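/- Conventions. For a locally compact Hausdorff étale groupoid $\mathcal G$ and a continuous $2$-cocycle $\omega:\mathcal G^{(2)}\to\mathbb T$, i.e. $\omega(g,hk)\,\omega(h,k)=\omega(gh,k)\,\omega(g,h)$, let $C_c(\mathcal G,\omega)$ be the $*$-algebra $C_c(\mathcal G)$ with $(\phi*\psi)(g)=\sum_{hk=g}\phi(h)\psi(k)\omega(h,k)$ and $\psi^*(g)=\overline{\psi(g^{-1})\omega(g,g^{-1})}$. Its completion in the supremum of the norms $\|\pi(\cdot)\|$ over all $*$-homomorphisms $\pi$ to $C^*$-algebras is the full algebra $C^*(\mathcal G,\omega)$; its completion in the supremum over the units $u$ of the norms of the left regular representations on $\ell^2(\mathcal G_u)$ is the reduced algebra $C^*_r(\mathcal G,\omega)$. If $\omega\equiv1$ it is omitted. Discrete groups are groupoids with one unit. If a discrete group $K$ acts by homeomorphisms on $X$, then $K\rtimes X=\{(k,x)\}$ is the transformation groupoid with $r(k,x)=k.x$, $s(k,x)=x$ and $(k,k'.x)(k',x)=(kk',x)$. Every isomorphism below between algebras $C^*(\cdot)$ of groupoids is asserted both for the full algebras and for the reduced algebras. (1) Let $H$ and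 $K$ be discrete Abelian groups, $\beta:K\to\mathrm{Aut}(H)$ an action, $G=H\rtimes_\beta K$, and $\omega$ a $\mathbb T$-valued $2$-cocycle on $G$ with $\omega|_H\equiv1$ and $\omega|_K\equiv1$. Then $$(k.x)(h)=\omega((0,-k),(h,0))\,\omega((\beta_{-k}(h),-k),(0,k))\,x(\beta_{-k}(h))\qquad(k\in K,\ x\in\widehat H,\ h\in H)$$ defines an action of $K$ on $\widehat H$ by homeomorphisms, and $C^*(G,\omega)\cong C^*(K\rtimes\widehat H)$ for this action. (2) Let $\theta\in\mathbb R$. Then $\omega_\theta((h,k),(h',k'))=e^{2\pi i\theta kh'}$ is a $2$-cocycle on $\mathbb Z\times\mathbb Z$; the full algebra $C^*(\mathbb Z^2,\omega_\theta)$ is isomorphic to the rotation algebra $A_\theta$, the universal unital $C^*$-algebra generated by two unitaries $U,V$ with $UV=e^{2\pi i\theta}VU$; and $C^*(\mathbb Z^2,\omega_\theta)\cong C^*(\mathbb Z\rtimes\mathbb T)$ for the action $k.z=e^{-2\pi i\theta k}z$. (3) Let $N\ge1$ be an integer and let $(\alpha_n)_{n\ge0}$ be real numbers with $\alpha_0\in[0,1)$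 such that for every $n$ there is $k_n\in\{0,\dots,N-1\}$ with $N\alpha_{n+1}=\alpha_n+k_n$. Let $\mathscr S_N=\{(z_n)_{n\ge0}\in\mathbb T^{\mathbb N}: z_{n+1}^N=z_n\text{ for all }n\}$. Then $$\omega_\alpha\left(\left(\tfrac p{N^h},\tfrac q{N^k}\right),\left(\tfrac r{N^j},\tfrac s{N^\ell}\right)\right)=e^{2\pi i\alpha_{h+\ell}ps}$$ is a well-defined $2$-cocycle on the discrete group $\mathbb Z[\frac1N]\times\mathbb Z[\frac1N]$, the formula $\left(\frac p{N^\ell}.(z_n)\right)_n=\left(e^{2\pi i\alpha_{n+\ell}p}z_n\right)_n$ defines an action of $\mathbb Z[\frac1N]$ on $\mathscr S_N$ by homeomorphisms, and the noncommutative solenoid satisfies $C^*(\mathbb Z[\frac1N]\times\mathbb Z[\frac1N],\omega_\alpha)\cong C^*(\mathbb Z[\frac1N]\rtimes\mathscr S_N)$ for this action. -/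

import Mathlib

open scoped ENNReal SemidirectProduct

universe u v w

noncomputable section

namespace GroupoidCStar

/-! ### Locally compact Hausdorff étale groupoids -/

/-- A locally compact Hausdorff étale groupoid.  The set of units is `{x | src x = x}`, and the
product `mul a b` is only meaningful for composable pairs, that is when `src a = rng b`. -/
structure EtaleGroupoid where
  carrier : Type u
  [top : TopologicalSpace carrier]
  [t2 : T2Space carrier]
  [locallyCompact : LocallyCompactSpace carrier]
  src : carrier → carrier
  rng : carrier → carrier
  mul : carrier → carrier → carrier
  inv : carrier → carrier
  src_src : ∀ a, src (src a) = src a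
  rng_src : ∀ a, rng (src a) = src a
  src_rng : ∀ a, src (rng a) = rng a
  rng_rng : ∀ a, rng (rng a) = rng a
  src_mul : ∀ a b, src a = rng b → src (mul a b) = src b
  rng_mul : ∀ a b, src a = rng b → rng (mul a b) = rng a
  mul_assoc : ∀ a b c, src a = rng b → src b = rng c → mul (mul a b) c = mul a (mul b c)
  mul_src : ∀ a, mul a (src a) = a
  rng_mul_self : ∀ a, mul (rng a) a = a
  src_inv : ∀ a, src (inv a) = rng a
  rng_inv : ∀ a, rng (inv a) = src a
  mul_inv : ∀ a, mul a (inv a) = rng a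
  inv_mul : ∀ a, mul (inv a) a = src a
  continuousOn_mul :
    ContinuousOn (fun p : carrier × carrier => mul p.1 p.2) {p | src p.1 = rng p.2}
  continuous_inv : Continuous inv
  isLocalHomeomorph_rng : IsLocalHomeomorph rng

attribute [instance] EtaleGroupoid.top EtaleGroupoid.t2 EtaleGroupoid.locallyCompact

/-- A group with the discrete topology, seen as an étale groupoid with one unit. -/
abbrev ofGroup (G : Type u) [Group G] : EtaleGroupoid.{u} :=
  letI : TopologicalSpace G := ⊥
  haveI : DiscreteTopology G := ⟨rfl⟩
  { carrier := G
    src := fun _ => 1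
    rng := fun _ => 1
    mul := fun a b => a * b
    inv := fun a => a⁻¹
    src_src := fun _ => rfl
    rng_src := fun _ => rfl
    src_rng := fun _ => rfl
    rng_rng := fun _ => rfl
    src_mul := fun _ _ _ => rfl
    rng_mul := fun _ _ _ => rfl
    mul_assoc := fun a b c _ _ => _root_.mul_assoc a b c
    mul_src := fun a => mul_one a
    rng_mul_self := fun a => one_mul a
    src_inv := fun _ => rfl
    rng_inv := fun _ => rfl
    mul_inv := fun a => mul_inv_cancel a
    inv_mul := fun a => inv_mul_cancel a
    continuousOn_mul := continuous_of_discreteTopology.continuousOn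
    continuous_inv := continuous_of_discreteTopology
    isLocalHomeomorph_rng := by
      refine IsLocalHomeomorph.mk _ fun a => ?_
      let e : OpenPartialHomeomorph G G :=
        { toFun := fun _ => 1
          invFun := fun _ => a
          source := {a}
          target := {1}
          map_source' := by simp
          map_target' := by simp
          left_inv' := by simp
          right_inv' := by simp
          open_source := isOpen_discrete _
          open_target := isOpen_discrete _
          continuousOn_toFun := continuousOn_const
          continuousOn_invFun := continuousOn_const }
      exact ⟨e, rfl, fun _ _ => rfl⟩ }

/-- The transformation groupoid `K ⋊ X = {(k, x)}` of an action `α` of a discrete group `K` by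
homeomorphisms of `X`: `r (k, x) = (1, k.x)`, `s (k, x) = (1, x)`,
`(k, k'.x) (k', x) = (k k', x)` and `(k, x)⁻¹ = (k⁻¹, k.x)`. -/
abbrev transformationGroupoid (K : Type v) [Group K] (X : Type u) [TopologicalSpace X] [T2Space X]
    [LocallyCompactSpace X] (α : K →* (X ≃ₜ X)) : EtaleGroupoid.{max u v} :=
  letI : TopologicalSpace K := ⊥
  haveI : DiscreteTopology K := ⟨rfl⟩
  { carrier := K × X
    src := fun a => (1, a.2)
    rng := fun a => (1, α a.1 a.2)
    mul := fun a b => (a.1 * b.1, b.2)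
    inv := fun a => (a.1⁻¹, α a.1 a.2)
    src_src := fun _ => rfl
    rng_src := fun a => by simp
    src_rng := fun _ => rfl
    rng_rng := fun a => by simp
    src_mul := fun _ _ _ => rfl
    rng_mul := fun a b h => by
      have h2 : a.2 = α b.1 b.2 := (Prod.ext_iff.1 h).2
      simp [h2]
    mul_assoc := fun a b c _ _ => by simp [_root_.mul_assoc]
    mul_src := fun a => by simp
    rng_mul_self := fun a => by simp
    src_inv := fun _ => rfl
    rng_inv := fun a => by simp [← Homeomorph.mul_apply]
    mul_inv := fun a => by simp
    inv_mul := fun a => by simp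
    continuousOn_mul := by
      apply Continuous.continuousOn
      fun_prop
    continuous_inv := by
      refine Continuous.prodMk (by fun_prop) ?_
      exact continuous_prod_of_discrete_left.2 fun k => (α k).continuous
    isLocalHomeomorph_rng := by
      refine IsLocalHomeomorph.mk _ fun a => ?_
      let e : OpenPartialHomeomorph (K × X) (K × X) :=
        { toFun := fun b => (1, α a.1 b.2)
          invFun := fun b => (a.1, (α a.1).symm b.2)
          source := {b | b.1 = a.1}
          target := {b | b.1 = 1}
          map_source' := by simp
          map_target' := by simp
          left_inv' := by
            rintro ⟨k, x⟩ h
            have h1 : k = a.1 := h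
            simp [h1]
          right_inv' := by
            rintro ⟨k, x⟩ h
            have h1 : k = 1 := h
            simp [h1]
          open_source := (isOpen_discrete {a.1}).preimage continuous_fst
          open_target := (isOpen_discrete {1}).preimage continuous_fst
          continuousOn_toFun :=
            (continuous_const.prodMk ((α a.1).continuous.comp continuous_snd)).continuousOn
          continuousOn_invFun :=
            (continuous_const.prodMk ((α a.1).symm.continuous.comp continuous_snd)).continuousOn }
      refine ⟨e, rfl, ?_⟩
      rintro ⟨k, x⟩ h
      have h1 : k = a.1 := h
      subst h1
      rfl }

/-! ### Circle-valued 2-cocycles and the twisted convolution product -/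

/-- A continuous 2-cocycle on a groupoid (only its values on composable pairs matter). -/
structure TwoCocycle (𝒢 : EtaleGroupoid.{u}) where
  toFun : 𝒢.carrier → 𝒢.carrier → Circle
  continuousOn_toFun : ContinuousOn (fun p : 𝒢.carrier × 𝒢.carrier => toFun p.1 p.2)
    {p | 𝒢.src p.1 = 𝒢.rng p.2}
  cocycle : ∀ a b c, 𝒢.src a = 𝒢.rng b → 𝒢.src b = 𝒢.rng c →
    toFun a (𝒢.mul b c) * toFun b c = toFun (𝒢.mul a b) c * toFun a b

instance (𝒢 : EtaleGroupoid.{u}) :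
    CoeFun (TwoCocycle 𝒢) (fun _ => 𝒢.carrier → 𝒢.carrier → Circle) :=
  ⟨TwoCocycle.toFun⟩

/-- The trivial 2-cocycle. -/
def TwoCocycle.trivial (𝒢 : EtaleGroupoid.{u}) : TwoCocycle 𝒢 where
  toFun := fun _ _ => 1
  continuousOn_toFun := continuousOn_const
  cocycle := fun _ _ _ _ _ => rfl

variable {𝒢 : EtaleGroupoid.{u}}

/-- Twisted convolution: `(f * g)(γ) = ∑ f(a) g(b) ω(a, b)` over the composable pairs `(a, b)`
with `a b = γ`. The sum has finitely many nonzero terms when `f` is compactly supported. -/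
def conv (ω : TwoCocycle 𝒢) (f g : 𝒢.carrier → ℂ) (γ : 𝒢.carrier) : ℂ :=
  ∑ᶠ p : {p : 𝒢.carrier × 𝒢.carrier // 𝒢.src p.1 = 𝒢.rng p.2 ∧ 𝒢.mul p.1 p.2 = γ},
    f p.1.1 * g p.1.2 * (ω p.1.1 p.1.2 : ℂ)

/-- Twisted involution: `f^*(γ)` is the conjugate of `f(γ⁻¹) ω(γ, γ⁻¹)`. -/
def invol (ω : TwoCocycle 𝒢) (f : 𝒢.carrier → ℂ) (γ : 𝒢.carrier) : ℂ :=
  starRingEnd ℂ (f (𝒢.inv γ) * (ω γ (𝒢.inv γ) : ℂ))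

/-! ### The full and the reduced twisted groupoid C*-algebras -/

/-- The C*-algebra of bounded families `(a_i)_i` with `a_i ∈ B_i`, in the sup norm. -/
abbrev BddFamily {I : Type v} (B : I → Type u) [∀ i, NonUnitalCStarAlgebra (B i)] :
    Type (max u v) := lp B ∞

instance {I : Type v} (B : I → Type u) [∀ i, NonUnitalCStarAlgebra (B i)] :
    NonUnitalCStarAlgebra (BddFamily B) where

/-- The closed *-subalgebra generated by a set of bounded families. -/
def generated {I : Type v} {B : I → Type u} [∀ i, NonUnitalCStarAlgebra (B i)]
    (S : Set (BddFamily B)) : NonUnitalStarSubalgebra ℂ (BddFamily B) :=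
  (NonUnitalStarAlgebra.adjoin ℂ S).topologicalClosure

/-- The closed *-subalgebra generated by a set of bounded families, as a C*-algebra. -/
def GeneratedCStar {I : Type v} {B : I → Type u} [∀ i, NonUnitalCStarAlgebra (B i)]
    (S : Set (BddFamily B)) : Type (max u v) := generated S

instance {I : Type v} {B : I → Type u} [∀ i, NonUnitalCStarAlgebra (B i)]
    (S : Set (BddFamily B)) : NonUnitalCStarAlgebra (GeneratedCStar S) :=
  haveI : IsClosed (generated S : Set (BddFamily B)) :=
    NonUnitalStarSubalgebra.isClosed_topologicalClosure _
  inferInstanceAs (NonUnitalCStarAlgebra (generated S))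

/-- A *-homomorphism from the convolution *-algebra `C_c(𝒢, ω)` to a C*-algebra `B`. -/
structure ConvRep (ω : TwoCocycle 𝒢) (B : Type v) [CStarAlgebra B] where
  toLin : CompactlySupportedContinuousMap 𝒢.carrier ℂ →ₗ[ℂ] B
  map_conv : ∀ f g h : CompactlySupportedContinuousMap 𝒢.carrier ℂ,
    ⇑h = conv ω f g → toLin h = toLin f * toLin g
  map_invol : ∀ f h : CompactlySupportedContinuousMap 𝒢.carrier ℂ,
    ⇑h = invol ω f → toLin h = star (toLin f)

/-- The *-homomorphisms from `C_c(𝒢, ω)` to C*-algebras. -/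
structure BundledRep (ω : TwoCocycle 𝒢) where
  target : Type u
  [inst : CStarAlgebra target]
  rep : ConvRep ω target

attribute [instance] BundledRep.inst

/-- The full twisted groupoid C*-algebra `C*(𝒢, ω)`: the completion of `C_c(𝒢, ω)` in the norm
`‖f‖ = sup ‖π f‖`, where `π` runs over all *-homomorphisms to C*-algebras. It is realised as the
closed *-algebra generated by the families `(π f)_π`, in the C*-algebra of all bounded families
`(a_π)_π`. -/
abbrev FullCStar (ω : TwoCocycle 𝒢) : Type (u + 1) :=
  GeneratedCStar (B := fun π : BundledRep ω => π.target)
    {a | ∃ f : CompactlySupportedContinuousMap 𝒢.carrier ℂ,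
      ∀ π : BundledRep ω, a π = π.rep.toLin f}

/-- The unit space. -/
abbrev Units (𝒢 : EtaleGroupoid.{u}) : Type u := {x : 𝒢.carrier // 𝒢.src x = x}

/-- The source fibre `𝒢_x`. -/
abbrev Fibre (x : Units 𝒢) : Type u := {γ : 𝒢.carrier // 𝒢.src γ = x}

/-- The Hilbert space `ℓ²(𝒢_x)`. -/
abbrev FibreSpace (x : Units 𝒢) : Type u := lp (fun _ : Fibre x => ℂ) 2

/-- The bounded operator `T` on `ℓ²(𝒢_x)` is the value at `f` of the left regular
representation, `T ξ = f * ξ`. -/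
def IsLeftRegular (ω : TwoCocycle 𝒢) (x : Units 𝒢)
    (f : CompactlySupportedContinuousMap 𝒢.carrier ℂ)
    (T : FibreSpace x →L[ℂ] FibreSpace x) : Prop :=
  ∀ (ξ : FibreSpace x) (γ : Fibre x),
    T ξ γ = conv ω f (Function.extend Subtype.val (ξ : Fibre x → ℂ) 0) γ

/-- The reduced twisted groupoid C*-algebra `C*_r(𝒢, ω)`: the completion of `C_c(𝒢, ω)` in the
norm `‖f‖ = sup ‖π_x f‖`, where `π_x` is the left regular representation on `ℓ²(𝒢_x)` and `x`
runs over the units. It is realised as the closed *-algebra generated by the families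
`(π_x f)_x`. -/
abbrev ReducedCStar (ω : TwoCocycle 𝒢) : Type u :=
  GeneratedCStar (B := fun x : Units 𝒢 => FibreSpace x →L[ℂ] FibreSpace x)
    {a | ∃ f : CompactlySupportedContinuousMap 𝒢.carrier ℂ,
      ∀ x : Units 𝒢, IsLeftRegular ω x f (a x)}

/-- The twisted groupoid C*-algebras of `(𝒢, ω)` and `(ℋ, η)` are isomorphic, the full ones as
well as the reduced ones. -/
def CStarIso {𝒢 : EtaleGroupoid.{u}} (ω : TwoCocycle 𝒢) {ℋ : EtaleGroupoid.{v}}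
    (η : TwoCocycle ℋ) : Prop :=
  Nonempty (FullCStar ω ≃⋆ₐ[ℂ] FullCStar η) ∧ Nonempty (ReducedCStar ω ≃⋆ₐ[ℂ] ReducedCStar η)

/-! ### Rotation algebras and noncommutative solenoids -/

/-- `A` is the rotation algebra `A_θ`: the universal unital C*-algebra generated by two unitaries
`U`, `V` with `U V = e^{2πiθ} V U`. -/
def IsRotationAlgebra (θ : ℝ) (A : Type v) [CStarAlgebra A] : Prop :=
  ∃ U ∈ unitary A, ∃ V ∈ unitary A,
    U * V = (Circle.exp (2 * Real.pi * θ) : ℂ) • (V * U) ∧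
    (StarAlgebra.adjoin ℂ {U, V}).topologicalClosure = ⊤ ∧
    ∀ (B : Type w) [CStarAlgebra B], ∀ U' ∈ unitary B, ∀ V' ∈ unitary B,
      U' * V' = (Circle.exp (2 * Real.pi * θ) : ℂ) • (V' * U') →
      ∃! φ : A →⋆ₐ[ℂ] B, φ U = U' ∧ φ V = V'

/-- The ring `ℤ[1/N]` (only its additive group is used). -/
abbrev ZInv (N : ℕ) : Subalgebra ℤ ℚ := Algebra.adjoin ℤ {(N : ℚ)⁻¹}

/-- The solenoid `{(z_n)_n : z_{n+1}^N = z_n for all n}`, in the topology of pointwise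
convergence. -/
abbrev Solenoid (N : ℕ) : Type := {z : ℕ → Circle // ∀ n, z (n + 1) ^ N = z n}

instance (N : ℕ) : CompactSpace (Solenoid N) := by
  have h : IsClosed {z : ℕ → Circle | ∀ n, z (n + 1) ^ N = z n} := by
    rw [Set.ofPred_forall]
    exact isClosed_iInter fun n => isClosed_eq (by fun_prop) (by fun_prop)
  exact isCompact_iff_compactSpace.1 h.isCompact

end GroupoidCStar

end

open GroupoidCStar

universe w'

noncomputable section

namespace GroupoidCStar

/-! ### Projective unitary families -/

/-! The canonical elements of the twisted group algebra satisfy `U a * U b = ω(a,b) U (ab)`. Since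
`ω` is trivial on `H` and on `K`, they restrict to genuine representations of both groups. By
Gelfand duality the one of `H` extends to a *-homomorphism `M` on `C(X)`, where `X` is the dual of
`H`. Moving `U h` past `v k = U k` costs the scalar `conjCocycle ω k h` and replaces `h` by `β k⁻¹
h`, which is exactly how the action in the theorem moves characters. So `(v, M)` is a covariant pair
(`ProjRep.exists_covPair`). Conversely, the products `v k * M (χ h)`, rescaled by the conjugate of
`ω(k,h)`, satisfy the relations of the `U a` (`apply_mul_section`, `CovPair.toProj`).

Full algebras: the two convolution algebras thus have the same representations, hence the same norm
on trigonometric polynomials. These are dense by Stone–Weierstrass, so the completions agree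
(`nonempty_generatedCStar_equiv`).

Reduced algebras: the vector functional at `δ_1` of the left regular representation is the invariant
mean of `X` composed with the conditional expectation `F ↦ F 1`. For the regular representation at a
point `x` of the transformation groupoid, evaluation at `x` replaces the mean. A bound `‖T‖ ≤ C`
says that `C² E(F*F) - E((TF)*(TF))` is nonnegative for all `F`, either in mean or at every point.
The two conditions agree because the mean is positive and faithful and `F` may be multiplied by any
function on `X` (`norm_le_iff_forall_orbit`).

Only the pairing of `H` with a compact space enters (`IsDualPairing`), so the Pontryagin dual, the
circle and the solenoid are treated at once; the last two use bicharacters on direct products. For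
the rotation algebra, two unitaries with the rotation relation give a projective family of `ℤ × ℤ`.
The universal property reaches C*-algebras in every universe because the algebra generated by a
countable family is separable, hence small. -/

theorem conj_mul_coe_circle (z : Circle) : starRingEnd ℂ (z : ℂ) * z = 1 := by
  rw [← Circle.coe_inv_eq_conj, ← Circle.coe_mul, inv_mul_cancel, Circle.coe_one]

theorem coe_mul_conj_circle (z : Circle) : (z : ℂ) * starRingEnd ℂ (z : ℂ) = 1 := by
  rw [mul_comm, conj_mul_coe_circle]

/-- A family of partial isometries in a C*-algebra satisfying the relations of the canonical
basis of the twisted group algebra. -/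
structure ProjRep {G : Type u} [Group G] (ω : TwoCocycle (ofGroup G)) (B : Type w)
    [NonUnitalCStarAlgebra B] where
  U : G → B
  U_mul : ∀ a b : G, U a * U b = (ω a b : ℂ) • U (a * b)
  star_U : ∀ a : G, star (U a) = starRingEnd ℂ (ω a⁻¹ a : ℂ) • U a⁻¹

namespace ProjRep

variable {G : Type u} [Group G] {ω : TwoCocycle (ofGroup G)} {B : Type w}
  [NonUnitalCStarAlgebra B]

/-- The linear extension to finitely supported functions. -/
def lin (R : ProjRep ω B) : (G →₀ ℂ) →ₗ[ℂ] B := Finsupp.linearCombination ℂ R.U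

@[simp] theorem lin_single (R : ProjRep ω B) (a : G) (z : ℂ) :
    R.lin (Finsupp.single a z) = z • R.U a := by simp [lin]

theorem range_lin (R : ProjRep ω B) : LinearMap.range R.lin = Submodule.span ℂ (Set.range R.U) :=
  Finsupp.range_linearCombination ℂ

theorem star_mul_self (R : ProjRep ω B) (a : G) : star (R.U a) * R.U a = R.U 1 := by
  rw [R.star_U, smul_mul_assoc, R.U_mul, smul_smul, conj_mul_coe_circle, one_smul, inv_mul_cancel]

/-- All `U a` have the same initial projection `U 1`, so `‖U a‖² = ‖U 1‖`; the case `a = 1` gives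
the bound. Being uniform, it allows arbitrary collections of families to be combined into a bounded
one. -/
theorem norm_U_le (R : ProjRep ω B) (a : G) : ‖R.U a‖ ≤ 1 := by
  have h (b : G) : ‖R.U b‖ * ‖R.U b‖ = ‖R.U 1‖ := by
    rw [← CStarRing.norm_star_mul_self, R.star_mul_self]
  have h1 := h 1
  have h2 := h a
  have h3 : ‖R.U 1‖ ≤ 1 := by nlinarith [norm_nonneg (R.U 1)]
  nlinarith [norm_nonneg (R.U a)]

/-- The span of the family, as a *-subalgebra. -/
def spanAlg (R : ProjRep ω B) : NonUnitalStarSubalgebra ℂ B where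
  carrier := LinearMap.range R.lin
  add_mem' := add_mem
  zero_mem' := zero_mem _
  smul_mem' c _ := (LinearMap.range R.lin).smul_mem c
  mul_mem' {x y} hx hy := by
    simp only [SetLike.mem_coe, range_lin] at hx hy ⊢
    induction hx using Submodule.span_induction with
    | zero => simp
    | add a b _ _ ha hb => rw [add_mul]; exact add_mem ha hb
    | smul c a _ ha => rw [smul_mul_assoc]; exact Submodule.smul_mem _ _ ha
    | mem a ha =>
      obtain ⟨a, rfl⟩ := ha
      induction hy using Submodule.span_induction with
      | zero => simp
      | add a b _ _ ha hb => rw [mul_add]; exact add_mem ha hb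
      | smul c a _ ha => rw [mul_smul_comm]; exact Submodule.smul_mem _ _ ha
      | mem b hb =>
        obtain ⟨b, rfl⟩ := hb
        rw [R.U_mul]
        exact Submodule.smul_mem _ _ (Submodule.subset_span ⟨_, rfl⟩)
  star_mem' {x} hx := by
    simp only [SetLike.mem_coe, range_lin] at hx ⊢
    induction hx using Submodule.span_induction with
    | zero => simp
    | add a b _ _ ha hb => rw [star_add]; exact add_mem ha hb
    | smul c a _ ha => rw [star_smul]; exact Submodule.smul_mem _ _ ha
    | mem a ha =>
      obtain ⟨a, rfl⟩ := ha
      rw [R.star_U]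
      exact Submodule.smul_mem _ _ (Submodule.subset_span ⟨_, rfl⟩)

theorem mem_spanAlg (R : ProjRep ω B) {x : B} : x ∈ R.spanAlg ↔ ∃ c, R.lin c = x := Iff.rfl

/-- The C*-algebra generated by the family. -/
abbrev alg (R : ProjRep ω B) : NonUnitalStarSubalgebra ℂ B := R.spanAlg.topologicalClosure

/-- The image of a projective family under a *-homomorphism. -/
def map {C : Type w'} [NonUnitalCStarAlgebra C] (φ : B →⋆ₙₐ[ℂ] C) (R : ProjRep ω B) :
    ProjRep ω C where
  U a := φ (R.U a)
  U_mul a b := by rw [← map_mul, R.U_mul, map_smul]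
  star_U a := by rw [← map_star, R.star_U, map_smul]

theorem map_lin {C : Type w'} [NonUnitalCStarAlgebra C] (φ : B →⋆ₙₐ[ℂ] C) (R : ProjRep ω B)
    (c : G →₀ ℂ) : (R.map φ).lin c = φ (R.lin c) := by
  induction c using Finsupp.induction_linear with
  | zero => simp
  | add f g hf hg => simp only [map_add, hf, hg]
  | single a z => simp [map]

/-- The product of two projective families. -/
def prod {C : Type w'} [NonUnitalCStarAlgebra C] (R : ProjRep ω B) (S : ProjRep ω C) :
    ProjRep ω (B × C) where
  U a := (R.U a, S.U a)
  U_mul a b := by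
    refine Prod.ext ?_ ?_
    · exact R.U_mul a b
    · exact S.U_mul a b
  star_U a := by
    refine Prod.ext ?_ ?_
    · exact R.star_U a
    · exact S.star_U a

theorem prod_lin {C : Type w'} [NonUnitalCStarAlgebra C] (R : ProjRep ω B) (S : ProjRep ω C)
    (c : G →₀ ℂ) : (R.prod S).lin c = (R.lin c, S.lin c) := by
  induction c using Finsupp.induction_linear with
  | zero => simp only [map_zero, Prod.mk_zero_zero]
  | add f g hf hg => simp only [map_add, hf, hg, Prod.mk_add_mk]
  | single a z => simp [prod]

/-- The product of a bounded collection of projective families. -/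
def family {I : Type v} {B : I → Type w} [∀ i, NonUnitalCStarAlgebra (B i)]
    (R : ∀ i, ProjRep ω (B i)) : ProjRep ω (BddFamily B) where
  U a := ⟨fun i => (R i).U a, memℓp_infty ⟨1, by
    rintro _ ⟨i, rfl⟩
    exact (R i).norm_U_le a⟩⟩
  U_mul a b := lp.ext <| funext fun i => (R i).U_mul a b
  star_U a := lp.ext <| funext fun i => (R i).star_U a

theorem family_lin {I : Type v} {B : I → Type w} [∀ i, NonUnitalCStarAlgebra (B i)]
    (R : ∀ i, ProjRep ω (B i)) (c : G →₀ ℂ) (i : I) : (family R).lin c i = (R i).lin c := by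
  induction c using Finsupp.induction_linear with
  | zero => simp
  | add f g hf hg => simp only [map_add, lp.coeFn_add, Pi.add_apply, hf, hg]
  | single a z => simp [family]

end ProjRep

/-! ### Isomorphisms between generated C*-algebras -/

/-- The first coordinate maps the C*-algebra generated by a product family isomorphically, if
the two coordinates have the same norm. -/
theorem nonempty_algEquiv_of_norm_eq {G : Type u} [Group G] {ω : TwoCocycle (ofGroup G)}
    {A : Type v} {B : Type w} [NonUnitalCStarAlgebra A] [NonUnitalCStarAlgebra B]
    (R : ProjRep ω A) (φ : A →⋆ₙₐ[ℂ] B) (hφ : ∀ c, ‖φ (R.lin c)‖ = ‖R.lin c‖) :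
    Nonempty (R.alg ≃⋆ₐ[ℂ] (R.map φ).alg) := by
  have hcont : Continuous φ := by
    refine AddMonoidHomClass.continuous_of_bound φ 1 fun x => ?_
    rw [one_mul]; exact NonUnitalStarAlgHom.norm_apply_le φ x
  have hnorm : ∀ x ∈ R.alg, ‖φ x‖ = ‖x‖ := by
    have hcl : IsClosed {x : A | ‖φ x‖ = ‖x‖} := isClosed_eq (by fun_prop) (by fun_prop)
    have hsub : (R.spanAlg : Set A) ⊆ {x : A | ‖φ x‖ = ‖x‖} := by
      rintro x ⟨c, rfl⟩
      exact hφ c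
    exact fun x hx => closure_minimal hsub hcl hx
  let ψ : R.alg →⋆ₙₐ[ℂ] B := φ.comp (NonUnitalStarSubalgebraClass.subtype R.alg)
  have hiso : Isometry ψ := AddMonoidHomClass.isometry_of_norm ψ fun x => hnorm x x.2
  -- An isometric image of a complete space is closed, so the range contains the closure of the
  -- image of the span.
  have hclosed : IsClosed (Set.range ψ) := by
    have : CompleteSpace R.alg :=
      (NonUnitalStarSubalgebra.isClosed_topologicalClosure R.spanAlg).completeSpace_coe
    exact hiso.isClosedEmbedding.isClosed_range
  have hrange : Set.range ψ = ((R.map φ).alg : Set B) := by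
    apply Set.Subset.antisymm
    · rintro _ ⟨x, rfl⟩
      have : Set.MapsTo φ (R.spanAlg : Set A) ((R.map φ).spanAlg : Set B) := by
        rintro _ ⟨c, rfl⟩
        exact ⟨c, R.map_lin φ c⟩
      exact this.closure hcont x.2
    · refine closure_minimal ?_ hclosed
      rintro _ ⟨c, rfl⟩
      exact ⟨⟨R.lin c, R.spanAlg.le_topologicalClosure ⟨c, rfl⟩⟩, (R.map_lin φ c).symm⟩
  let χ : R.alg →⋆ₙₐ[ℂ] (R.map φ).alg :=
    NonUnitalStarAlgHom.codRestrict ψ _ fun x => (hrange ▸ ⟨x, rfl⟩ : ψ x ∈ ((R.map φ).alg : Set B))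
  refine ⟨StarAlgEquiv.ofBijective χ ⟨?_, ?_⟩⟩
  · exact fun x y h => hiso.injective (congrArg Subtype.val h)
  · rintro ⟨y, hy⟩
    obtain ⟨x, hx⟩ : y ∈ Set.range ψ := hrange ▸ hy
    exact ⟨x, Subtype.ext hx⟩

/-- Projective families with the same norms generate isomorphic C*-algebras. -/
theorem nonempty_alg_equiv_alg {G : Type u} [Group G] {ω : TwoCocycle (ofGroup G)}
    {A : Type v} {B : Type w} [NonUnitalCStarAlgebra A] [NonUnitalCStarAlgebra B]
    (R : ProjRep ω A) (S : ProjRep ω B) (h : ∀ c, ‖R.lin c‖ = ‖S.lin c‖) :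
    Nonempty (R.alg ≃⋆ₐ[ℂ] S.alg) := by
  -- Inside the product both coordinate projections are isometric on the span, so the correspondence
  -- `R.lin c ↦ S.lin c` never has to be shown well defined.
  have hnorm (c) : ‖(R.prod S).lin c‖ = ‖R.lin c‖ := by
    rw [ProjRep.prod_lin, Prod.norm_def, ← h, max_self]
  obtain ⟨e⟩ := nonempty_algEquiv_of_norm_eq (R.prod S) (NonUnitalStarAlgHom.fst ℂ A B)
    fun c => by rw [hnorm, ProjRep.prod_lin]; rfl
  obtain ⟨f⟩ := nonempty_algEquiv_of_norm_eq (R.prod S) (NonUnitalStarAlgHom.snd ℂ A B)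
    fun c => by rw [hnorm, ProjRep.prod_lin, h]; rfl
  exact ⟨e.symm.trans f⟩

/-- A generated C*-algebra whose generators lie between the span of a projective family and its
closure. -/
theorem ProjRep.generated_eq {G : Type u} [Group G] {ω : TwoCocycle (ofGroup G)} {I : Type v}
    {B : I → Type w} [∀ i, NonUnitalCStarAlgebra (B i)] (R : ProjRep ω (BddFamily B))
    (S : Set (BddFamily B)) (h₁ : ∀ c, R.lin c ∈ S) (h₂ : S ⊆ R.alg) :
    generated S = R.alg := by
  apply le_antisymm
  · refine NonUnitalStarSubalgebra.topologicalClosure_minimal _ ?_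
      (NonUnitalStarSubalgebra.isClosed_topologicalClosure _)
    exact NonUnitalStarAlgebra.adjoin_le h₂
  · refine NonUnitalStarSubalgebra.topologicalClosure_mono ?_
    rintro _ ⟨c, rfl⟩
    exact NonUnitalStarAlgebra.subset_adjoin ℂ S (h₁ c)

theorem nonempty_generated_equiv {G : Type u} [Group G] {ω : TwoCocycle (ofGroup G)}
    {I J : Type*} {A : I → Type*} {B : J → Type*} [∀ i, NonUnitalCStarAlgebra (A i)]
    [∀ i, NonUnitalCStarAlgebra (B i)] (R : ProjRep ω (BddFamily A)) (S : ProjRep ω (BddFamily B))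
    (T : Set (BddFamily A)) (T' : Set (BddFamily B)) (h₁ : ∀ c, R.lin c ∈ T) (h₂ : T ⊆ R.alg)
    (h₁' : ∀ c, S.lin c ∈ T') (h₂' : T' ⊆ S.alg) (h : ∀ c, ‖R.lin c‖ = ‖S.lin c‖) :
    Nonempty (GeneratedCStar T ≃⋆ₐ[ℂ] GeneratedCStar T') := by
  have e := nonempty_alg_equiv_alg R S h
  rw [← R.generated_eq T h₁ h₂, ← S.generated_eq T' h₁' h₂'] at e
  exact e

/-! ### Characters -/

/-- A compact space identified with the characters of `H` by `x ↦ (h ↦ χ h x)`. -/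
structure IsDualPairing {H : Type u} [CommGroup H] {X : Type w} [TopologicalSpace X]
    (χ : H →* C(X, Circle)) : Prop where
  injective : ∀ x y : X, (∀ h, χ h x = χ h y) → x = y
  surjective : ∀ φ : H →* Circle, ∃ x, ∀ h, χ h x = φ h

/-- A circle-valued function as a complex-valued function. -/
def toComplex {X : Type w} [TopologicalSpace X] (f : C(X, Circle)) : C(X, ℂ) :=
  ⟨fun x => (f x : ℂ), by fun_prop⟩

@[simp] theorem toComplex_apply {X : Type w} [TopologicalSpace X] (f : C(X, Circle)) (x : X) :
    toComplex f x = (f x : ℂ) := rfl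

section Characters

variable {H : Type u} [CommGroup H] {X : Type w} [TopologicalSpace X] (χ : H →* C(X, Circle))

/-- The characters as complex-valued functions. -/
def chr (h : H) : C(X, ℂ) := toComplex (χ h)

theorem chr_apply (h : H) (x : X) : chr χ h x = (χ h x : ℂ) := rfl

theorem chr_one : chr χ 1 = 1 := by ext x; simp [chr]

theorem chr_mul (h h' : H) : chr χ (h * h') = chr χ h * chr χ h' := by ext x; simp [chr]

theorem star_chr (h : H) : star (chr χ h) = chr χ h⁻¹ := by
  ext x
  change starRingEnd ℂ (χ h x : ℂ) = (χ h⁻¹ x : ℂ)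
  rw [map_inv, ContinuousMap.inv_apply, Circle.coe_inv_eq_conj]

variable [CompactSpace X] {χ}

/-- Trigonometric polynomials are dense. -/
theorem IsDualPairing.span_chr_dense (hχ : IsDualPairing χ) :
    (Submodule.span ℂ (Set.range (chr χ))).topologicalClosure = ⊤ := by
  let S : StarSubalgebra ℂ C(X, ℂ) :=
    { carrier := Submodule.span ℂ (Set.range (chr χ))
      add_mem' := add_mem
      mul_mem' := fun {x y} hx hy => by
        simp only [SetLike.mem_coe] at hx hy ⊢
        have := Submodule.mul_mem_mul hx hy
        rw [Submodule.span_mul_span] at this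
        refine Submodule.span_mono ?_ this
        rintro _ ⟨_, ⟨a, rfl⟩, _, ⟨b, rfl⟩, rfl⟩
        exact ⟨a * b, chr_mul χ a b⟩
      algebraMap_mem' := fun r => by
        rw [Algebra.algebraMap_eq_smul_one, ← chr_one χ]
        exact Submodule.smul_mem _ _ (Submodule.subset_span ⟨1, rfl⟩)
      star_mem' := fun {x} hx => by
        simp only [SetLike.mem_coe] at hx ⊢
        induction hx using Submodule.span_induction with
        | zero => simp
        | add a b _ _ ha hb => rw [star_add]; exact add_mem ha hb
        | smul c a _ ha => rw [star_smul]; exact Submodule.smul_mem _ _ ha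
        | mem a ha =>
          obtain ⟨a, rfl⟩ := ha
          rw [star_chr]
          exact Submodule.subset_span ⟨_, rfl⟩ }
  have hsep : S.SeparatesPoints := by
    intro x y hxy
    have : ∃ h, χ h x ≠ χ h y := by
      by_contra hcon
      push Not at hcon
      exact hxy (hχ.injective x y hcon)
    obtain ⟨h, hh⟩ := this
    exact ⟨_, ⟨chr χ h, Submodule.subset_span ⟨h, rfl⟩, rfl⟩, fun e => hh (Circle.ext e)⟩
  have := ContinuousMap.starSubalgebra_topologicalClosure_eq_top_of_separatesPoints S hsep
  apply SetLike.coe_injective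
  exact congrArg (fun T : StarSubalgebra ℂ C(X, ℂ) => (T : Set C(X, ℂ))) this

/-- Density of trigonometric polynomials as an induction principle: a closed linear condition on
functions need only be checked on characters. -/
theorem IsDualPairing.eq_top (hχ : IsDualPairing χ) (p : Submodule ℂ C(X, ℂ))
    (hp : IsClosed (p : Set C(X, ℂ))) (h : ∀ a, chr χ a ∈ p) : p = ⊤ := by
  rw [eq_top_iff, ← hχ.span_chr_dense]
  refine Submodule.topologicalClosure_minimal _ ?_ hp
  rw [Submodule.span_le]
  rintro _ ⟨a, rfl⟩
  exact h a

/-- Continuous linear maps are determined by their values on characters. -/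
theorem IsDualPairing.clm_ext (hχ : IsDualPairing χ) {E : Type*} [NormedAddCommGroup E]
    [NormedSpace ℂ E] {f g : C(X, ℂ) →L[ℂ] E} (h : ∀ a, f (chr χ a) = g (chr χ a)) : f = g := by
  have : LinearMap.ker (f - g).toLinearMap = ⊤ :=
    hχ.eq_top _ (f - g).isClosed_ker fun a => by simp [h a]
  ext x : 1
  have hx : x ∈ LinearMap.ker (f - g).toLinearMap := this ▸ Submodule.mem_top
  simpa [sub_eq_zero] using hx

/-- A map into `X` is continuous as soon as its compositions with the characters are. -/
theorem IsDualPairing.continuous_iff (hχ : IsDualPairing χ) {Y : Type*} [TopologicalSpace Y]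
    (f : Y → X) (hf : ∀ h, Continuous fun y => χ h (f y)) : Continuous f := by
  let i : X → H → Circle := fun x h => χ h x
  -- Compactness of `X` makes this continuous injection into the Hausdorff space `H → Circle` an
  -- embedding, so `X` carries the topology of pointwise convergence.
  have hi : Topology.IsClosedEmbedding i :=
    Continuous.isClosedEmbedding (by fun_prop) fun x y h => hχ.injective x y (congrFun h)
  exact hi.isInducing.continuous_iff.2 (continuous_pi hf)

end Characters

/-- A non-unital *-homomorphism of C*-algebras as a continuous linear map. -/
def starHomCLM {A : Type v} {B : Type w} [NonUnitalCStarAlgebra A] [NonUnitalCStarAlgebra B]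
    (φ : A →⋆ₙₐ[ℂ] B) : A →L[ℂ] B :=
  (φ : A →ₗ[ℂ] B).mkContinuous 1 fun x => by
    rw [one_mul]; exact NonUnitalStarAlgHom.norm_apply_le φ x

@[simp] theorem starHomCLM_apply {A : Type v} {B : Type w} [NonUnitalCStarAlgebra A]
    [NonUnitalCStarAlgebra B] (φ : A →⋆ₙₐ[ℂ] B) (a : A) : starHomCLM φ a = φ a := rfl

/-- A unitary representation of an abelian group in a unital C*-algebra extends to the continuous
functions on the dual. -/
theorem IsDualPairing.exists_starAlgHom {H : Type u} [CommGroup H] {X : Type w}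
    [TopologicalSpace X] [CompactSpace X] {χ : H →* C(X, Circle)} (hχ : IsDualPairing χ)
    {B : Type v} [CStarAlgebra B] (V : H →* B) (hV : ∀ h, star (V h) = V h⁻¹) :
    ∃ Θ : C(X, ℂ) →⋆ₐ[ℂ] B, ∀ h, Θ (chr χ h) = V h := by
  let S : StarSubalgebra ℂ B := StarAlgebra.adjoin ℂ (Set.range V)
  have hcomm : ∀ a ∈ Set.range V, ∀ b ∈ Set.range V, a * b = b * a := by
    rintro _ ⟨a, rfl⟩ _ ⟨b, rfl⟩
    rw [← map_mul, mul_comm, map_mul]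
  have hcomm' : ∀ a ∈ Set.range V, ∀ b ∈ Set.range V, a * star b = star b * a := by
    rintro _ ⟨a, rfl⟩ _ ⟨b, rfl⟩
    rw [hV]
    exact hcomm _ ⟨_, rfl⟩ _ ⟨_, rfl⟩
  -- The `V h` commute with each other and with their adjoints, so the closed algebra that they
  -- generate is a commutative C*-algebra, to which Gelfand duality applies.
  have hS : IsMulCommutative S := StarAlgebra.isMulCommutative_adjoin ℂ hcomm hcomm'
  let T := S.topologicalClosure
  let _ : CommRing T := StarSubalgebra.commRingTopologicalClosure S hS.is_comm.comm
  have : IsClosed (T : Set B) := S.isClosed_topologicalClosure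
  let _ : CommCStarAlgebra T :=
    { (inferInstance : CStarAlgebra T) with mul_comm := mul_comm }
  have hmem (h : H) : V h ∈ T := S.le_topologicalClosure (StarAlgebra.subset_adjoin ℂ _ ⟨h, rfl⟩)
  let W (h : H) : T := ⟨V h, hmem h⟩
  have hW1 : W 1 = 1 := Subtype.ext (map_one V)
  have hWmul (a b : H) : W (a * b) = W a * W b := Subtype.ext (map_mul V a b)
  have hWstar (a : H) : star (W a) = W a⁻¹ := Subtype.ext (hV a)
  let Y := WeakDual.characterSpace ℂ T
  have hnorm (φ : Y) (h : H) : φ (W h) ∈ Submonoid.unitSphere ℂ := by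
    change φ (W h) ∈ Metric.sphere (0 : ℂ) 1
    rw [mem_sphere_zero_iff_norm]
    have h1 : starRingEnd ℂ (φ (W h)) * φ (W h) = 1 := by
      have : starRingEnd ℂ (φ (W h)) = φ (star (W h)) := (map_star φ _).symm
      rw [this, ← map_mul, hWstar, ← hWmul, inv_mul_cancel, hW1, map_one]
    have h2 := congrArg norm h1
    rw [norm_mul, RCLike.norm_conj, norm_one] at h2
    nlinarith [norm_nonneg (φ (W h))]
  let ψ (φ : Y) : H →* Circle :=
    { toFun := fun h => ⟨φ (W h), hnorm φ h⟩
      map_one' := Circle.ext (by simp [hW1])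
      map_mul' := fun a b => Circle.ext ((congrArg φ (hWmul a b)).trans (map_mul φ _ _)) }
  -- A point of the spectrum of `T` restricts to a character of `H`, hence gives a point of `X`. The
  -- homomorphism sought is the pullback along this map `r`, followed by the inverse Gelfand
  -- transform.
  choose r hr using fun φ : Y => hχ.surjective (ψ φ)
  have hrc : Continuous r := by
    refine hχ.continuous_iff r fun h => ?_
    simp only [hr]
    refine Continuous.subtype_mk ?_ _
    exact (WeakDual.eval_continuous (W h)).comp continuous_subtype_val
  let Θ₀ : C(X, ℂ) →⋆ₐ[ℂ] T :=
    ((gelfandStarTransform T).symm : C(Y, ℂ) →⋆ₐ[ℂ] T).comp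
      (ContinuousMap.compStarAlgHom' ℂ ℂ ⟨r, hrc⟩)
  refine ⟨(T.subtype).comp Θ₀, fun h => ?_⟩
  have : Θ₀ (chr χ h) = W h := by
    change (gelfandStarTransform T).symm _ = W h
    rw [StarAlgEquiv.symm_apply_eq]
    ext φ
    change ((χ h (r φ) : Circle) : ℂ) = φ (W h)
    rw [hr]
    rfl
  exact congrArg Subtype.val this

/-! ### Covariant pairs -/

section Pull

variable {K : Type v} [Group K] {X : Type w} [TopologicalSpace X] (α : K →* (X ≃ₜ X))

/-- The right action of `K` on the continuous functions on `X`. -/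
def pull (k : K) (f : C(X, ℂ)) : C(X, ℂ) := f.comp (α k : C(X, X))

@[simp] theorem pull_apply (k : K) (f : C(X, ℂ)) (x : X) : pull α k f x = f (α k x) := rfl

theorem pull_one (f : C(X, ℂ)) : pull α 1 f = f := by ext x; simp

/-- `pull` as a *-homomorphism. -/
def pullHom [CompactSpace X] (k : K) : C(X, ℂ) →⋆ₙₐ[ℂ] C(X, ℂ) where
  toFun := pull α k
  map_smul' _ _ := rfl
  map_zero' := rfl
  map_add' _ _ := rfl
  map_mul' _ _ := rfl
  map_star' _ := rfl

end Pull

/-- A covariant pair for an action of a discrete group on a compact space. -/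
structure CovPair {K : Type v} [Group K] {X : Type w} [TopologicalSpace X] [CompactSpace X]
    (α : K →* (X ≃ₜ X)) (B : Type w') [NonUnitalCStarAlgebra B] where
  v : K → B
  M : C(X, ℂ) →⋆ₙₐ[ℂ] B
  v_mul : ∀ k l, v k * v l = v (k * l)
  star_v : ∀ k, star (v k) = v k⁻¹
  v_one : v 1 = M 1
  cov : ∀ k f, M f * v k = v k * M (pull α k f)

namespace CovPair

variable {K : Type v} [Group K] {X : Type w} [TopologicalSpace X] [CompactSpace X]
  {α : K →* (X ≃ₜ X)} {B : Type w'} [NonUnitalCStarAlgebra B]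

/-- The integrated form of a covariant pair. -/
def lin (P : CovPair α B) : (K →₀ C(X, ℂ)) →ₗ[ℂ] B :=
  Finsupp.lsum ℂ fun k => (LinearMap.mulLeft ℂ (P.v k)).comp (P.M : C(X, ℂ) →ₗ[ℂ] B)

theorem lin_apply (P : CovPair α B) (F : K →₀ C(X, ℂ)) :
    P.lin F = F.sum fun k f => P.v k * P.M f := rfl

@[simp] theorem lin_single (P : CovPair α B) (k : K) (f : C(X, ℂ)) :
    P.lin (Finsupp.single k f) = P.v k * P.M f := by simp [lin]

theorem v_mul_one (P : CovPair α B) (k : K) : P.v k * P.M 1 = P.v k := by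
  rw [← P.v_one, P.v_mul, mul_one]

/-- The initial projection of `v k` is `M 1`, so multiplying `M f` by `v k` on the left does not
change its norm. -/
theorem norm_v_mul_le (P : CovPair α B) (k : K) (f : C(X, ℂ)) : ‖P.v k * P.M f‖ ≤ ‖f‖ := by
  have h : star (P.v k * P.M f) * (P.v k * P.M f) = star (P.M f) * P.M f := by
    rw [star_mul, mul_assoc, ← mul_assoc _ (P.v k), P.star_v, P.v_mul, inv_mul_cancel, P.v_one,
      ← map_mul, one_mul]
  have h2 : ‖P.v k * P.M f‖ * ‖P.v k * P.M f‖ = ‖P.M f‖ * ‖P.M f‖ := by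
    rw [← CStarRing.norm_star_mul_self, h, CStarRing.norm_star_mul_self]
  exact (mul_self_inj (norm_nonneg _) (norm_nonneg _)).1 h2 ▸ NonUnitalStarAlgHom.norm_apply_le P.M f

/-- The product of the crossed product algebra. -/
def cmul (α : K →* (X ≃ₜ X)) (F F' : K →₀ C(X, ℂ)) : K →₀ C(X, ℂ) :=
  F.sum fun k f => F'.sum fun l g => Finsupp.single (k * l) (pull α l f * g)

/-- Covariance moves `M f` past `v l` at the price of composing `f` with `α l`. This matches the
groupoid factorisation `(kl, x) = (k, l.x)(l, x)`, since functions are evaluated at the source. -/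
theorem lin_cmul (P : CovPair α B) (F F' : K →₀ C(X, ℂ)) :
    P.lin (cmul α F F') = P.lin F * P.lin F' := by
  rw [cmul, Finsupp.sum, map_sum, lin_apply, Finsupp.sum, Finset.sum_mul]
  refine Finset.sum_congr rfl fun k _ => ?_
  rw [Finsupp.sum, map_sum, lin_apply, Finsupp.sum, Finset.mul_sum]
  refine Finset.sum_congr rfl fun l _ => ?_
  rw [lin_single, ← P.v_mul, map_mul, mul_assoc, ← mul_assoc (P.v l), ← P.cov]
  simp only [mul_assoc]

/-- The involution of the crossed product algebra. -/
def cstar (α : K →* (X ≃ₜ X)) (F : K →₀ C(X, ℂ)) : K →₀ C(X, ℂ) :=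
  F.sum fun k f => Finsupp.single k⁻¹ (pull α k⁻¹ (star f))

theorem lin_cstar (P : CovPair α B) (F : K →₀ C(X, ℂ)) :
    P.lin (cstar α F) = star (P.lin F) := by
  rw [cstar, Finsupp.sum, map_sum, lin_apply, Finsupp.sum, star_sum]
  refine Finset.sum_congr rfl fun k _ => ?_
  rw [lin_single, ← P.cov, star_mul, P.star_v, map_star]

/-- The image of a covariant pair in a product of C*-algebras. -/
def family {I : Type*} {B : I → Type*} [∀ i, NonUnitalCStarAlgebra (B i)]
    (P : ∀ i, CovPair α (B i)) : CovPair α (BddFamily B) where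
  v k := ⟨fun i => (P i).v k, memℓp_infty ⟨‖(1 : C(X, ℂ))‖, by
    rintro _ ⟨i, rfl⟩
    simpa only [v_mul_one] using (P i).norm_v_mul_le k 1⟩⟩
  M :=
    { toFun := fun f => ⟨fun i => (P i).M f, memℓp_infty ⟨‖f‖, by
        rintro _ ⟨i, rfl⟩
        exact NonUnitalStarAlgHom.norm_apply_le _ _⟩⟩
      map_smul' := fun c f => lp.ext <| funext fun i => map_smul (P i).M c f
      map_zero' := lp.ext <| funext fun i => map_zero (P i).M
      map_add' := fun f g => lp.ext <| funext fun i => map_add (P i).M f g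
      map_mul' := fun f g => lp.ext <| funext fun i => map_mul (P i).M f g
      map_star' := fun f => lp.ext <| funext fun i => map_star (P i).M f }
  v_mul k l := lp.ext <| funext fun i => (P i).v_mul k l
  star_v k := lp.ext <| funext fun i => (P i).star_v k
  v_one := lp.ext <| funext fun i => (P i).v_one
  cov k f := lp.ext <| funext fun i => (P i).cov k f

theorem family_lin {I : Type*} {B : I → Type*} [∀ i, NonUnitalCStarAlgebra (B i)]
    (P : ∀ i, CovPair α (B i)) (F : K →₀ C(X, ℂ)) (i : I) :
    (family P).lin F i = (P i).lin F := by
  induction F using Finsupp.induction_linear with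
  | zero => simp
  | add f g hf hg => simp only [map_add, lp.coeFn_add, Pi.add_apply, hf, hg]
  | single a z => simp only [lin_single]; rfl

end CovPair

/-! ### Cocycles on semidirect products -/

theorem TwoCocycle.map_one_right {G : Type u} [Group G] (ω : TwoCocycle (ofGroup G)) (a : G) :
    ω a (1 : G) = ω (1 : G) (1 : G) := by
  have h := ω.cocycle a (1 : G) (1 : G) rfl rfl
  have h' : ω a ((1 : G) * 1) * ω (1 : G) (1 : G) = ω (a * 1) (1 : G) * ω a (1 : G) := h
  rw [mul_one, mul_one] at h'
  exact (mul_left_cancel h').symm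

theorem TwoCocycle.group_cocycle {G : Type u} [Group G] (ω : TwoCocycle (ofGroup G)) (a b c : G) :
    ω a (b * c) * ω b c = ω (a * b) c * ω a b := ω.cocycle a b c rfl rfl

section Semidirect

variable {H : Type u} [CommGroup H] {K : Type v} [Group K] {β : K →* MulAut H}

open SemidirectProduct

/-- The element `h` with `a = inr k * inl h`. -/
def normalPart (a : H ⋊[β] K) : H := β a.right⁻¹ a.left

theorem inr_mul_inl_normalPart (a : H ⋊[β] K) : inr a.right * inl (normalPart a) = a := by
  ext <;> simp [normalPart]

theorem normalPart_mul (a b : H ⋊[β] K) :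
    normalPart (a * b) = β b.right⁻¹ (normalPart a) * normalPart b := by
  simp [normalPart]

@[simp] theorem normalPart_one : normalPart (1 : H ⋊[β] K) = 1 := by
  simp [normalPart]

theorem normalPart_inr_mul_inl (k : K) (h : H) :
    normalPart (inr k * inl h : H ⋊[β] K) = h := by
  simp [normalPart]

/-- The function by which conjugation with `k` multiplies the canonical unitary of `h`. -/
def conjCocycle (ω : TwoCocycle (ofGroup (H ⋊[β] K))) (k : K) (h : H) : Circle :=
  ω (inr k⁻¹ : H ⋊[β] K) (inl h : H ⋊[β] K) * ω (⟨β k⁻¹ h, k⁻¹⟩ : H ⋊[β] K) (inr k : H ⋊[β] K)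

/-- The value of the cocycle at the two factors of `a = inr k * inl h`. -/
def sectionCocycle (ω : TwoCocycle (ofGroup (H ⋊[β] K))) (a : H ⋊[β] K) : Circle :=
  ω (inr a.right : H ⋊[β] K) (inl (normalPart a) : H ⋊[β] K)

/-- A cocycle on `H ⋊ K` which is trivial on `H` and on `K`. -/
structure TwoCocycle.IsNormalized (ω : TwoCocycle (ofGroup (H ⋊[β] K))) : Prop where
  inl_inl : ∀ h h' : H, ω (inl h : H ⋊[β] K) (inl h' : H ⋊[β] K) = 1
  inr_inr : ∀ k k' : K, ω (inr k : H ⋊[β] K) (inr k' : H ⋊[β] K) = 1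

namespace TwoCocycle.IsNormalized

variable {ω : TwoCocycle (ofGroup (H ⋊[β] K))}

theorem inl_mul_inr (k : K) (h : H) :
    (inl h * inr k : H ⋊[β] K) = inr k * inl (β k⁻¹ h) := by
  ext <;> simp

theorem map_one_one (hω : ω.IsNormalized) : ω (1 : H ⋊[β] K) (1 : H ⋊[β] K) = 1 := by
  simpa using hω.inl_inl 1 1

/-- Comparing the cocycle identities at `(k⁻¹, h, k)` and at `(k⁻¹, k, β k⁻¹ h)`, where `ω(k⁻¹, k) =
1`, gives the scalar relating `U h * U k` to `U k * U (β k⁻¹ h)`. -/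
theorem inl_inr (hω : ω.IsNormalized) (k : K) (h : H) :
    ω (inl h : H ⋊[β] K) (inr k : H ⋊[β] K) =
      conjCocycle ω k h * ω (inr k : H ⋊[β] K) (inl (β k⁻¹ h) : H ⋊[β] K) := by
  have h1 := ω.group_cocycle (inr k⁻¹ : H ⋊[β] K) (inl h) (inr k)
  have h2 := ω.group_cocycle (inr k⁻¹ : H ⋊[β] K) (inr k) (inl (β k⁻¹ h))
  have e1 : (inr k⁻¹ * inl h : H ⋊[β] K) = ⟨β k⁻¹ h, k⁻¹⟩ := by ext <;> simp
  have e2 : (inr k⁻¹ * inr k : H ⋊[β] K) = inl 1 := by simp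
  rw [e1, inl_mul_inr] at h1
  rw [e2, hω.inl_inl, hω.inr_inr, mul_one] at h2
  rw [conjCocycle, mul_comm (ω _ _) (ω (⟨β k⁻¹ h, k⁻¹⟩ : H ⋊[β] K) _), ← h1,
    mul_right_comm, h2, one_mul]

/-- Rescaling `U a` to `U k * U h`, for `a = kh`, replaces `ω` by a cohomologous cocycle. In it only
the commutation of the `H`-part of `a` with the `K`-part of `b` leaves a scalar. -/
theorem apply_mul_section (hω : ω.IsNormalized) (a b : H ⋊[β] K) :
    ω a b * sectionCocycle ω a * sectionCocycle ω b =
      conjCocycle ω b.right (normalPart a) * sectionCocycle ω (a * b) := by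
  set k := a.right with hk
  set l := b.right with hl
  set h := normalPart a with hh
  set m := normalPart b with hm
  set h' := β l⁻¹ h with hh'
  have ea : (inr k * inl h : H ⋊[β] K) = a := inr_mul_inl_normalPart a
  have eb : (inr l * inl m : H ⋊[β] K) = b := inr_mul_inl_normalPart b
  have e1 := ω.group_cocycle a (inr l) (inl m)
  have e2 := ω.group_cocycle (inr k : H ⋊[β] K) (inl h) (inr l)
  have e3 := hω.inl_inr l h
  have e4 := ω.group_cocycle (inr k : H ⋊[β] K) (inr l) (inl h')
  have e5 := ω.group_cocycle (inr (k * l) : H ⋊[β] K) (inl h') (inl m)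
  have e6 : (inr (k * l) * inl h' : H ⋊[β] K) = a * inr l := by
    rw [← ea, mul_assoc, inl_mul_inr, ← mul_assoc, map_mul]
  rw [eb] at e1
  rw [inl_mul_inr, ea] at e2
  rw [hω.inr_inr, ← map_mul, mul_one] at e4
  rw [hω.inl_inl, mul_one, e6, ← map_mul] at e5
  have es : sectionCocycle ω (a * b) = ω (inr (k * l) : H ⋊[β] K) (inl (h' * m) : H ⋊[β] K) := by
    rw [sectionCocycle, normalPart_mul, mul_right]
  -- The rest is elimination in an abelian group: the values of `ω` that contain the intermediate
  -- element `a * inr l` or one of its factors cancel.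
  have aux (A sa sb c W O Y Z T V S : Circle) (e1 : A * sb = W * O) (e2 : Y * Z = O * sa)
      (e3 : Z = c * T) (e4 : Y * T = V) (e5 : S = W * V) : A * sa * sb = c * S := by
    rw [mul_right_comm, e1, mul_assoc, ← e2, e3, e5, ← e4]
    ac_rfl
  rw [es]
  exact aux _ _ _ _ _ _ _ _ _ _ _ e1 e2 e3 e4 e5

end TwoCocycle.IsNormalized

end Semidirect

/-! ### Covariant pairs and projective families -/

section Semidirect

variable {H : Type u} [CommGroup H] {K : Type v} [Group K] {β : K →* MulAut H}
  {X : Type w} [TopologicalSpace X] [CompactSpace X]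

open SemidirectProduct

/-- An action on the dual of `H` that corresponds to the conjugation by the canonical unitaries of
`K` in the twisted group algebra. -/
structure IsDualAction (ω : TwoCocycle (ofGroup (H ⋊[β] K))) (χ : H →* C(X, Circle))
    (α : K →* (X ≃ₜ X)) : Prop where
  normalized : ω.IsNormalized
  dual : IsDualPairing χ
  act : ∀ k h x, χ h (α k x) = conjCocycle ω k h * χ (β k⁻¹ h) x

variable {ω : TwoCocycle (ofGroup (H ⋊[β] K))} {χ : H →* C(X, Circle)} {α : K →* (X ≃ₜ X)}
  {B : Type w'}

omit [CompactSpace X] in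
theorem IsDualAction.pull_chr (hα : IsDualAction ω χ α) (k : K) (h : H) :
    pull α k (chr χ h) = (conjCocycle ω k h : ℂ) • chr χ (β k⁻¹ h) := by
  ext x
  simp [chr_apply, hα.act]

/-- The projective family of a covariant pair. -/
def CovPair.toProj [NonUnitalCStarAlgebra B] (hα : IsDualAction ω χ α) (P : CovPair α B) :
    ProjRep ω B :=
  let U (a : H ⋊[β] K) : B :=
    starRingEnd ℂ (sectionCocycle ω a : ℂ) • (P.v a.right * P.M (chr χ (normalPart a)))
  have hU (a b : H ⋊[β] K) : U a * U b = (ω a b : ℂ) • U (a * b) := by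
    have h1 : P.v a.right * P.M (chr χ (normalPart a)) *
        (P.v b.right * P.M (chr χ (normalPart b))) =
        (conjCocycle ω b.right (normalPart a) : ℂ) •
          (P.v (a * b).right * P.M (chr χ (normalPart (a * b)))) := by
      rw [mul_assoc, ← mul_assoc _ (P.v b.right), P.cov, hα.pull_chr, mul_assoc, ← map_mul,
        ← mul_assoc, P.v_mul, smul_mul_assoc, ← chr_mul, ← normalPart_mul, map_smul,
        mul_smul_comm, mul_right]
    have h2 : (ω a b : ℂ) * sectionCocycle ω a * sectionCocycle ω b =
        conjCocycle ω b.right (normalPart a) * sectionCocycle ω (a * b) := by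
      exact_mod_cast congrArg (fun z : Circle => (z : ℂ)) (hα.normalized.apply_mul_section a b)
    simp only [U]
    rw [smul_mul_smul_comm, h1, smul_smul, smul_smul]
    congr 1
    have ha := conj_mul_coe_circle (sectionCocycle ω a)
    have hb := conj_mul_coe_circle (sectionCocycle ω b)
    have hab := conj_mul_coe_circle (sectionCocycle ω (a * b))
    generalize starRingEnd ℂ (sectionCocycle ω a : ℂ) = x at *
    generalize starRingEnd ℂ (sectionCocycle ω b : ℂ) = y at *
    generalize starRingEnd ℂ (sectionCocycle ω (a * b) : ℂ) = z at *
    -- Here `x`, `y`, `z` are the inverses of the three section values, so this is `h2` multiplied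
    -- by all three.
    linear_combination (-x * y * z) * h2 - x * y * (conjCocycle ω b.right (normalPart a) : ℂ) * hab
      + z * (ω a b : ℂ) * y * sectionCocycle ω b * ha + z * (ω a b : ℂ) * hb
  have h1 : U 1 = P.M 1 := by
    have : sectionCocycle ω (1 : H ⋊[β] K) = 1 := by
      rw [sectionCocycle, normalPart_one, one_right, map_one, map_one, hα.normalized.map_one_one]
    simp only [U, this, normalPart_one, one_right, chr_one, P.v_one]
    rw [← map_mul, one_mul, Circle.coe_one, map_one, one_smul]
  -- The adjoint relation need not be computed from the cocycle: it follows from the product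
  -- relation and this identity, since `U a⁻¹ * U a` is a scalar multiple of `U 1`.
  have hUs (a : H ⋊[β] K) : U a * star (U a) = U 1 := by
    have hs : starRingEnd ℂ (sectionCocycle ω a : ℂ) *
        star (starRingEnd ℂ (sectionCocycle ω a : ℂ)) = 1 := by
      rw [RCLike.star_def, Complex.conj_conj, conj_mul_coe_circle]
    simp only [h1, U]
    rw [star_smul, star_mul, smul_mul_smul_comm, hs, one_smul, ← map_star P.M, star_chr, mul_assoc,
      ← mul_assoc _ _ (star (P.v a.right)), ← map_mul, ← chr_mul, mul_inv_cancel, chr_one,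
      ← mul_assoc, P.v_mul_one, P.star_v, P.v_mul, mul_inv_cancel, P.v_one]
  { U := U
    U_mul := hU
    star_U := fun a => by
      have h1s : star (U 1) = U 1 := by rw [h1, ← map_star, star_one]
      have h2 : U a * U 1 = U a := by
        rw [hU, mul_one, ω.map_one_right, hα.normalized.map_one_one, Circle.coe_one, one_smul]
      have h3 : U a⁻¹ * U 1 = U a⁻¹ := by
        rw [hU, mul_one, ω.map_one_right, hα.normalized.map_one_one, Circle.coe_one, one_smul]
      have h4 : U 1 = starRingEnd ℂ (ω a⁻¹ a : ℂ) • (U a⁻¹ * U a) := by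
        rw [hU, smul_smul, conj_mul_coe_circle, one_smul, inv_mul_cancel]
      calc star (U a) = U 1 * star (U a) := by rw [← h1s, ← star_mul, h2]
        _ = starRingEnd ℂ (ω a⁻¹ a : ℂ) • (U a⁻¹ * (U a * star (U a))) := by
          rw [h4, smul_mul_assoc, mul_assoc]
        _ = _ := by rw [hUs, h3] }

theorem CovPair.toProj_U [NonUnitalCStarAlgebra B] (hα : IsDualAction ω χ α) (P : CovPair α B)
    (a : H ⋊[β] K) : (P.toProj hα).U a =
      starRingEnd ℂ (sectionCocycle ω a : ℂ) • (P.v a.right * P.M (chr χ (normalPart a))) := rfl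

/-- The embedding of the twisted group algebra into the crossed product. -/
def trigPoly (ω : TwoCocycle (ofGroup (H ⋊[β] K))) (χ : H →* C(X, Circle)) :
    ((H ⋊[β] K) →₀ ℂ) →ₗ[ℂ] (K →₀ C(X, ℂ)) :=
  Finsupp.linearCombination ℂ fun a =>
    Finsupp.single a.right (starRingEnd ℂ (sectionCocycle ω a : ℂ) • chr χ (normalPart a))

theorem CovPair.toProj_lin [NonUnitalCStarAlgebra B] (hα : IsDualAction ω χ α) (P : CovPair α B)
    (c : (H ⋊[β] K) →₀ ℂ) : (P.toProj hα).lin c = P.lin (trigPoly ω χ c) := by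
  induction c using Finsupp.induction_linear with
  | zero => simp
  | add f g hf hg => simp only [map_add, hf, hg]
  | single a z =>
    rw [ProjRep.lin_single, toProj_U, trigPoly, Finsupp.linearCombination_single, map_smul,
      lin_single, map_smul, mul_smul_comm]

/-- The integrated form of a covariant pair takes values in the C*-algebra generated by the
projective family. -/
theorem CovPair.lin_mem_alg [NonUnitalCStarAlgebra B] (hα : IsDualAction ω χ α)
    (P : CovPair α B) (F : K →₀ C(X, ℂ)) : P.lin F ∈ (P.toProj hα).alg := by
  induction F using Finsupp.induction_linear with
  | zero => rw [map_zero]; exact zero_mem _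
  | add f g hf hg => rw [map_add]; exact add_mem hf hg
  | single k f =>
    rw [lin_single]
    -- The functions `f` for which `v k * M f` lies in the generated algebra form a closed subspace;
    -- it contains the characters because `v k * M (χ h)` is a scalar multiple of a member of the
    -- family.
    let T : C(X, ℂ) →L[ℂ] B := (ContinuousLinearMap.mul ℂ B (P.v k)).comp (starHomCLM P.M)
    let p : Submodule ℂ B := (P.toProj hα).alg.toSubmodule
    have hp : IsClosed (p : Set B) :=
      NonUnitalStarSubalgebra.isClosed_topologicalClosure (P.toProj hα).spanAlg
    have htop := hα.dual.eq_top (p.comap T.toLinearMap) (hp.preimage T.continuous) fun h => by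
      refine NonUnitalStarSubalgebra.le_topologicalClosure _ ?_
      rw [ProjRep.mem_spanAlg]
      refine ⟨Finsupp.single (inr k * inl h) (sectionCocycle ω (inr k * inl h) : ℂ), ?_⟩
      rw [ProjRep.lin_single, toProj_U, smul_smul, coe_mul_conj_circle, one_smul,
        normalPart_inr_mul_inl]
      simp [T]
    have hf : f ∈ p.comap T.toLinearMap := htop ▸ Submodule.mem_top
    exact hf

/-- Every projective family in a unital C*-algebra comes from a covariant pair. -/
theorem ProjRep.exists_covPair [CStarAlgebra B] (hα : IsDualAction ω χ α) (R : ProjRep ω B) :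
    ∃ P : CovPair α B, (∀ k, P.v k = R.U (inr k)) ∧ ∀ h, P.M (chr χ h) = R.U (inl h) := by
  have hω := hα.normalized
  have hp1 (a : H ⋊[β] K) : R.U a * R.U 1 = R.U a := by
    rw [R.U_mul, mul_one, ω.map_one_right, hω.map_one_one, Circle.coe_one, one_smul]
  have hps : star (R.U 1) = R.U 1 := by
    rw [R.star_U, inv_one, hω.map_one_one]; simp
  have h1p (a : H ⋊[β] K) : R.U 1 * R.U a = R.U a := by
    have := congrArg star (hp1 a⁻¹)
    rw [star_mul, hps, R.star_U, mul_smul_comm, inv_inv] at this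
    have h2 := congrArg (fun x => (ω a a⁻¹ : ℂ) • x) this
    simpa only [smul_smul, coe_mul_conj_circle, one_smul] using h2
  have hinl (h h' : H) : R.U (inl h) * R.U (inl h') = R.U (inl (h * h')) := by
    rw [R.U_mul, hω.inl_inl, Circle.coe_one, one_smul, map_mul]
  have hinr (k k' : K) : R.U (inr k) * R.U (inr k') = R.U (inr (k * k')) := by
    rw [R.U_mul, hω.inr_inr, Circle.coe_one, one_smul, map_mul]
  have hinl_star (h : H) : star (R.U (inl h)) = R.U (inl h⁻¹) := by
    rw [R.star_U, ← map_inv, hω.inl_inl]; simp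
  have hinr_star (k : K) : star (R.U (inr k)) = R.U (inr k⁻¹) := by
    rw [R.star_U, ← map_inv, hω.inr_inr]; simp
  -- The representation need not be unital, so `U 1` is only a projection. Adding its complement
  -- makes the restriction to `H` unital; the complement is cut off again in `M`.
  let V : H →* B :=
    { toFun := fun h => R.U (inl h) + (1 - R.U 1)
      map_one' := by simp
      map_mul' := fun a b => by
        simp only [mul_add, add_mul, mul_sub, sub_mul, hp1, h1p, mul_one, one_mul, hinl]
        abel }
  obtain ⟨Θ, hΘ⟩ := hα.dual.exists_starAlgHom V fun h => by simp [V, hinl_star, hps]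
  have hΘp (h : H) : Θ (chr χ h) * R.U 1 = R.U (inl h) := by
    rw [hΘ]; simp [V, add_mul, sub_mul, hp1]
  have hpΘ (h : H) : R.U 1 * Θ (chr χ h) = R.U (inl h) := by
    rw [hΘ]; simp [V, mul_add, mul_sub, hp1, h1p]
  let Θc : C(X, ℂ) →L[ℂ] B := starHomCLM (Θ : C(X, ℂ) →⋆ₙₐ[ℂ] B)
  -- The projection `U 1` commutes with the image of `Θ`, as one sees on characters; this makes the
  -- compression `f ↦ Θ f * U 1` multiplicative.
  have hcomm (f : C(X, ℂ)) : R.U 1 * Θ f = Θ f * R.U 1 := by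
    have : (ContinuousLinearMap.mul ℂ B (R.U 1)).comp Θc =
        ((ContinuousLinearMap.mul ℂ B).flip (R.U 1)).comp Θc :=
      hα.dual.clm_ext fun h => (hpΘ h).trans (hΘp h).symm
    exact DFunLike.congr_fun this f
  let M : C(X, ℂ) →⋆ₙₐ[ℂ] B :=
    { toFun := fun f => Θ f * R.U 1
      map_smul' := fun c f => by simp
      map_zero' := by simp
      map_add' := fun f g => by simp [add_mul]
      map_mul' := fun f g => by
        rw [map_mul, mul_assoc (Θ f) (R.U 1), ← mul_assoc (R.U 1), hcomm, mul_assoc (Θ g), hp1,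
          mul_assoc]
      map_star' := fun f => by rw [star_mul, hps, ← map_star, hcomm] }
  refine ⟨⟨fun k => R.U (inr k), M, hinr, hinr_star, ?_, fun k f => ?_⟩, fun _ => rfl, hΘp⟩
  · change _ = Θ 1 * R.U 1
    rw [map_one, map_one, one_mul]
  -- Both sides of the covariance relation are continuous and linear in `f`; on a character it is
  -- the commutation rule `inl_inr`.
  · have : ((ContinuousLinearMap.mul ℂ B).flip (R.U (inr k))).comp (starHomCLM M) =
        ((ContinuousLinearMap.mul ℂ B (R.U (inr k))).comp (starHomCLM M)).comp
          (starHomCLM (pullHom α k)) := by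
      refine hα.dual.clm_ext fun h => ?_
      change M (chr χ h) * R.U (inr k) = R.U (inr k) * M (pull α k (chr χ h))
      rw [hα.pull_chr, map_smul]
      change (Θ (chr χ h) * R.U 1) * R.U (inr k) =
        R.U (inr k) * (_ • (Θ (chr χ (β k⁻¹ h)) * R.U 1))
      rw [hΘp, hΘp, R.U_mul, hω.inl_inr, mul_smul_comm, R.U_mul, smul_smul, Circle.coe_mul,
        TwoCocycle.IsNormalized.inl_mul_inr]
    exact DFunLike.congr_fun this f

/-- The family is recovered from its covariant pair: `U k * U h` is `U a` times the section value of
`a = kh`, and `trigPoly` divides by that value. -/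
theorem ProjRep.lin_eq_of_covPair [NonUnitalCStarAlgebra B] (R : ProjRep ω B) (P : CovPair α B)
    (hv : ∀ k, P.v k = R.U (inr k)) (hM : ∀ h, P.M (chr χ h) = R.U (inl h))
    (c : (H ⋊[β] K) →₀ ℂ) : P.lin (trigPoly ω χ c) = R.lin c := by
  induction c using Finsupp.induction_linear with
  | zero => simp
  | add f g hf hg => simp only [map_add, hf, hg]
  | single a z =>
    rw [ProjRep.lin_single, trigPoly, Finsupp.linearCombination_single, map_smul,
      CovPair.lin_single, map_smul, hv, hM, mul_smul_comm, R.U_mul, inr_mul_inl_normalPart,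
      smul_smul _ _ (R.U a), sectionCocycle, conj_mul_coe_circle, one_smul]

end Semidirect

/-- The compactly supported continuous functions on a groupoid. -/
abbrev Cc (𝒢 : EtaleGroupoid.{u}) : Type u := CompactlySupportedContinuousMap 𝒢.carrier ℂ

theorem sum_single_inv_apply {G : Type u} [Group G] {M N : Type*} [AddCommMonoid M]
    [AddCommMonoid N] (φ : G → M → N) (hφ : ∀ a, φ a 0 = 0) (c : G →₀ M) (a : G) :
    (c.sum fun b z => Finsupp.single b⁻¹ (φ b z)) a = φ a⁻¹ (c a⁻¹) := by
  classical
  rw [Finsupp.sum, Finsupp.finsetSum_apply, Finset.sum_eq_single a⁻¹]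
  · simp
  · intro b _ hb
    rw [Finsupp.single_apply, if_neg]
    rintro rfl
    exact hb (inv_inv b).symm
  · intro ha
    rw [Finsupp.notMem_support_iff.1 ha, hφ, Finsupp.single_zero, Finsupp.zero_apply]

theorem sum_single_mul_apply {G : Type u} [Group G] {M N : Type*} [AddCommMonoid M]
    [AddCommMonoid N] (φ : G → M → N) (hφ : ∀ a, φ a 0 = 0) (c : G →₀ M) (a b : G) :
    (c.sum fun x z => Finsupp.single (a * x) (φ x z)) b = φ (a⁻¹ * b) (c (a⁻¹ * b)) := by
  classical
  rw [Finsupp.sum, Finsupp.finsetSum_apply, Finset.sum_eq_single (a⁻¹ * b)]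
  · simp
  · intro x _ hx
    rw [Finsupp.single_apply, if_neg]
    rintro rfl
    exact hx (by simp)
  · intro ha
    rw [Finsupp.notMem_support_iff.1 ha, hφ, Finsupp.single_zero, Finsupp.zero_apply]

/-! ### Representations of the convolution algebra of a group -/

section OfGroup

variable {G : Type u} [Group G]

/-- Compactly supported functions on a discrete group are finitely supported functions. -/
def groupEquiv (G : Type u) [Group G] :
    Cc (ofGroup G) ≃ₗ[ℂ] (G →₀ ℂ) :=
  letI : TopologicalSpace G := ⊥
  haveI : DiscreteTopology G := ⟨rfl⟩
  { toFun := fun f : CompactlySupportedContinuousMap G ℂ => Finsupp.ofSupportFinite f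
      (f.hasCompactSupport.isCompact.finite_of_discrete.subset (subset_tsupport f))
    invFun := fun c => (⟨⟨fun a => c a, continuous_of_discreteTopology⟩,
      HasCompactSupport.of_support_subset_isCompact (K := (c.support : Set G))
        (c.support.finite_toSet.isCompact) fun a ha => Finsupp.mem_support_iff.2 ha⟩ :
      CompactlySupportedContinuousMap G ℂ)
    map_add' := fun f g => by ext; rfl
    map_smul' := fun c f => by ext; rfl
    left_inv := fun f => by ext; rfl
    right_inv := fun c => by ext; rfl }

@[simp] theorem groupEquiv_apply (f : Cc (ofGroup G))
    (a : G) : groupEquiv G f a = f a := rfl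

variable {ω : TwoCocycle (ofGroup G)}

/-- A factorisation of `b` is determined by its first factor. Only `f` has to be finitely supported,
so the formula serves both for products and for the action on `ℓ²`. -/
theorem conv_ofGroup (f g : G → ℂ) (s : Finset G) (hs : ∀ a ∉ s, f a = 0) (b : G) :
    conv ω f g b = ∑ a ∈ s, f a * g (a⁻¹ * b) * (ω a (a⁻¹ * b) : ℂ) := by
  let e : G ≃ {p : G × G // (1 : G) = 1 ∧ p.1 * p.2 = b} :=
    { toFun := fun a => ⟨(a, a⁻¹ * b), rfl, mul_inv_cancel_left a b⟩
      invFun := fun p => p.1.1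
      left_inv := fun a => rfl
      right_inv := by
        rintro ⟨⟨a, a'⟩, -, rfl⟩
        simp }
  have h : conv ω f g b = ∑ᶠ a : G, f a * g (a⁻¹ * b) * (ω a (a⁻¹ * b) : ℂ) :=
    (finsum_comp_equiv e).symm
  rw [h]
  refine finsum_eq_sum_of_support_subset _ fun a ha => ?_
  by_contra has
  exact ha (by simp [hs a has])

/-- The product of the twisted group algebra. -/
def tmul (ω : TwoCocycle (ofGroup G)) (c d : G →₀ ℂ) : G →₀ ℂ :=
  c.sum fun a z => d.sum fun b w => Finsupp.single (a * b) (z * w * (ω a b : ℂ))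

theorem tmul_apply (c d : G →₀ ℂ) (b : G) :
    tmul ω c d b = ∑ a ∈ c.support, c a * d (a⁻¹ * b) * (ω a (a⁻¹ * b) : ℂ) := by
  rw [tmul, Finsupp.sum, Finsupp.finsetSum_apply]
  exact Finset.sum_congr rfl fun a _ =>
    sum_single_mul_apply (fun x w => c a * w * (ω a x : ℂ)) (by simp) d a b

/-- The involution of the twisted group algebra. -/
def tstar (ω : TwoCocycle (ofGroup G)) (c : G →₀ ℂ) : G →₀ ℂ :=
  c.sum fun a z => Finsupp.single a⁻¹ (starRingEnd ℂ (z * (ω a⁻¹ a : ℂ)))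

theorem tstar_apply (c : G →₀ ℂ) (a : G) :
    tstar ω c a = starRingEnd ℂ (c a⁻¹ * (ω a a⁻¹ : ℂ)) := by
  have := sum_single_inv_apply (fun b z => starRingEnd ℂ (z * (ω b⁻¹ b : ℂ))) (by simp) c a
  rwa [inv_inv] at this

namespace ProjRep

variable {B : Type w'}

theorem lin_apply [NonUnitalCStarAlgebra B] (R : ProjRep ω B) (c : G →₀ ℂ) :
    R.lin c = c.sum fun a z => z • R.U a := rfl

theorem lin_tmul [NonUnitalCStarAlgebra B] (R : ProjRep ω B) (c d : G →₀ ℂ) :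
    R.lin (tmul ω c d) = R.lin c * R.lin d := by
  rw [tmul, Finsupp.sum, map_sum, lin_apply R c, Finsupp.sum, Finset.sum_mul]
  refine Finset.sum_congr rfl fun a _ => ?_
  rw [Finsupp.sum, map_sum, lin_apply R d, Finsupp.sum, Finset.mul_sum]
  refine Finset.sum_congr rfl fun b _ => ?_
  rw [lin_single, smul_mul_smul_comm, R.U_mul, smul_smul]

theorem lin_tstar [NonUnitalCStarAlgebra B] (R : ProjRep ω B) (c : G →₀ ℂ) :
    R.lin (tstar ω c) = star (R.lin c) := by
  rw [tstar, Finsupp.sum, map_sum, lin_apply R c, Finsupp.sum, star_sum]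
  refine Finset.sum_congr rfl fun a _ => ?_
  rw [lin_single, star_smul, R.star_U, smul_smul, map_mul]
  rfl

variable [CStarAlgebra B]

/-- A projective family as a representation of the convolution algebra. -/
def toConv (R : ProjRep ω B) : ConvRep ω B where
  toLin := R.lin.comp (groupEquiv G).toLinearMap
  map_conv f g h hh := by
    have : groupEquiv G h = tmul ω (groupEquiv G f) (groupEquiv G g) := by
      ext b
      rw [tmul_apply]
      exact (congrFun hh b).trans (conv_ofGroup (fun a : G => f a) (fun a : G => g a) _
        (fun a ha => Finsupp.notMem_support_iff.1 ha) b)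
    simp only [LinearMap.comp_apply, LinearEquiv.coe_coe, this, lin_tmul]
  map_invol f h hh := by
    have : groupEquiv G h = tstar ω (groupEquiv G f) := by
      ext b
      rw [tstar_apply]
      exact congrFun hh b
    simp only [LinearMap.comp_apply, LinearEquiv.coe_coe, this, lin_tstar]

/-- The projective family of a representation of the convolution algebra. -/
def ofConv (π : ConvRep ω B) : ProjRep ω B where
  U a := π.toLin ((groupEquiv G).symm (Finsupp.single a 1))
  U_mul a b := by
    rw [← map_smul, ← map_smul]
    refine (π.map_conv _ _ _ ?_).symm
    have h : (ω a b : ℂ) • Finsupp.single (a * b) (1 : ℂ) =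
        tmul ω (Finsupp.single a 1) (Finsupp.single b 1) := by
      simp [tmul, -Finsupp.single_mul]
    rw [h]
    ext x
    change tmul ω _ _ x = _
    rw [tmul_apply]
    exact (conv_ofGroup _ _ _ (fun a ha => Finsupp.notMem_support_iff.1 ha) x).symm
  star_U a := by
    rw [← map_smul, ← map_smul]
    refine (π.map_invol _ _ ?_).symm
    have h : starRingEnd ℂ (ω a⁻¹ a : ℂ) • Finsupp.single a⁻¹ (1 : ℂ) =
        tstar ω (Finsupp.single a 1) := by
      simp [tstar, -Finsupp.single_mul]
    rw [h]
    ext x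
    exact tstar_apply _ _

theorem ofConv_lin (π : ConvRep ω B) (c : G →₀ ℂ) :
    (ofConv π).lin c = π.toLin ((groupEquiv G).symm c) := by
  induction c using Finsupp.induction_linear with
  | zero => simp
  | add f g hf hg => simp only [map_add, hf, hg]
  | single a z =>
    rw [lin_single, ofConv, ← map_smul, ← map_smul, Finsupp.smul_single, smul_eq_mul, mul_one]

end ProjRep

end OfGroup

/-! ### Representations of the convolution algebra of a transformation groupoid -/

section Transformation

variable {K : Type v} [Group K] {X : Type w} [TopologicalSpace X] [CompactSpace X] [T2Space X]

/-- Compactly supported functions on a transformation groupoid are finitely supported families of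
continuous functions. -/
def transformationEquiv (α : K →* (X ≃ₜ X)) :
    Cc (transformationGroupoid K X α) ≃ₗ[ℂ]
      (K →₀ C(X, ℂ)) :=
  letI : TopologicalSpace K := ⊥
  haveI : DiscreteTopology K := ⟨rfl⟩
  { toFun := fun f : CompactlySupportedContinuousMap (K × X) ℂ =>
      Finsupp.ofSupportFinite
        (fun k : K => (⟨fun x => f (k, x), by fun_prop⟩ : C(X, ℂ))) <| by
        refine (f.hasCompactSupport.isCompact.image continuous_fst).finite_of_discrete.subset ?_
        intro k hk
        obtain ⟨x, hx⟩ : ∃ x, f (k, x) ≠ 0 := by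
          by_contra hcon
          push Not at hcon
          exact hk (ContinuousMap.ext hcon)
        exact ⟨(k, x), subset_tsupport f hx, rfl⟩
    invFun := fun F =>
      (⟨⟨fun p => F p.1 p.2, continuous_prod_of_discrete_left.2 fun k => (F k).continuous⟩,
        HasCompactSupport.of_support_subset_isCompact
          (K := (F.support : Set K) ×ˢ (Set.univ : Set X))
          (F.support.finite_toSet.isCompact.prod isCompact_univ) (by
            rintro ⟨k, x⟩ hp
            refine ⟨Finsupp.mem_support_iff.2 fun h => hp ?_, trivial⟩
            change F k x = 0
            rw [h, ContinuousMap.zero_apply])⟩ : CompactlySupportedContinuousMap (K × X) ℂ)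
    map_add' := fun f g => by ext; rfl
    map_smul' := fun c f => by ext; rfl
    left_inv := fun f => by ext; rfl
    right_inv := fun F => by ext; rfl }

variable {α : K →* (X ≃ₜ X)}

@[simp] theorem transformationEquiv_symm_apply (F : K →₀ C(X, ℂ)) (k : K) (x : X) :
    (transformationEquiv α).symm F (k, x) = F k x := rfl

/-- A factorisation of `(k, x)` is determined by the group component `a` of its first arrow: the
second arrow is `(a⁻¹k, x)`, and the first must start where it ends. -/
theorem conv_transformation (f g : K × X → ℂ) (s : Finset K) (hs : ∀ a ∉ s, ∀ x, f (a, x) = 0)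
    (k : K) (x : X) :
    conv (TwoCocycle.trivial (transformationGroupoid K X α)) f g (k, x) =
      ∑ a ∈ s, f (a, α (a⁻¹ * k) x) * g (a⁻¹ * k, x) := by
  let e : K ≃ {p : (K × X) × (K × X) //
      ((1 : K), p.1.2) = (1, α p.2.1 p.2.2) ∧ (p.1.1 * p.2.1, p.2.2) = (k, x)} :=
    { toFun := fun a => ⟨((a, α (a⁻¹ * k) x), (a⁻¹ * k, x)), rfl, by simp⟩
      invFun := fun p => p.1.1.1
      left_inv := fun a => rfl
      right_inv := by
        rintro ⟨⟨⟨a, y⟩, ⟨b, z⟩⟩, h1, h2⟩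
        simp only [Prod.mk.injEq, true_and] at h1 h2
        obtain ⟨rfl, rfl⟩ := h2
        subst h1
        simp }
  have h : conv (TwoCocycle.trivial (transformationGroupoid K X α)) f g (k, x) =
      ∑ᶠ a : K, f (a, α (a⁻¹ * k) x) * g (a⁻¹ * k, x) * ((1 : Circle) : ℂ) :=
    (finsum_comp_equiv e).symm
  rw [h]
  simp only [Circle.coe_one, mul_one]
  refine finsum_eq_sum_of_support_subset _ fun a ha => ?_
  by_contra has
  exact ha (by simp [hs a has])

namespace CovPair

theorem cmul_apply (F F' : K →₀ C(X, ℂ)) (k : K) (x : X) :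
    cmul α F F' k x = ∑ a ∈ F.support, F a (α (a⁻¹ * k) x) * F' (a⁻¹ * k) x := by
  rw [cmul, Finsupp.sum, Finsupp.finsetSum_apply, ContinuousMap.sum_apply]
  refine Finset.sum_congr rfl fun a _ => ?_
  rw [sum_single_mul_apply (fun l g => pull α l (F a) * g) (by simp) F' a k]
  rfl

theorem cstar_apply (F : K →₀ C(X, ℂ)) (k : K) (x : X) :
    cstar α F k x = starRingEnd ℂ (F k⁻¹ (α k x)) := by
  rw [cstar, sum_single_inv_apply (fun l f => pull α l⁻¹ (star f)) (by intro; ext; simp) F k,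
    inv_inv]
  rfl

variable {B : Type w'} [CStarAlgebra B]

/-- The integrated form of a covariant pair. -/
def toConv (P : CovPair α B) : ConvRep (TwoCocycle.trivial (transformationGroupoid K X α)) B where
  toLin := P.lin.comp (transformationEquiv α).toLinearMap
  map_conv f g h hh := by
    have : transformationEquiv α h =
        cmul α (transformationEquiv α f) (transformationEquiv α g) := by
      ext k x
      rw [cmul_apply]
      refine (congrFun hh (k, x)).trans (conv_transformation _ _ _ (fun a ha y => ?_) k x)
      exact DFunLike.congr_fun (Finsupp.notMem_support_iff.1 ha) y
    simp only [LinearMap.comp_apply, LinearEquiv.coe_coe, this, lin_cmul]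
  map_invol f h hh := by
    have : transformationEquiv α h = cstar α (transformationEquiv α f) := by
      ext k x
      rw [cstar_apply]
      refine (congrFun hh (k, x)).trans ?_
      change starRingEnd ℂ (f (k⁻¹, α k x) * ((1 : Circle) : ℂ)) = _
      rw [Circle.coe_one, mul_one]
      rfl
    simp only [LinearMap.comp_apply, LinearEquiv.coe_coe, this, lin_cstar]

theorem map_cmul_of_conv (π : ConvRep (TwoCocycle.trivial (transformationGroupoid K X α)) B)
    (F F' : K →₀ C(X, ℂ)) :
    π.toLin ((transformationEquiv α).symm (cmul α F F')) =
      π.toLin ((transformationEquiv α).symm F) * π.toLin ((transformationEquiv α).symm F') := by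
  refine π.map_conv _ _ _ ?_
  ext ⟨k, x⟩
  rw [transformationEquiv_symm_apply, cmul_apply]
  refine (conv_transformation (fun p => F p.1 p.2) (fun p => F' p.1 p.2) _
    (fun a ha y => ?_) k x).symm
  exact DFunLike.congr_fun (Finsupp.notMem_support_iff.1 ha) y

theorem map_cstar_of_conv (π : ConvRep (TwoCocycle.trivial (transformationGroupoid K X α)) B)
    (F : K →₀ C(X, ℂ)) :
    π.toLin ((transformationEquiv α).symm (cstar α F)) =
      star (π.toLin ((transformationEquiv α).symm F)) := by
  refine π.map_invol _ _ ?_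
  ext ⟨k, x⟩
  rw [transformationEquiv_symm_apply, cstar_apply]
  change _ = starRingEnd ℂ (F k⁻¹ (α k x) * ((1 : Circle) : ℂ))
  rw [Circle.coe_one, mul_one]

theorem cmul_single (k l : K) (f g : C(X, ℂ)) :
    cmul α (Finsupp.single k f) (Finsupp.single l g) =
      Finsupp.single (k * l) (pull α l f * g) := by
  have h (l : K) : pull α l 0 = 0 := rfl
  simp [cmul, h]

theorem cstar_single (k : K) (f : C(X, ℂ)) :
    cstar α (Finsupp.single k f) = Finsupp.single k⁻¹ (pull α k⁻¹ (star f)) := by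
  have h (l : K) : pull α l 0 = 0 := rfl
  simp [cstar, h]

/-- The covariant pair of a representation of the convolution algebra. -/
def ofConv (π : ConvRep (TwoCocycle.trivial (transformationGroupoid K X α)) B) :
    CovPair α B where
  -- Since `X` is compact, the indicator function of `{k} × X` is compactly supported, so `v k`
  -- needs no multiplier algebra.
  v k := π.toLin ((transformationEquiv α).symm (Finsupp.single k 1))
  M :=
    { toFun := fun f => π.toLin ((transformationEquiv α).symm (Finsupp.single 1 f))
      map_smul' := fun c f => by simp only [← Finsupp.smul_single, map_smul, MonoidHom.id_apply]
      map_zero' := by simp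
      map_add' := fun f g => by simp
      map_mul' := fun f g => by rw [← map_cmul_of_conv, cmul_single, pull_one, one_mul]
      map_star' := fun f => by rw [← map_cstar_of_conv, cstar_single, inv_one, pull_one] }
  v_mul k l := by
    rw [← map_cmul_of_conv, cmul_single, mul_one]
    rfl
  star_v k := by
    rw [← map_cstar_of_conv, cstar_single, star_one]
    rfl
  v_one := rfl
  cov k f := by
    change π.toLin _ * _ = _ * π.toLin _
    rw [← map_cmul_of_conv, ← map_cmul_of_conv, cmul_single, cmul_single]
    congr 3
    · simp
    · rw [pull_one]
      ext x
      simp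

theorem ofConv_lin (π : ConvRep (TwoCocycle.trivial (transformationGroupoid K X α)) B)
    (F : K →₀ C(X, ℂ)) : (ofConv π).lin F = π.toLin ((transformationEquiv α).symm F) := by
  induction F using Finsupp.induction_linear with
  | zero => simp
  | add f g hf hg => simp only [map_add, hf, hg]
  | single k f =>
    rw [lin_single]
    change π.toLin _ * π.toLin _ = _
    rw [← map_cmul_of_conv, cmul_single, mul_one]
    congr 3
    ext x
    simp

end CovPair

end Transformation

/-! ### The isomorphism of the full C*-algebras -/

section Isomorphism

open SemidirectProduct

/-- A family of representations of a twisted group algebra and a family of representations of a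
crossed product generate isomorphic C*-algebras, if they define the same norm on the twisted group
algebra. -/
theorem nonempty_generatedCStar_equiv {H : Type u} [CommGroup H] {K : Type v} [Group K]
    {β : K →* MulAut H} {X : Type w} [TopologicalSpace X] [CompactSpace X] [T2Space X]
    {ω : TwoCocycle (ofGroup (H ⋊[β] K))} {χ : H →* C(X, Circle)} {α : K →* (X ≃ₜ X)}
    (hα : IsDualAction ω χ α)
    {I J : Type*} {A : I → Type*} {B : J → Type*} [∀ i, NonUnitalCStarAlgebra (A i)]
    [∀ j, NonUnitalCStarAlgebra (B j)] (R : ∀ i, ProjRep ω (A i)) (P : ∀ j, CovPair α (B j))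
    (T : Set (BddFamily A)) (T' : Set (BddFamily B))
    (hT : ∀ a, a ∈ T ↔ ∃ f : Cc (ofGroup (H ⋊[β] K)), ∀ i, a i = (R i).lin (groupEquiv _ f))
    (hT' : ∀ b, b ∈ T' ↔ ∃ f : Cc (transformationGroupoid K X α),
      ∀ j, b j = (P j).lin (transformationEquiv α f))
    (h : ∀ c, ∀ C : ℝ, 0 ≤ C →
      ((∀ i, ‖(R i).lin c‖ ≤ C) ↔ ∀ j, ‖(P j).lin (trigPoly ω χ c)‖ ≤ C)) :
    Nonempty (GeneratedCStar T ≃⋆ₐ[ℂ] GeneratedCStar T') := by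
  refine nonempty_generated_equiv (ProjRep.family R) ((CovPair.family P).toProj hα) _ _
    (fun c => (hT _).2 ⟨(groupEquiv _).symm c, fun i => ?_⟩) ?_
    (fun c => (hT' _).2 ⟨(transformationEquiv α).symm (trigPoly ω χ c), fun j => ?_⟩) ?_ fun c => ?_
  · rw [LinearEquiv.apply_symm_apply, ProjRep.family_lin]
  · intro a ha
    obtain ⟨f, hf⟩ := (hT a).1 ha
    refine NonUnitalStarSubalgebra.le_topologicalClosure _ ⟨groupEquiv _ f, ?_⟩
    exact lp.ext <| funext fun i => (ProjRep.family_lin R _ i).trans (hf i).symm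
  · rw [LinearEquiv.apply_symm_apply, CovPair.toProj_lin, CovPair.family_lin]
  · intro b hb
    obtain ⟨f, hf⟩ := (hT' b).1 hb
    have : b = (CovPair.family P).lin (transformationEquiv α f) :=
      lp.ext <| funext fun j => (hf j).trans (CovPair.family_lin P _ j).symm
    rw [this]
    exact (CovPair.family P).lin_mem_alg hα _
  -- The norm of a bounded family is the least bound of its coordinates, so each inequality is the
  -- hypothesis with `C` equal to the norm of the other side.
  · rw [CovPair.toProj_lin]
    apply le_antisymm
    · refine lp.norm_le_of_forall_le (norm_nonneg _) fun i => ?_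
      rw [ProjRep.family_lin]
      refine (h c _ (norm_nonneg _)).2 (fun j => ?_) i
      rw [← CovPair.family_lin]
      exact lp.norm_apply_le_norm ENNReal.top_ne_zero _ j
    · refine lp.norm_le_of_forall_le (norm_nonneg _) fun j => ?_
      rw [CovPair.family_lin]
      refine (h c _ (norm_nonneg _)).1 (fun i => ?_) j
      rw [← ProjRep.family_lin]
      exact lp.norm_apply_le_norm ENNReal.top_ne_zero _ i

/-- The full twisted group C*-algebra is the full crossed product. -/
theorem nonempty_fullCStar_equiv {H : Type u} [CommGroup H] {K : Type v} [Group K]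
    {β : K →* MulAut H} {X : Type u} [TopologicalSpace X] [CompactSpace X] [T2Space X]
    {ω : TwoCocycle (ofGroup (H ⋊[β] K))} {χ : H →* C(X, Circle)} {α : K →* (X ≃ₜ X)}
    (hα : IsDualAction ω χ α) :
    Nonempty (FullCStar ω ≃⋆ₐ[ℂ]
      FullCStar (TwoCocycle.trivial (transformationGroupoid K X α))) := by
  refine nonempty_generatedCStar_equiv hα
    (fun π : BundledRep ω => ProjRep.ofConv π.rep)
    (fun ρ : BundledRep (TwoCocycle.trivial (transformationGroupoid K X α)) =>
      CovPair.ofConv ρ.rep) _ _ (fun a => ?_) (fun b => ?_) fun c C _ => ⟨?_, ?_⟩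
  · simp only [ProjRep.ofConv_lin, LinearEquiv.symm_apply_apply]; rfl
  · simp only [CovPair.ofConv_lin, LinearEquiv.symm_apply_apply]; rfl
  -- A representation of the crossed product restricts to one of the twisted group algebra on the
  -- same C*-algebra, which therefore occurs among the given ones.
  · intro h ρ
    have := h ⟨ρ.target, ((CovPair.ofConv ρ.rep).toProj hα).toConv⟩
    rw [ProjRep.ofConv_lin] at this
    change ‖((CovPair.ofConv ρ.rep).toProj hα).lin (groupEquiv _ ((groupEquiv _).symm c))‖ ≤ C
      at this
    rwa [LinearEquiv.apply_symm_apply, CovPair.toProj_lin] at this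
  · intro h π
    obtain ⟨P, hv, hM⟩ := (ProjRep.ofConv π.rep).exists_covPair hα
    have := h ⟨π.target, P.toConv⟩
    rw [CovPair.ofConv_lin] at this
    change ‖P.lin (transformationEquiv α ((transformationEquiv α).symm _))‖ ≤ C at this
    rwa [LinearEquiv.apply_symm_apply, ProjRep.lin_eq_of_covPair _ P hv hM] at this

end Isomorphism

/-! ### Weighted permutation operators -/

section Weighted

variable {ι : Type u}

/-- The square summable families. -/
abbrev EllTwo (ι : Type u) : Type u := lp (fun _ : ι => ℂ) 2

/-- A permutation of the indices preserves the `ℓ²` norm and the weights enlarge it at most by their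
bound. The absolute value covers the empty index set, where `C` may be negative. -/
theorem tsum_weighted_le (σ : Equiv.Perm ι) (c : ι → ℂ) {C : ℝ} (hc : ∀ i, ‖c i‖ ≤ C)
    (ξ : EllTwo ι) :
    Summable (fun i => ‖c i * ξ (σ i)‖ ^ (2 : ℝ≥0∞).toReal) ∧
      ∑' i, ‖c i * ξ (σ i)‖ ^ (2 : ℝ≥0∞).toReal ≤ (|C| * ‖ξ‖) ^ (2 : ℝ≥0∞).toReal := by
  have h2 : 0 < (2 : ℝ≥0∞).toReal := by norm_num
  have hs : Summable fun i => |C| ^ (2 : ℝ≥0∞).toReal * ‖ξ (σ i)‖ ^ (2 : ℝ≥0∞).toReal :=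
    (σ.summable_iff.2 ((lp.memℓp ξ).summable h2)).mul_left _
  have hle (i : ι) : ‖c i * ξ (σ i)‖ ^ (2 : ℝ≥0∞).toReal ≤
      |C| ^ (2 : ℝ≥0∞).toReal * ‖ξ (σ i)‖ ^ (2 : ℝ≥0∞).toReal := by
    rw [← Real.mul_rpow (abs_nonneg _) (norm_nonneg _), norm_mul]
    have := (hc i).trans (le_abs_self C)
    gcongr
  have hs' := Summable.of_nonneg_of_le (fun i => by positivity) hle hs
  refine ⟨hs', (hs'.tsum_le_tsum hle hs).trans_eq ?_⟩
  rw [tsum_mul_left, σ.tsum_eq fun i => ‖ξ i‖ ^ (2 : ℝ≥0∞).toReal,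
    ← lp.norm_rpow_eq_tsum h2, Real.mul_rpow (abs_nonneg _) (norm_nonneg _)]

/-- The operator `ξ ↦ (c i * ξ (σ i))_i`. -/
def wperm (σ : Equiv.Perm ι) (c : ι → ℂ) (C : ℝ) (hc : ∀ i, ‖c i‖ ≤ C) :
    EllTwo ι →L[ℂ] EllTwo ι :=
  LinearMap.mkContinuous
    { toFun := fun ξ => ⟨fun i => c i * ξ (σ i), memℓp_gen (tsum_weighted_le σ c hc ξ).1⟩
      map_add' := fun ξ η => lp.ext <| funext fun i => mul_add _ _ _
      map_smul' := fun z ξ => lp.ext <| funext fun i => mul_left_comm _ _ _ }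
    |C| fun ξ => lp.norm_le_of_tsum_le (by norm_num) (by positivity) (tsum_weighted_le σ c hc ξ).2

@[simp] theorem wperm_apply (σ : Equiv.Perm ι) (c : ι → ℂ) (C : ℝ) (hc : ∀ i, ‖c i‖ ≤ C)
    (ξ : EllTwo ι) (i : ι) : wperm σ c C hc ξ i = c i * ξ (σ i) := rfl

theorem star_wperm (σ : Equiv.Perm ι) (c : ι → ℂ) (C : ℝ) (hc : ∀ i, ‖c i‖ ≤ C) :
    star (wperm σ c C hc) = wperm σ.symm (fun i => starRingEnd ℂ (c (σ.symm i))) C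
      fun i => by rw [RCLike.norm_conj]; exact hc _ := by
  rw [ContinuousLinearMap.star_eq_adjoint]
  symm
  rw [ContinuousLinearMap.eq_adjoint_iff]
  intro ξ η
  rw [lp.inner_eq_tsum, lp.inner_eq_tsum, ← σ.tsum_eq]
  refine tsum_congr fun i => ?_
  simp only [wperm_apply, RCLike.inner_apply, map_mul, RCLike.conj_conj, Equiv.symm_apply_apply]
  ring

theorem ext_wperm {T S : EllTwo ι →L[ℂ] EllTwo ι} (h : ∀ ξ i, T ξ i = S ξ i) : T = S :=
  ContinuousLinearMap.ext fun ξ => lp.ext <| funext fun i => h ξ i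

end Weighted

/-! ### The left regular representations -/

section LeftRegularGroup

variable {G : Type u} [Group G] {ω : TwoCocycle (ofGroup G)}

/-- Left translation on the source fibre. -/
def fibreTranslation (x : Units (ofGroup G)) (a : G) : Equiv.Perm (Fibre x) where
  toFun γ := ⟨(a⁻¹ * γ.1 : G), γ.2⟩
  invFun γ := ⟨(a * γ.1 : G), γ.2⟩
  left_inv γ := Subtype.ext (mul_inv_cancel_left a γ.1)
  right_inv γ := Subtype.ext (inv_mul_cancel_left a γ.1)

/-- The left regular representation of a discrete group. -/
def leftRegular (hω : ω (1 : G) (1 : G) = 1) (x : Units (ofGroup G)) :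
    ProjRep ω (FibreSpace x →L[ℂ] FibreSpace x) where
  U a := wperm (fibreTranslation x a) (fun γ => (ω a (a⁻¹ * γ.1 : G) : ℂ)) 1
    fun γ => (Circle.norm_coe _).le
  U_mul a b := by
    refine ext_wperm fun ξ γ => ?_
    change (ω a (a⁻¹ * γ.1 : G) : ℂ) * ((ω b (b⁻¹ * (a⁻¹ * γ.1) : G) : ℂ) *
      ξ ⟨(b⁻¹ * (a⁻¹ * γ.1) : G), γ.2⟩) = (ω a b : ℂ) *
        ((ω (a * b : G) ((a * b)⁻¹ * γ.1 : G) : ℂ) * ξ ⟨((a * b)⁻¹ * γ.1 : G), γ.2⟩)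
    have h1 : ((a * b)⁻¹ * γ.1 : G) = b⁻¹ * (a⁻¹ * γ.1) := by rw [mul_inv_rev, mul_assoc]
    -- Multiplicativity at the coordinate `γ` is the cocycle identity for `a`, `b` and the remaining
    -- factor `(ab)⁻¹γ`.
    have h2 := ω.group_cocycle a b (b⁻¹ * (a⁻¹ * γ.1))
    rw [mul_inv_cancel_left] at h2
    have h3 := congrArg (fun z : Circle => (z : ℂ)) h2
    simp only [Circle.coe_mul] at h3
    simp only [h1]
    rw [← mul_assoc, h3]
    ring
  star_U a := by
    rw [star_wperm]
    refine ext_wperm fun ξ γ => ?_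
    change starRingEnd ℂ (ω a (a⁻¹ * (a * γ.1) : G) : ℂ) * ξ ⟨(a * γ.1 : G), γ.2⟩ =
      starRingEnd ℂ (ω (a⁻¹ : G) a : ℂ) *
        ((ω (a⁻¹ : G) (a⁻¹⁻¹ * γ.1 : G) : ℂ) * ξ ⟨(a⁻¹⁻¹ * γ.1 : G), γ.2⟩)
    have h1 : (a⁻¹⁻¹ * γ.1 : G) = a * γ.1 := by rw [inv_inv]
    -- With `ω(1, γ) = 1` this becomes `ω(a⁻¹, aγ) ω(a, γ) = ω(a⁻¹, a)`, which compares the weights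
    -- of the adjoint with those of `U a⁻¹`.
    have h2 := ω.group_cocycle a⁻¹ a γ.1
    have h4 : ω (1 : G) γ.1 = 1 := by
      have := ω.group_cocycle (1 : G) (1 : G) γ.1
      rw [one_mul, one_mul, hω, mul_one] at this
      exact mul_eq_left.1 this
    rw [inv_mul_cancel, h4, one_mul] at h2
    have h3 := congrArg (fun z : Circle => (z : ℂ)) h2
    simp only [Circle.coe_mul] at h3
    simp only [h1, inv_mul_cancel_left, ← h3, map_mul]
    have h5 := conj_mul_coe_circle (ω (a⁻¹ : G) (a * γ.1 : G))
    linear_combination (-starRingEnd ℂ (ω a γ.1 : ℂ) * ξ ⟨(a * γ.1 : G), γ.2⟩) * h5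

theorem leftRegular_lin_apply (hω : ω (1 : G) (1 : G) = 1) (x : Units (ofGroup G)) (c : G →₀ ℂ)
    (ξ : FibreSpace x) (γ : Fibre x) :
    (leftRegular hω x).lin c ξ γ =
      ∑ a ∈ c.support, c a * ((ω a (a⁻¹ * γ.1 : G) : ℂ) * ξ ⟨(a⁻¹ * γ.1 : G), γ.2⟩) := by
  rw [ProjRep.lin_apply, Finsupp.sum, sum_apply, lp.coeFn_sum,
    Finset.sum_apply]
  rfl

/-- Translations preserve the source fibre, so the extension by zero of `ξ` is only evaluated where
it agrees with `ξ`, and the convolution formula determines the operator. -/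
theorem isLeftRegular_iff_group (hω : ω (1 : G) (1 : G) = 1) (x : Units (ofGroup G))
    (f : Cc (ofGroup G)) (T : FibreSpace x →L[ℂ] FibreSpace x) :
    IsLeftRegular ω x f T ↔ T = (leftRegular hω x).lin (groupEquiv G f) := by
  have key (ξ : FibreSpace x) (γ : Fibre x) :
      conv ω f (Function.extend Subtype.val (ξ : Fibre x → ℂ) 0) γ =
        (leftRegular hω x).lin (groupEquiv G f) ξ γ := by
    rw [leftRegular_lin_apply]
    refine (conv_ofGroup (fun a : G => f a) _ (groupEquiv G f).support
      (fun a ha => Finsupp.notMem_support_iff.1 ha) γ.1).trans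
      (Finset.sum_congr rfl fun a _ => ?_)
    have := Subtype.val_injective.extend_apply (ξ : Fibre x → ℂ) 0 ⟨(a⁻¹ * γ.1 : G), γ.2⟩
    rw [show Function.extend Subtype.val (ξ : Fibre x → ℂ) 0 (a⁻¹ * γ.1 : G) = _ from this,
      groupEquiv_apply]
    ring
  constructor
  · exact fun h => ext_wperm fun ξ γ => (h ξ γ).trans (key ξ γ)
  · rintro rfl ξ γ
    exact (key ξ γ).symm

end LeftRegularGroup

section LeftRegularTransformation

variable {K : Type v} [Group K] {X : Type w} [TopologicalSpace X] [CompactSpace X] [T2Space X]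
  {α : K →* (X ≃ₜ X)}

/-- Left translation on the source fibre. -/
def orbitTranslation (x : Units (transformationGroupoid K X α)) (k : K) :
    Equiv.Perm (Fibre x) where
  toFun γ := ⟨(k⁻¹ * γ.1.1, γ.1.2), γ.2⟩
  invFun γ := ⟨(k * γ.1.1, γ.1.2), γ.2⟩
  left_inv γ := Subtype.ext (Prod.ext (mul_inv_cancel_left k γ.1.1) rfl)
  right_inv γ := Subtype.ext (Prod.ext (inv_mul_cancel_left k γ.1.1) rfl)

/-- The left regular representations of a transformation groupoid. -/
def orbitPair (x : Units (transformationGroupoid K X α)) :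
    CovPair α (FibreSpace x →L[ℂ] FibreSpace x) where
  v k := wperm (orbitTranslation x k) (fun _ => 1) 1 fun _ => norm_one.le
  M :=
    -- A function on the unit space multiplies the coordinate at an arrow by its value at the range
    -- of the arrow.
    { toFun := fun f => wperm 1 (fun γ => f (α γ.1.1 γ.1.2)) ‖f‖ fun γ => f.norm_coe_le_norm _
      map_smul' := fun c f => ext_wperm fun ξ γ => mul_assoc _ _ _
      map_zero' := ext_wperm fun ξ γ => zero_mul _
      map_add' := fun f g => ext_wperm fun ξ γ => add_mul _ _ _
      map_mul' := fun f g => ext_wperm fun ξ γ => mul_assoc _ _ _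
      map_star' := fun f => by
        rw [star_wperm]
        rfl }
  v_mul k l := by
    refine ext_wperm fun ξ γ => ?_
    change 1 * (1 * ξ ⟨(l⁻¹ * (k⁻¹ * γ.1.1), γ.1.2), γ.2⟩) =
      1 * ξ ⟨((k * l)⁻¹ * γ.1.1, γ.1.2), γ.2⟩
    simp only [mul_inv_rev, mul_assoc, one_mul]
  star_v k := by
    rw [star_wperm]
    refine ext_wperm fun ξ γ => ?_
    change starRingEnd ℂ 1 * ξ ⟨(k * γ.1.1, γ.1.2), γ.2⟩ =
      1 * ξ ⟨(k⁻¹⁻¹ * γ.1.1, γ.1.2), γ.2⟩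
    rw [map_one, inv_inv]
  v_one := by
    refine ext_wperm fun ξ γ => ?_
    change 1 * ξ ⟨(1⁻¹ * γ.1.1, γ.1.2), γ.2⟩ = 1 * ξ γ
    simp only [inv_one, one_mul]
  cov k f := by
    refine ext_wperm fun ξ γ => ?_
    change f (α γ.1.1 γ.1.2) * (1 * ξ ⟨(k⁻¹ * γ.1.1, γ.1.2), γ.2⟩) =
      1 * (f (α k (α (k⁻¹ * γ.1.1) γ.1.2)) * ξ ⟨(k⁻¹ * γ.1.1, γ.1.2), γ.2⟩)
    rw [← Homeomorph.mul_apply, ← map_mul, mul_inv_cancel_left]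
    ring

theorem orbitPair_lin_apply (x : Units (transformationGroupoid K X α)) (F : K →₀ C(X, ℂ))
    (ξ : FibreSpace x) (γ : Fibre x) :
    (orbitPair x).lin F ξ γ = ∑ k ∈ F.support, F k (α (k⁻¹ * γ.1.1) γ.1.2) *
      ξ ⟨(k⁻¹ * γ.1.1, γ.1.2), γ.2⟩ := by
  rw [CovPair.lin_apply, Finsupp.sum, sum_apply, lp.coeFn_sum,
    Finset.sum_apply]
  exact Finset.sum_congr rfl fun k _ => one_mul _

theorem isLeftRegular_iff_transformation (x : Units (transformationGroupoid K X α))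
    (f : Cc (transformationGroupoid K X α)) (T : FibreSpace x →L[ℂ] FibreSpace x) :
    IsLeftRegular (TwoCocycle.trivial (transformationGroupoid K X α)) x f T ↔
      T = (orbitPair x).lin (transformationEquiv α f) := by
  have key (ξ : FibreSpace x) (γ : Fibre x) :
      conv (TwoCocycle.trivial (transformationGroupoid K X α)) f
        (Function.extend Subtype.val (ξ : Fibre x → ℂ) 0) γ =
        (orbitPair x).lin (transformationEquiv α f) ξ γ := by
    rw [orbitPair_lin_apply]
    refine (conv_transformation (α := α) (fun p => f p) _ (transformationEquiv α f).support
      (fun a ha y => DFunLike.congr_fun (Finsupp.notMem_support_iff.1 ha) y)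
      γ.1.1 γ.1.2).trans (Finset.sum_congr rfl fun a _ => ?_)
    have := Subtype.val_injective.extend_apply (ξ : Fibre x → ℂ) 0
      ⟨(a⁻¹ * γ.1.1, γ.1.2), γ.2⟩
    rw [show Function.extend Subtype.val (ξ : Fibre x → ℂ) 0 (a⁻¹ * γ.1.1, γ.1.2) = _ from this]
    rfl
  constructor
  · exact fun h => ext_wperm fun ξ γ => (h ξ γ).trans (key ξ γ)
  · rintro rfl ξ γ
    exact (key ξ γ).symm

end LeftRegularTransformation

/-! ### The invariant mean on the dual -/

section Mean

variable {H : Type u} [CommGroup H] {X : Type w} [TopologicalSpace X] [CompactSpace X]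
  {χ : H →* C(X, Circle)}

/-- A real-valued function as a complex-valued function. -/
def realToComplex (r : C(X, ℝ)) : C(X, ℂ) := ⟨fun x => (r x : ℂ), by fun_prop⟩

@[simp] theorem realToComplex_apply (r : C(X, ℝ)) (x : X) : realToComplex r x = (r x : ℂ) := rfl

/-- The square root of a real-valued function, as a complex-valued function. -/
def sqrtComplex (r : C(X, ℝ)) : C(X, ℂ) :=
  realToComplex ⟨fun x => Real.sqrt (r x), by fun_prop⟩

theorem star_sqrtComplex_mul (r : C(X, ℝ)) (hr : ∀ x, 0 ≤ r x) :
    star (sqrtComplex r) * sqrtComplex r = realToComplex r := by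
  ext x
  change starRingEnd ℂ (Real.sqrt (r x) : ℂ) * (Real.sqrt (r x) : ℂ) = (r x : ℂ)
  rw [Complex.conj_ofReal, ← Complex.ofReal_mul, Real.mul_self_sqrt (hr x)]

/-- The integral over the dual group: a positive functional for which the characters are
orthonormal. -/
structure IsDualMean (χ : H →* C(X, Circle)) (μ : C(X, ℂ) →L[ℂ] ℂ) : Prop where
  map_one : μ 1 = 1
  map_chr : ∀ h, h ≠ 1 → μ (chr χ h) = 0
  nonneg : ∀ f, 0 ≤ (μ (star f * f)).re

/-- A nonnegative function is `star s * s` for its square root `s`. -/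
theorem IsDualMean.re_nonneg {μ : C(X, ℂ) →L[ℂ] ℂ} (hμ : IsDualMean χ μ) (r : C(X, ℝ))
    (hr : ∀ x, 0 ≤ r x) : 0 ≤ (μ (realToComplex r)).re := by
  rw [← star_sqrtComplex_mul r hr]
  exact hμ.nonneg _

/-- No group structure on `X` is given; translation by `y` is reconstructed by multiplying
characters pointwise. -/
theorem IsDualPairing.exists_translation (hχ : IsDualPairing χ) (y : X) :
    ∃ t : C(X, X), ∀ h x, χ h (t x) = χ h y * χ h x := by
  let ψ (x : X) : H →* Circle :=
    { toFun := fun h => χ h y * χ h x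
      map_one' := by simp
      map_mul' := fun a b => by simp [mul_mul_mul_comm] }
  choose t ht using fun x => hχ.surjective (ψ x)
  refine ⟨⟨t, hχ.continuous_iff t fun h => ?_⟩, fun h x => ht x h⟩
  simp only [ht]
  change Continuous fun x => χ h y * χ h x
  fun_prop

/-- The mean is faithful. -/
theorem IsDualMean.faithful {μ : C(X, ℂ) →L[ℂ] ℂ} (hμ : IsDualMean χ μ) (hχ : IsDualPairing χ)
    (u : C(X, ℂ)) (hu : (μ (star u * u)).re = 0) : u = 0 := by
  choose t ht using hχ.exists_translation
  -- A translation multiplies the character of `h` by a scalar, which is `1` for `h = 1`, while the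
  -- mean vanishes for all other `h`. So the mean is invariant.
  have hinv (y : X) (f : C(X, ℂ)) : μ (f.comp (t y)) = μ f := by
    have : μ.comp (starHomCLM ((ContinuousMap.compStarAlgHom' ℂ ℂ (t y) : C(X, ℂ) →⋆ₐ[ℂ] C(X, ℂ)) :
        C(X, ℂ) →⋆ₙₐ[ℂ] C(X, ℂ))) = μ := by
      refine hχ.clm_ext fun h => ?_
      have e : (chr χ h).comp (t y) = (χ h y : ℂ) • chr χ h := by
        ext x
        simp [chr_apply, ht]
      change μ ((chr χ h).comp (t y)) = μ (chr χ h)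
      rw [e, map_smul]
      by_cases hh : h = 1
      · subst hh; simp
      · rw [hμ.map_chr h hh, smul_zero]
    exact DFunLike.congr_fun this f
  by_contra hne
  obtain ⟨x₀, hx₀⟩ : ∃ x, u x ≠ 0 := by
    by_contra hcon
    push Not at hcon
    exact hne (ContinuousMap.ext hcon)
  have htrans (x : X) : ∃ y, t y x = x₀ := by
    obtain ⟨y, hy⟩ := hχ.surjective
      { toFun := fun h => χ h x₀ * (χ h x)⁻¹
        map_one' := by simp
        map_mul' := fun a b => by 
          simp only [map_mul, ContinuousMap.mul_apply, mul_inv]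
          exact mul_mul_mul_comm _ _ _ _ }
    refine ⟨y, hχ.injective _ _ fun h => ?_⟩
    rw [ht, hy]
    simp
  -- Translations act transitively, so finitely many translates of the open set where `u` does not
  -- vanish cover `X`. The corresponding sum of translates of `|u|²` is then strictly positive, but
  -- has mean zero.
  obtain ⟨s, hs⟩ := isCompact_univ.elim_finite_subcover (fun y => {x | u (t y x) ≠ 0})
    (fun y => isOpen_ne_fun (by fun_prop) continuous_const) fun x _ => by
      obtain ⟨y, hy⟩ := htrans x
      exact Set.mem_iUnion.2 ⟨y, by simpa [hy] using hx₀⟩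
  let r : C(X, ℝ) := ⟨fun x => ∑ y ∈ s, ‖u (t y x)‖ ^ 2, by fun_prop⟩
  have hr : realToComplex r = ∑ y ∈ s, (star u * u).comp (t y) := by
    ext x
    rw [ContinuousMap.sum_apply, realToComplex_apply]
    change ((∑ y ∈ s, ‖u (t y x)‖ ^ 2 : ℝ) : ℂ) = _
    push_cast
    refine Finset.sum_congr rfl fun y _ => ?_
    change _ = starRingEnd ℂ (u (t y x)) * u (t y x)
    rw [Complex.conj_mul']
  have hμr : (μ (realToComplex r)).re = 0 := by
    rw [hr, map_sum, Complex.re_sum]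
    exact Finset.sum_eq_zero fun y _ => by rw [hinv, hu]
  obtain ⟨x₁, -, hx₁⟩ := isCompact_univ.exists_isMinOn (⟨x₀, trivial⟩ : (Set.univ : Set X).Nonempty)
    r.continuous.continuousOn
  have hpos : 0 < r x₁ := by
    obtain ⟨y, hy, hyx⟩ : ∃ y ∈ s, u (t y x₁) ≠ 0 := by simpa using hs (Set.mem_univ x₁)
    exact Finset.sum_pos' (fun _ _ => by positivity) ⟨y, hy, by positivity⟩
  -- Positivity and normalisation of the mean would force it to be at least the minimum `r x₁ > 0`.
  have hsub := hμ.re_nonneg (r - ContinuousMap.const X (r x₁)) fun x =>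
    sub_nonneg.2 (hx₁ (Set.mem_univ x))
  have e : realToComplex (r - ContinuousMap.const X (r x₁)) =
      realToComplex r - (r x₁ : ℂ) • 1 := by
    ext x; simp
  rw [e, map_sub, map_smul, hμ.map_one, Complex.sub_re, hμr] at hsub
  simp at hsub
  linarith

/-- Let `m` be the negative part of `r`. Testing against its square root shows that the mean of `m²
= -m r` is at most zero, so it vanishes, and `m = 0` by faithfulness. -/
theorem IsDualMean.nonneg_of_forall {μ : C(X, ℂ) →L[ℂ] ℂ} (hμ : IsDualMean χ μ)
    (hχ : IsDualPairing χ) (r : C(X, ℝ))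
    (hr : ∀ g : C(X, ℂ), 0 ≤ (μ (star g * g * realToComplex r)).re) (x : X) : 0 ≤ r x := by
  let m : C(X, ℝ) := ⟨fun x => max (-r x) 0, by fun_prop⟩
  have hm : ∀ x, 0 ≤ m x := fun x => le_max_right _ _
  have h1 := hr (sqrtComplex m)
  have hsq : star (realToComplex m) * realToComplex m =
      -(star (sqrtComplex m) * sqrtComplex m * realToComplex r) := by
    rw [star_sqrtComplex_mul m hm]
    ext x
    change starRingEnd ℂ (m x : ℂ) * (m x : ℂ) = -((m x : ℂ) * (r x : ℂ))
    rw [Complex.conj_ofReal]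
    norm_cast
    change max (-r x) 0 * max (-r x) 0 = -(max (-r x) 0 * r x)
    rcases le_total (-r x) 0 with h | h
    · rw [max_eq_right h]; simp
    · rw [max_eq_left h]; ring
  have h2 := hμ.nonneg (realToComplex m)
  rw [hsq, map_neg, Complex.neg_re] at h2
  have h3 := hμ.faithful hχ (realToComplex m) (by
    rw [hsq, map_neg, Complex.neg_re, le_antisymm (neg_nonneg.1 h2) h1, neg_zero])
  have h4 : ((max (-r x) 0 : ℝ) : ℂ) = 0 := DFunLike.congr_fun h3 x
  have h5 := le_max_left (-r x) 0
  rw [Complex.ofReal_eq_zero.1 h4] at h5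
  linarith

end Mean

/-! ### The isomorphism of the reduced C*-algebras -/

section Vacuum

variable {K : Type v} [Group K] {X : Type w} [TopologicalSpace X] [CompactSpace X] [T2Space X]
  {α : K →* (X ≃ₜ X)} {E : Type w'} [NormedAddCommGroup E] [InnerProductSpace ℂ E]
  [CompleteSpace E]

/-- The conditional expectation of `F* F`. -/
def gram (α : K →* (X ≃ₜ X)) (F : K →₀ C(X, ℂ)) : C(X, ℂ) :=
  CovPair.cmul α (CovPair.cstar α F) F 1

/-- A cyclic vector whose vector functional factors through the conditional expectation. -/
structure IsVacuum (P : CovPair α (E →L[ℂ] E)) (δ : E) (φ : C(X, ℂ) → ℂ) : Prop where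
  inner_lin : ∀ F, inner ℂ δ (P.lin F δ) = φ (F 1)
  dense : DenseRange fun F => P.lin F δ

/-- Since `lin` is a *-homomorphism, the squared norm is the vector functional at `F* F`, which sees
only the component at `1`. -/
theorem IsVacuum.norm_sq {P : CovPair α (E →L[ℂ] E)} {δ : E} {φ : C(X, ℂ) → ℂ}
    (h : IsVacuum P δ φ) (F : K →₀ C(X, ℂ)) : ((‖P.lin F δ‖ ^ 2 : ℝ) : ℂ) = φ (gram α F) := by
  rw [gram, ← h.inner_lin, CovPair.lin_cmul, CovPair.lin_cstar,
    ContinuousLinearMap.star_eq_adjoint, mul_apply_eq_comp,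
    ContinuousLinearMap.adjoint_inner_right, inner_self_eq_norm_sq_to_K]
  push_cast
  rfl

theorem IsVacuum.norm_le {P : CovPair α (E →L[ℂ] E)} {δ : E} {φ : C(X, ℂ) → ℂ}
    (h : IsVacuum P δ φ) (T : E →L[ℂ] E) {C : ℝ} (hC : 0 ≤ C)
    (hT : ∀ F, ‖T (P.lin F δ)‖ ^ 2 ≤ C ^ 2 * ‖P.lin F δ‖ ^ 2) : ‖T‖ ≤ C := by
  refine T.opNorm_le_bound hC fun ξ => ?_
  refine h.dense.induction_on ξ (isClosed_le (by fun_prop) (by fun_prop)) fun F => ?_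
  rw [← abs_of_nonneg (norm_nonneg (T (P.lin F δ))),
    ← abs_of_nonneg (mul_nonneg hC (norm_nonneg (P.lin F δ))), ← sq_le_sq, mul_pow]
  exact hT F

/-- A representation whose vacuum functional is the integral over the dual group has the same norm
as the collection of the representations on the orbits. -/
theorem norm_le_iff_forall_orbit {H : Type u} [CommGroup H] {χ : H →* C(X, Circle)}
    (hχ : IsDualPairing χ) {μ : C(X, ℂ) →L[ℂ] ℂ} (hμ : IsDualMean χ μ)
    {P : CovPair α (E →L[ℂ] E)} {δ : E} (hP : IsVacuum P δ μ)
    {J : Type*} (pt : J → X) (hpt : Function.Surjective pt) {D : J → Type*}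
    [∀ j, NormedAddCommGroup (D j)] [∀ j, InnerProductSpace ℂ (D j)] [∀ j, CompleteSpace (D j)]
    (Q : ∀ j, CovPair α (D j →L[ℂ] D j)) (e : ∀ j, D j)
    (hQ : ∀ j, IsVacuum (Q j) (e j) fun f => f (pt j))
    (hQM : ∀ j f, (Q j).M f (e j) = f (pt j) • e j) (T : K →₀ C(X, ℂ)) {C : ℝ} (hC : 0 ≤ C) :
    ‖P.lin T‖ ≤ C ↔ ∀ j, ‖(Q j).lin T‖ ≤ C := by
  have hgram (j : J) (F : K →₀ C(X, ℂ)) :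
      gram α F (pt j) = ((‖(Q j).lin F (e j)‖ ^ 2 : ℝ) : ℂ) := ((hQ j).norm_sq F).symm
  let r (F : K →₀ C(X, ℂ)) : C(X, ℝ) := ⟨fun x => (gram α F x).re, by fun_prop⟩
  -- Every point of `X` is the base point of some orbit, where the Gram function equals a squared
  -- norm; in particular it is real.
  have hr (F : K →₀ C(X, ℂ)) : realToComplex (r F) = gram α F := by
    ext x
    obtain ⟨j, rfl⟩ := hpt x
    change (((gram α F (pt j)).re : ℝ) : ℂ) = _
    rw [hgram, Complex.ofReal_re]
  have hrj (j : J) (F : K →₀ C(X, ℂ)) : r F (pt j) = ‖(Q j).lin F (e j)‖ ^ 2 := by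
    change (gram α F (pt j)).re = _
    rw [hgram, Complex.ofReal_re]
  have hPr (F : K →₀ C(X, ℂ)) : ‖P.lin F δ‖ ^ 2 = (μ (realToComplex (r F))).re := by
    rw [hr, ← hP.norm_sq, Complex.ofReal_re]
  have hsub (F : K →₀ C(X, ℂ)) : realToComplex (C ^ 2 • r F - r (CovPair.cmul α T F)) =
      ((C ^ 2 : ℝ) : ℂ) • realToComplex (r F) - realToComplex (r (CovPair.cmul α T F)) := by
    ext x; simp
  constructor
  · intro h j
    refine (hQ j).norm_le _ hC fun F => ?_
    have hpos := hμ.nonneg_of_forall hχ (C ^ 2 • r F - r (CovPair.cmul α T F)) (fun g => ?_) (pt j)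
    · change 0 ≤ C ^ 2 * r F (pt j) - r (CovPair.cmul α T F) (pt j) at hpos
      rw [hrj, hrj, CovPair.lin_cmul, mul_apply_eq_comp] at hpos
      linarith
    -- Right multiplication of `G` by a function `g` multiplies its Gram function by `|g|²`. This
    -- provides the test functions required by `nonneg_of_forall`.
    · have hmul (G : K →₀ C(X, ℂ)) : star g * g * realToComplex (r G) =
          realToComplex (r (CovPair.cmul α G (Finsupp.single 1 g))) := by
        rw [hr, hr]
        ext x
        obtain ⟨j, rfl⟩ := hpt x
        change starRingEnd ℂ (g (pt j)) * g (pt j) * gram α G (pt j) = _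
        rw [hgram, hgram, CovPair.lin_cmul, CovPair.lin_single, (Q j).v_one, ← map_mul, one_mul,
          mul_apply_eq_comp, hQM, map_smul, norm_smul, Complex.conj_mul', mul_pow]
        push_cast
        rfl
      -- Associativity is needed only for Gram functions, where it is inherited from operators in
      -- the orbit representations.
      have hassoc : r (CovPair.cmul α (CovPair.cmul α T F) (Finsupp.single 1 g)) =
          r (CovPair.cmul α T (CovPair.cmul α F (Finsupp.single 1 g))) := by
        ext x
        obtain ⟨j, rfl⟩ := hpt x
        rw [hrj, hrj]
        simp only [CovPair.lin_cmul, mul_assoc]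
      rw [hsub, mul_sub, mul_smul_comm, hmul, hmul, hassoc, map_sub, map_smul, Complex.sub_re,
        smul_eq_mul, Complex.re_ofReal_mul, ← hPr, ← hPr, CovPair.lin_cmul P T,
        mul_apply_eq_comp, ← mul_pow, sub_nonneg]
      have := (P.lin T).le_of_opNorm_le h (P.lin (CovPair.cmul α F (Finsupp.single 1 g)) δ)
      gcongr
  · intro h
    refine hP.norm_le _ hC fun F => ?_
    -- Conversely, the bounds on the orbits give a pointwise inequality, which the positive mean
    -- preserves.
    have hpos := hμ.re_nonneg (C ^ 2 • r F - r (CovPair.cmul α T F)) fun x => ?_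
    · rw [hsub, map_sub, map_smul, Complex.sub_re, smul_eq_mul, Complex.re_ofReal_mul, ← hPr,
        ← hPr, CovPair.lin_cmul, mul_apply_eq_comp] at hpos
      linarith
    · obtain ⟨j, rfl⟩ := hpt x
      change 0 ≤ C ^ 2 * r F (pt j) - r (CovPair.cmul α T F) (pt j)
      rw [hrj, hrj, CovPair.lin_cmul, mul_apply_eq_comp, ← mul_pow, sub_nonneg]
      have := ((Q j).lin T).le_of_opNorm_le (h j) ((Q j).lin F (e j))
      gcongr

end Vacuum

/-! ### The canonical basis of `ℓ²`. -/

section Basis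

variable {ι : Type u}

open Classical in
/-- The canonical basis of `ℓ²`. -/
def basisVec (i : ι) : EllTwo ι := lp.single 2 i 1

theorem basisVec_self (i : ι) : basisVec i i = 1 := by
  classical
  exact lp.single_apply_self (E := fun _ : ι => ℂ) 2 i 1

theorem basisVec_of_ne {i j : ι} (h : j ≠ i) : basisVec i j = 0 := by
  classical
  exact Pi.single_eq_of_ne (M := fun _ : ι => ℂ) h _

theorem inner_basisVec (i : ι) (ξ : EllTwo ι) : inner ℂ (basisVec i) ξ = ξ i := by
  classical
  rw [basisVec, lp.inner_single_left]
  simp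

theorem wperm_basisVec (σ : Equiv.Perm ι) (c : ι → ℂ) (C : ℝ) (hc : ∀ i, ‖c i‖ ≤ C) (i : ι) :
    wperm σ c C hc (basisVec i) = c (σ.symm i) • basisVec (σ.symm i) := by
  refine lp.ext (funext fun j => ?_)
  change c j * basisVec i (σ j) = c (σ.symm i) * basisVec (σ.symm i) j
  by_cases h : j = σ.symm i
  · subst h
    rw [σ.apply_symm_apply, basisVec_self, basisVec_self]
  · rw [basisVec_of_ne h, basisVec_of_ne fun e => h (by rw [← e, σ.symm_apply_apply]), mul_zero,
      mul_zero]

theorem dense_of_basisVec_mem (p : Submodule ℂ (EllTwo ι)) (h : ∀ i, basisVec i ∈ p) :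
    Dense (p : Set (EllTwo ι)) := by
  classical
  intro ξ
  refine mem_closure_of_tendsto (lp.hasSum_single ENNReal.ofNat_ne_top ξ)
    (Filter.Eventually.of_forall fun s => ?_)
  refine sum_mem fun i _ => ?_
  have : lp.single (E := fun _ : ι => ℂ) 2 i (ξ i) = ξ i • basisVec i := by
    refine lp.ext (funext fun j => ?_)
    change Pi.single (M := fun _ : ι => ℂ) i (ξ i) j = ξ i * basisVec i j
    by_cases hj : j = i
    · subst hj
      rw [basisVec_self, Pi.single_eq_same, mul_one]
    · rw [basisVec_of_ne hj, Pi.single_eq_of_ne hj, mul_zero]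
  rw [this]
  exact p.smul_mem _ (h i)

end Basis

/-! ### The vacuum vectors of the orbit representations. -/

section Orbit

variable {K : Type v} [Group K] {X : Type w} [TopologicalSpace X] [CompactSpace X] [T2Space X]
  {α : K →* (X ≃ₜ X)}

/-- The unit as an element of its source fibre. -/
def orbitBase (x : Units (transformationGroupoid K X α)) : Fibre x := ⟨(1, x.1.2), x.2⟩

theorem orbitPair_M_base (x : Units (transformationGroupoid K X α)) (f : C(X, ℂ)) :
    (orbitPair x).M f (basisVec (orbitBase x)) = f x.1.2 • basisVec (orbitBase x) := by
  refine (wperm_basisVec 1 _ ‖f‖ (fun γ => f.norm_coe_le_norm _) _).trans ?_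
  change f (α 1 x.1.2) • basisVec (orbitBase x) = _
  rw [map_one]
  rfl

theorem orbitPair_v_base (x : Units (transformationGroupoid K X α)) (γ : Fibre x) :
    (orbitPair x).v γ.1.1 (basisVec (orbitBase x)) = basisVec γ := by
  refine (wperm_basisVec _ _ 1 (fun _ => norm_one.le) _).trans ?_
  rw [one_smul]
  congr 1
  refine Subtype.ext (Prod.ext (mul_one γ.1.1) ?_)
  exact (congrArg Prod.snd γ.2).symm

/-- The operator `v k` sends the base vector to the basis vector at `(k, x)`, orthogonal to it
unless `k = 1`. Every arrow with source `x` is reached, so the base vector is cyclic. -/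
theorem isVacuum_orbitPair (x : Units (transformationGroupoid K X α)) :
    IsVacuum (orbitPair x) (basisVec (orbitBase x)) fun f => f x.1.2 where
  inner_lin F := by
    rw [inner_basisVec]
    induction F using Finsupp.induction_linear with
    | zero => simp
    | add f g hf hg =>
      rw [map_add, add_apply, lp.coeFn_add, Pi.add_apply, hf, hg]
      rfl
    | single k f =>
      rw [CovPair.lin_single, mul_apply_eq_comp, orbitPair_M_base, map_smul]
      change f x.1.2 * _ = _
      have h := orbitPair_v_base x ⟨(k, x.1.2), x.2⟩
      change (orbitPair x).v k (basisVec (orbitBase x)) = _ at h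
      rw [h]
      by_cases hk : k = 1
      · subst hk
        rw [Finsupp.single_eq_same]
        exact (congrArg (f x.1.2 * ·) (basisVec_self _)).trans (mul_one _)
      · rw [Finsupp.single_eq_of_ne (Ne.symm hk), basisVec_of_ne, mul_zero,
          ContinuousMap.zero_apply]
        exact fun e => hk (congrArg (fun γ : Fibre x => γ.1.1) e).symm
  dense := by
    let L := ((ContinuousLinearMap.apply ℂ (FibreSpace x) (basisVec (orbitBase x))).toLinearMap.comp
      (orbitPair x).lin)
    refine dense_of_basisVec_mem (LinearMap.range L) fun γ => ⟨Finsupp.single γ.1.1 1, ?_⟩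
    change (orbitPair x).lin _ _ = _
    rw [CovPair.lin_single, CovPair.v_mul_one, orbitPair_v_base]

end Orbit

/-! ### The vacuum vector of the left regular representation and the reduced isomorphism. -/

section Reduced

open SemidirectProduct

theorem leftRegular_U_base {G : Type u} [Group G] {ω : TwoCocycle (ofGroup G)}
    (hω : ω (1 : G) (1 : G) = 1) (x : Units (ofGroup G)) (γ : Fibre x) :
    (leftRegular hω x).U γ.1 (basisVec ⟨(1 : G), x.2⟩) = basisVec γ := by
  refine (wperm_basisVec _ _ 1 (fun _ => (Circle.norm_coe _).le) _).trans ?_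
  have h : (fibreTranslation x γ.1).symm ⟨(1 : G), x.2⟩ = γ := Subtype.ext (mul_one (γ.1 : G))
  rw [h]
  change (ω γ.1 ((γ.1 : G)⁻¹ * (γ.1 : G) : G) : ℂ) • _ = _
  rw [inv_mul_cancel, ω.map_one_right, hω, Circle.coe_one, one_smul]

variable {H : Type u} [CommGroup H] {K : Type v} [Group K] {β : K →* MulAut H}
  {X : Type w} [TopologicalSpace X] [CompactSpace X] [T2Space X]
  {ω : TwoCocycle (ofGroup (H ⋊[β] K))} {χ : H →* C(X, Circle)} {α : K →* (X ≃ₜ X)}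

/-- The vector functional at `δ`, restricted to the functions on `X`. -/
def vectorFunctional {E : Type w'} [NormedAddCommGroup E] [InnerProductSpace ℂ E]
    [CompleteSpace E] (P : CovPair α (E →L[ℂ] E)) (δ : E) : C(X, ℂ) →L[ℂ] ℂ :=
  (innerSL ℂ δ).comp ((ContinuousLinearMap.apply ℂ E δ).comp (starHomCLM P.M))

theorem vectorFunctional_apply {E : Type w'} [NormedAddCommGroup E] [InnerProductSpace ℂ E]
    [CompleteSpace E] (P : CovPair α (E →L[ℂ] E)) (δ : E) (f : C(X, ℂ)) :
    vectorFunctional P δ f = inner ℂ δ (P.M f δ) := rfl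

variable (hα : IsDualAction ω χ α) (x : Units (ofGroup (H ⋊[β] K)))
  (P : CovPair α (FibreSpace x →L[ℂ] FibreSpace x))
  (hv : ∀ k, P.v k = (leftRegular hα.normalized.map_one_one x).U (inr k))
  (hM : ∀ h, P.M (chr χ h) = (leftRegular hα.normalized.map_one_one x).U (inl h))

theorem inner_leftRegular_U (hω : ω (1 : H ⋊[β] K) (1 : H ⋊[β] K) = 1) (a : H ⋊[β] K) :
    inner ℂ (basisVec ⟨(1 : H ⋊[β] K), x.2⟩ : FibreSpace x)
      ((leftRegular hω x).U a (basisVec ⟨(1 : H ⋊[β] K), x.2⟩)) =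
        basisVec (ι := Fibre x) ⟨a, x.2⟩ ⟨(1 : H ⋊[β] K), x.2⟩ := by
  have h := leftRegular_U_base hω x ⟨a, x.2⟩
  change (leftRegular hω x).U a _ = _ at h
  rw [h, inner_basisVec]

theorem inner_leftRegular_U_of_ne (hω : ω (1 : H ⋊[β] K) (1 : H ⋊[β] K) = 1) (a : H ⋊[β] K)
    (ha : a ≠ 1) : inner ℂ (basisVec ⟨(1 : H ⋊[β] K), x.2⟩ : FibreSpace x)
      ((leftRegular hω x).U a (basisVec ⟨(1 : H ⋊[β] K), x.2⟩)) = 0 := by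
  rw [inner_leftRegular_U]
  exact basisVec_of_ne fun e => ha (congrArg Subtype.val e).symm

include hv hM in
-- The mean is obtained without measure theory: `U h` moves `δ_1` to `δ_h`, so the vector functional
-- at `δ_1` kills every nontrivial character.
theorem isDualMean_leftRegular :
    IsDualMean χ (vectorFunctional P (basisVec ⟨(1 : H ⋊[β] K), x.2⟩)) where
  map_one := by
    rw [vectorFunctional_apply, ← P.v_one, hv, map_one, inner_leftRegular_U]
    exact basisVec_self _
  map_chr h hh := by
    rw [vectorFunctional_apply, hM]
    exact inner_leftRegular_U_of_ne x _ _ fun e => hh (inl_injective (e.trans inl.map_one.symm))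
  nonneg f := by
    rw [vectorFunctional_apply, map_mul, map_star, ContinuousLinearMap.star_eq_adjoint,
      mul_apply_eq_comp, ContinuousLinearMap.adjoint_inner_right, ← RCLike.re_eq_complex_re]
    exact inner_self_nonneg

include hv hM in
theorem isVacuum_leftRegular :
    IsVacuum P (basisVec ⟨(1 : H ⋊[β] K), x.2⟩)
      (vectorFunctional P (basisVec ⟨(1 : H ⋊[β] K), x.2⟩)) where
  inner_lin F := by
    induction F using Finsupp.induction_linear with
    | zero => simp
    | add f g hf hg =>
      rw [map_add, add_apply, inner_add_right, hf, hg, ← map_add]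
      rfl
    | single k f =>
      rw [CovPair.lin_single]
      by_cases hk : k = 1
      · subst hk
        rw [Finsupp.single_eq_same, P.v_one, ← map_mul, one_mul, vectorFunctional_apply]
      · rw [Finsupp.single_eq_of_ne (Ne.symm hk), map_zero]
        -- For `k ≠ 1` no product `inr k * inl h` is the identity, so the matrix coefficient
        -- vanishes on characters and hence on all functions.
        have : (innerSL ℂ (basisVec ⟨(1 : H ⋊[β] K), x.2⟩ : FibreSpace x)).comp
            ((P.v k).comp ((ContinuousLinearMap.apply ℂ (FibreSpace x)
              (basisVec ⟨(1 : H ⋊[β] K), x.2⟩)).comp (starHomCLM P.M))) = 0 := by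
          refine hα.dual.clm_ext fun h => ?_
          change inner ℂ _ ((P.v k * P.M (chr χ h)) _) = 0
          rw [hv, hM, ProjRep.U_mul, smul_apply, inner_smul_right,
            inner_leftRegular_U_of_ne, mul_zero]
          intro e
          apply hk
          simpa using congrArg SemidirectProduct.right e
        exact DFunLike.congr_fun this f
  dense := by
    let L := ((ContinuousLinearMap.apply ℂ (FibreSpace x)
      (basisVec ⟨(1 : H ⋊[β] K), x.2⟩)).toLinearMap.comp P.lin)
    refine dense_of_basisVec_mem (LinearMap.range L) fun γ =>
      ⟨trigPoly ω χ (Finsupp.single γ.1 1), ?_⟩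
    change P.lin _ _ = _
    rw [ProjRep.lin_eq_of_covPair _ P hv hM, ProjRep.lin_single, one_smul]
    exact leftRegular_U_base hα.normalized.map_one_one x γ

include hα in
/-- The reduced twisted group C*-algebra is the reduced crossed product. -/
theorem nonempty_reducedCStar_equiv :
    Nonempty (ReducedCStar ω ≃⋆ₐ[ℂ]
      ReducedCStar (TwoCocycle.trivial (transformationGroupoid K X α))) := by
  have h1 := hα.normalized.map_one_one
  refine nonempty_generatedCStar_equiv hα (leftRegular h1) (orbitPair (α := α)) _ _
    (fun a => ?_) (fun b => ?_) fun c C hC => ?_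
  · exact exists_congr fun f => forall_congr' fun x => isLeftRegular_iff_group h1 x f _
  · exact exists_congr fun f => forall_congr' fun x => isLeftRegular_iff_transformation x f _
  -- The left regular representation at a single unit already bounds all orbit representations, and
  -- is bounded by them.
  · have key (x : Units (ofGroup (H ⋊[β] K))) : ‖(leftRegular h1 x).lin c‖ ≤ C ↔
        ∀ y : Units (transformationGroupoid K X α),
          ‖(orbitPair y).lin (trigPoly ω χ c)‖ ≤ C := by
      obtain ⟨P, hv, hM⟩ := (leftRegular h1 x).exists_covPair hα
      rw [← ProjRep.lin_eq_of_covPair _ P hv hM]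
      exact norm_le_iff_forall_orbit hα.dual (isDualMean_leftRegular hα x P hv hM)
        (isVacuum_leftRegular hα x P hv hM)
        (fun y : Units (transformationGroupoid K X α) => y.1.2)
        (fun y => ⟨⟨((1 : K), y), rfl⟩, rfl⟩) (fun y => orbitPair y)
        (fun y => basisVec (orbitBase y)) (fun y => isVacuum_orbitPair y)
        (fun y f => orbitPair_M_base y f) _ hC
    exact ⟨fun h => (key ⟨(1 : H ⋊[β] K), rfl⟩).1 (h _), fun h x => (key x).2 h⟩

end Reduced

section CStarIso

/-- Twisted group C*-algebras of semidirect products are crossed products. -/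
theorem IsDualAction.cstarIso {H : Type u} [CommGroup H] {K : Type v} [Group K]
    {β : K →* MulAut H} {X : Type u} [TopologicalSpace X] [CompactSpace X] [T2Space X]
    {ω : TwoCocycle (ofGroup (H ⋊[β] K))} {χ : H →* C(X, Circle)} {α : K →* (X ≃ₜ X)}
    (hα : IsDualAction ω χ α) :
    CStarIso ω (TwoCocycle.trivial (transformationGroupoid K X α)) :=
  ⟨nonempty_fullCStar_equiv hα, nonempty_reducedCStar_equiv hα⟩

end CStarIso

/-! ### The action on the dual -/

section Action

open SemidirectProduct

variable {H : Type u} [CommGroup H] {K : Type v} [Group K] {β : K →* MulAut H}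
  {ω : TwoCocycle (ofGroup (H ⋊[β] K))}

namespace TwoCocycle.IsNormalized

/-- Conjugation by `U k` is multiplicative on the span of the `U h`. On the level of `ω` this
combines the identities at `(h, h', k)`, `(h, k, ·)` and `(k, ·, ·)`; it makes the transformed
character a character. -/
theorem conjCocycle_mul_right (hω : ω.IsNormalized) (k : K) (h h' : H) :
    conjCocycle ω k (h * h') = conjCocycle ω k h * conjCocycle ω k h' := by
  have e1 := ω.group_cocycle (inl h : H ⋊[β] K) (inl h') (inr k)
  have e2 := ω.group_cocycle (inl h : H ⋊[β] K) (inr k) (inl (β k⁻¹ h'))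
  have e3 := ω.group_cocycle (inr k : H ⋊[β] K) (inl (β k⁻¹ h)) (inl (β k⁻¹ h'))
  rw [inl_mul_inr, ← map_mul, hω.inl_inl, mul_one] at e1
  rw [inl_mul_inr] at e2
  rw [← map_mul, ← map_mul, hω.inl_inl, mul_one] at e3
  have aux (X Y A B C D P Q c c₁ c₂ : Circle) (e1 : X * C = P) (e2 : X * D = Y * A)
      (e3 : Q = Y * B) (hA : A = c₁ * B) (hC : C = c₂ * D) (hP : P = c * Q) : c = c₁ * c₂ := by
    apply mul_right_cancel (b := Y * B)
    calc c * (Y * B) = X * C := by rw [e1, hP, e3]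
      _ = c₂ * (X * D) := by rw [hC, mul_left_comm]
      _ = c₁ * c₂ * (Y * B) := by rw [e2, hA]; ac_rfl
  exact aux _ _ _ _ _ _ _ _ _ _ _ e1 e2 e3 (hω.inl_inr k h) (hω.inl_inr k h')
    (hω.inl_inr k (h * h'))

/-- Conjugating by `U (kl)` is conjugating by `U k` and `U l` in succession; this 1-cocycle rule
becomes the composition law of the action. -/
theorem conjCocycle_mul_left (hω : ω.IsNormalized) (k l : K) (h : H) :
    conjCocycle ω (k * l) h = conjCocycle ω k h * conjCocycle ω l (β k⁻¹ h) := by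
  have e1 := ω.group_cocycle (inl h : H ⋊[β] K) (inr k) (inr l)
  have e2 := ω.group_cocycle (inr k : H ⋊[β] K) (inl (β k⁻¹ h)) (inr l)
  have e3 := ω.group_cocycle (inr k : H ⋊[β] K) (inr l) (inl (β l⁻¹ (β k⁻¹ h)))
  have e4 := hω.inl_inr (k * l) h
  have e5 : β (k * l)⁻¹ h = β l⁻¹ (β k⁻¹ h) := by
    rw [mul_inv_rev, map_mul, MulAut.mul_apply]
  rw [hω.inr_inr, mul_one, inl_mul_inr, ← map_mul] at e1
  rw [inl_mul_inr] at e2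
  rw [hω.inr_inr, mul_one, ← map_mul] at e3
  rw [e5] at e4
  have aux (W Z A B C D P Q c c₁ c₂ : Circle) (e1 : P = Z * A) (e2 : W * C = Z * B)
      (e3 : W * D = Q) (hA : A = c₁ * B) (hC : C = c₂ * D) (hP : P = c * Q) : c = c₁ * c₂ := by
    apply mul_right_cancel (b := W * D)
    calc c * (W * D) = Z * A := by rw [← e1, hP, e3]
      _ = c₁ * (W * C) := by rw [e2, hA, mul_left_comm]
      _ = c₁ * c₂ * (W * D) := by rw [hC]; ac_rfl
  exact aux _ _ _ _ _ _ _ _ _ _ _ e1 e2 e3 (hω.inl_inr k h) (hω.inl_inr l (β k⁻¹ h)) e4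

/-- The action of `K` on the dual of `H`. -/
theorem exists_isDualAction (hω : ω.IsNormalized) {X : Type w} [TopologicalSpace X]
    [CompactSpace X] {χ : H →* C(X, Circle)} (hχ : IsDualPairing χ) :
    ∃ α : K →* (X ≃ₜ X), IsDualAction ω χ α := by
  have h1 (k : K) : conjCocycle ω k 1 = 1 := by
    have := hω.conjCocycle_mul_right k 1 1
    rw [mul_one] at this
    exact mul_eq_left.1 this.symm
  have h2 (h : H) : conjCocycle ω 1 h = 1 := by
    have := hω.conjCocycle_mul_left 1 1 h
    rw [inv_one, map_one, MulAut.one_apply, mul_one] at this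
    exact mul_eq_left.1 this.symm
  let ψ (k : K) (x : X) : H →* Circle :=
    { toFun := fun h => conjCocycle ω k h * χ (β k⁻¹ h) x
      map_one' := by simp [h1]
      map_mul' := fun h h' => by
        rw [hω.conjCocycle_mul_right, map_mul, map_mul, ContinuousMap.mul_apply,
          mul_mul_mul_comm] }
  -- The image of `x` is defined as the point that represents the transformed character; the action
  -- laws and continuity are then verified on characters.
  choose a ha using fun k x => hχ.surjective (ψ k x)
  have ha' (k : K) (x : X) (h : H) : χ h (a k x) = conjCocycle ω k h * χ (β k⁻¹ h) x := ha k x h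
  have a_one (x : X) : a 1 x = x := hχ.injective _ _ fun h => by simp [ha', h2]
  have a_mul (k l : K) (x : X) : a (k * l) x = a k (a l x) := hχ.injective _ _ fun h => by
    rw [ha', ha', ha', hω.conjCocycle_mul_left, mul_inv_rev, map_mul, MulAut.mul_apply, mul_assoc]
  have a_cont (k : K) : Continuous (a k) := hχ.continuous_iff _ fun h => by
    simp only [ha']
    fun_prop
  refine ⟨{ toFun := fun k =>
              { toFun := a k
                invFun := a k⁻¹
                left_inv := fun x => by rw [← a_mul, inv_mul_cancel, a_one]
                right_inv := fun x => by rw [← a_mul, mul_inv_cancel, a_one]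
                continuous_toFun := a_cont k
                continuous_invFun := a_cont k⁻¹ }
            map_one' := Homeomorph.ext a_one
            map_mul' := fun k l => Homeomorph.ext (a_mul k l) }, hω, hχ, fun k h x => ha' k x h⟩

end TwoCocycle.IsNormalized

end Action

/-! ### The Pontryagin dual, the circle and the solenoid -/

section PontryaginDual

variable (H : Type u) [CommGroup H] [TopologicalSpace H] [DiscreteTopology H]

/-- Evaluation at the elements of `H`. -/
def dualEval : H →* C(PontryaginDual H, Circle) where
  toFun h := ⟨fun x => x h,
    (continuous_eval_const (F := C(H, Circle)) h).comp
      (ContinuousMonoidHom.isInducing_toContinuousMap H Circle).continuous⟩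
  map_one' := by ext x; exact congrArg _ (map_one x)
  map_mul' h h' := by ext x; exact congrArg _ (map_mul x h h')

theorem isDualPairing_dualEval : IsDualPairing (dualEval H) where
  injective _ _ h := PontryaginDual.ext h
  surjective φ := ⟨(⟨φ, continuous_of_discreteTopology⟩ : H →ₜ* Circle), fun _ => rfl⟩

end PontryaginDual

section CircleDual

/-- The characters of the circle. -/
def circleEval : Multiplicative ℤ →* C(Circle, Circle) where
  toFun n := ⟨fun z => z ^ n.toAdd, by fun_prop⟩
  map_one' := by ext z; simp
  map_mul' m n := by ext z; simp [zpow_add]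

theorem isDualPairing_circleEval : IsDualPairing circleEval where
  injective x y h := by simpa [circleEval] using h (Multiplicative.ofAdd 1)
  surjective φ := ⟨φ (Multiplicative.ofAdd 1), fun n => by
    change φ _ ^ n.toAdd = φ n
    rw [← map_zpow, ← ofAdd_zsmul, smul_eq_mul, mul_one, ofAdd_toAdd]⟩

end CircleDual

section SolenoidDual

variable {N : ℕ}

theorem ZInv.exists_rep (hN : 1 ≤ N) (x : ZInv N) : ∃ (p : ℤ) (h : ℕ), (x : ℚ) = p / (N : ℚ) ^ h := by
  have hN0 : (N : ℚ) ≠ 0 := by positivity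
  obtain ⟨x, hx⟩ := x
  change ∃ (p : ℤ) (h : ℕ), x = p / (N : ℚ) ^ h
  induction hx using Algebra.adjoin_induction with
  | mem x hx => exact ⟨1, 1, by simpa using hx⟩
  | algebraMap r => exact ⟨r, 0, by simp⟩
  | add x y _ _ hx hy =>
    obtain ⟨p, h, rfl⟩ := hx
    obtain ⟨q, m, rfl⟩ := hy
    refine ⟨p * N ^ m + q * N ^ h, h + m, ?_⟩
    push_cast
    rw [pow_add]
    field_simp
  | mul x y _ _ hx hy =>
    obtain ⟨p, h, rfl⟩ := hx
    obtain ⟨q, m, rfl⟩ := hy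
    refine ⟨p * q, h + m, ?_⟩
    push_cast
    rw [pow_add]
    field_simp

/-- The element `N⁻ⁿ`. -/
def ZInv.invPow (N : ℕ) (n : ℕ) : ZInv N :=
  ⟨(N : ℚ)⁻¹ ^ n, Subalgebra.pow_mem _ (Algebra.subset_adjoin (Set.mem_singleton _)) n⟩

theorem ZInv.coe_invPow (n : ℕ) : (ZInv.invPow N n : ℚ) = (1 : ℤ) / (N : ℚ) ^ n := by
  simp [invPow]

theorem Solenoid.pow_pow (z : Solenoid N) (n j : ℕ) : z.1 (n + j) ^ N ^ j = z.1 n := by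
  induction j with
  | zero => simp
  | succ j ih => rw [pow_succ', pow_mul, ← add_assoc, z.2, ih]

/-- Both sides are powers of the common root `z_{h+m}`, with exponents `N^m p` and `N^h q`, which
equality of the fractions identifies. -/
theorem Solenoid.zpow_eq (hN : 1 ≤ N) (z : Solenoid N) {p q : ℤ} {h m : ℕ}
    (e : (p : ℚ) / (N : ℚ) ^ h = q / (N : ℚ) ^ m) : z.1 h ^ p = z.1 m ^ q := by
  have hN0 : (N : ℚ) ≠ 0 := by positivity
  have e' : (N ^ m : ℤ) * p = N ^ h * q := by
    rw [div_eq_div_iff (by positivity) (by positivity)] at e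
    have : ((N ^ m : ℤ) * p : ℚ) = (N ^ h : ℤ) * q := by push_cast; linarith
    exact_mod_cast this
  have h1 := z.pow_pow h m
  have h2 := z.pow_pow m h
  rw [add_comm] at h2
  rw [← h1, ← h2, ← zpow_natCast, ← zpow_natCast, ← zpow_mul, ← zpow_mul]
  push_cast
  rw [e']

/-- The character of `ℤ[1/N]` given by a point of the solenoid. -/
def Solenoid.character (hN : 1 ≤ N) (z : Solenoid N) (x : ZInv N) : Circle :=
  z.1 (ZInv.exists_rep hN x).choose_spec.choose ^ (ZInv.exists_rep hN x).choose

theorem Solenoid.character_eq (hN : 1 ≤ N) (z : Solenoid N) {x : ZInv N} {p : ℤ} {h : ℕ}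
    (e : (x : ℚ) = p / (N : ℚ) ^ h) : z.character hN x = z.1 h ^ p :=
  z.zpow_eq hN ((ZInv.exists_rep hN x).choose_spec.choose_spec.symm.trans e)

theorem Solenoid.character_add (hN : 1 ≤ N) (z : Solenoid N) (x y : ZInv N) :
    z.character hN (x + y) = z.character hN x * z.character hN y := by
  have hN0 : (N : ℚ) ≠ 0 := by positivity
  obtain ⟨p, h, hx⟩ := ZInv.exists_rep hN x
  obtain ⟨q, m, hy⟩ := ZInv.exists_rep hN y
  have hx' : (x : ℚ) = (p * N ^ m : ℤ) / (N : ℚ) ^ (h + m) := by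
    rw [hx]; push_cast; rw [pow_add]; field_simp
  have hy' : (y : ℚ) = (q * N ^ h : ℤ) / (N : ℚ) ^ (h + m) := by
    rw [hy]; push_cast; rw [pow_add]; field_simp
  have hxy : ((x + y : ZInv N) : ℚ) = (p * N ^ m + q * N ^ h : ℤ) / (N : ℚ) ^ (h + m) := by
    rw [Subalgebra.coe_add, hx', hy', ← add_div]; push_cast; rfl
  rw [z.character_eq hN hx', z.character_eq hN hy', z.character_eq hN hxy, zpow_add]

theorem Solenoid.character_zero (hN : 1 ≤ N) (z : Solenoid N) : z.character hN 0 = 1 := by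
  rw [z.character_eq hN (p := 0) (h := 0) (by simp), zpow_zero]

/-- The characters of the solenoid. -/
def solenoidEval (hN : 1 ≤ N) : Multiplicative (ZInv N) →* C(Solenoid N, Circle) where
  toFun x := ⟨fun z => z.character hN x.toAdd, 
    ((continuous_apply _).comp continuous_subtype_val).zpow _⟩
  map_one' := by ext z; exact congrArg _ (z.character_zero hN)
  map_mul' x y := by ext z; exact congrArg _ (z.character_add hN _ _)

theorem solenoidEval_apply (hN : 1 ≤ N) (x : Multiplicative (ZInv N)) (z : Solenoid N) :
    solenoidEval hN x z = z.character hN x.toAdd := rfl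

theorem solenoidEval_invPow (hN : 1 ≤ N) (n : ℕ) (z : Solenoid N) :
    solenoidEval hN (Multiplicative.ofAdd (ZInv.invPow N n)) z = z.1 n := by
  rw [solenoidEval_apply, toAdd_ofAdd, z.character_eq hN (ZInv.coe_invPow n), zpow_one]

/-- A character of `ℤ[1/N]` is determined by its values at the `N⁻ⁿ`, and `N • N⁻⁽ⁿ⁺¹⁾ = N⁻ⁿ` is
exactly the solenoid relation. -/
theorem isDualPairing_solenoidEval (hN : 1 ≤ N) : IsDualPairing (solenoidEval hN) where
  injective x y h := Subtype.ext <| funext fun n => by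
    rw [← solenoidEval_invPow hN n x, h, solenoidEval_invPow]
  surjective φ := by
    have hN0 : (N : ℚ) ≠ 0 := by positivity
    refine ⟨⟨fun n => φ (Multiplicative.ofAdd (ZInv.invPow N n)), fun n => ?_⟩, fun x => ?_⟩
    · rw [← map_pow, ← ofAdd_nsmul]
      congr 2
      apply Subtype.ext
      change N • ((ZInv.invPow N (n + 1) : ZInv N) : ℚ) = (ZInv.invPow N n : ZInv N)
      rw [ZInv.coe_invPow, ZInv.coe_invPow, nsmul_eq_mul, pow_succ]
      field_simp
    · obtain ⟨p, h, hx⟩ := ZInv.exists_rep hN x.toAdd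
      rw [solenoidEval_apply, Solenoid.character_eq hN _ hx]
      change φ _ ^ p = φ x
      rw [← map_zpow, ← ofAdd_zsmul, ← ofAdd_toAdd x]
      congr 2
      apply Subtype.ext
      change p • ((ZInv.invPow N h : ZInv N) : ℚ) = (x.toAdd : ZInv N)
      rw [ZInv.coe_invPow, hx, zsmul_eq_mul]
      push_cast
      ring

end SolenoidDual

/-! ### Bicharacters -/

section Bicharacter

/-- A bicharacter as a 2-cocycle. -/
def TwoCocycle.ofBicharacter {G : Type u} [Group G] (D : G →* G →* Circle) :
    TwoCocycle (ofGroup G) where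
  toFun a b := D a b
  continuousOn_toFun := by
    let _ : TopologicalSpace G := ⊥
    have : DiscreteTopology G := ⟨rfl⟩
    exact continuous_of_discreteTopology.continuousOn
  cocycle (a b c : G) _ _ := by
    change D a (b * c) * D b c = D (a * b) c * D a b
    rw [map_mul, map_mul, MonoidHom.mul_apply, mul_assoc, mul_comm]

/-- The first projection of a direct product, written as a semidirect product. -/
def leftProj (H : Type u) (K : Type v) [Group H] [Group K] :
    H ⋊[(1 : K →* MulAut H)] K →* H where
  toFun a := a.left
  map_one' := rfl
  map_mul' _ _ := rfl

end Bicharacter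

/-! ### Cocycles from bicharacters on direct products. -/

section DirectProduct

open SemidirectProduct

variable {H : Type u} [CommGroup H] {K : Type v} [CommGroup K]

/-- The 2-cocycle `((h, k), (h', k')) ↦ B k h'` on `H × K`. -/
def TwoCocycle.ofRightLeft (B : K →* H →* Circle) :
    TwoCocycle (ofGroup (H ⋊[(1 : K →* MulAut H)] K)) :=
  .ofBicharacter ((MonoidHom.compHom' (leftProj H K)).comp (B.comp rightHom))

theorem TwoCocycle.ofRightLeft_apply (B : K →* H →* Circle) (a b : H ⋊[(1 : K →* MulAut H)] K) :
    TwoCocycle.ofRightLeft B a b = B a.right b.left := rfl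

theorem TwoCocycle.isNormalized_ofRightLeft (B : K →* H →* Circle) :
    (TwoCocycle.ofRightLeft B).IsNormalized where
  inl_inl h h' := by rw [ofRightLeft_apply, right_inl, map_one, MonoidHom.one_apply]
  inr_inr k k' := by rw [ofRightLeft_apply, left_inr, map_one]

/-- Only the factor `ω(k⁻¹, h)` contributes. Its inverse is the source of the minus sign in the
action on the circle. -/
theorem conjCocycle_ofRightLeft (B : K →* H →* Circle) (k : K) (h : H) :
    conjCocycle (TwoCocycle.ofRightLeft B) k h = B k⁻¹ h := by
  rw [conjCocycle, TwoCocycle.ofRightLeft_apply, TwoCocycle.ofRightLeft_apply, left_inr, map_one,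
    mul_one, right_inr, left_inl]

/-- The 2-cocycle `((h, k), (h', k')) ↦ B h k'` on `H × K`. -/
def TwoCocycle.ofLeftRight (B : H →* K →* Circle) :
    TwoCocycle (ofGroup (H ⋊[(1 : K →* MulAut H)] K)) :=
  .ofBicharacter ((MonoidHom.compHom' rightHom).comp (B.comp (leftProj H K)))

theorem TwoCocycle.ofLeftRight_apply (B : H →* K →* Circle) (a b : H ⋊[(1 : K →* MulAut H)] K) :
    TwoCocycle.ofLeftRight B a b = B a.left b.right := rfl

theorem TwoCocycle.isNormalized_ofLeftRight (B : H →* K →* Circle) :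
    (TwoCocycle.ofLeftRight B).IsNormalized where
  inl_inl h h' := by rw [ofLeftRight_apply, right_inl, map_one]
  inr_inr k k' := by rw [ofLeftRight_apply, left_inr, map_one, MonoidHom.one_apply]

/-- Only the second factor contributes, and it contains `k` itself; hence the action on the solenoid
has no minus sign. -/
theorem conjCocycle_ofLeftRight (B : H →* K →* Circle) (k : K) (h : H) :
    conjCocycle (TwoCocycle.ofLeftRight B) k h = B h k := by
  rw [conjCocycle, TwoCocycle.ofLeftRight_apply, TwoCocycle.ofLeftRight_apply, left_inr, map_one,
    MonoidHom.one_apply, one_mul, right_inr, MonoidHom.one_apply, MulAut.one_apply]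

end DirectProduct

theorem exists_cstarIso_pontryaginDual (H : Type u) [CommGroup H] [TopologicalSpace H]
    [DiscreteTopology H] (K : Type v) [CommGroup K] (β : K →* MulAut H)
    (ω : TwoCocycle (ofGroup (H ⋊[β] K))) (hω : ω.IsNormalized) :
    ∃ α : K →* (PontryaginDual H ≃ₜ PontryaginDual H),
      (∀ (k : K) (x : PontryaginDual H) (h : H), α k x h = conjCocycle ω k h * x (β k⁻¹ h)) ∧
      CStarIso ω (TwoCocycle.trivial (transformationGroupoid K (PontryaginDual H) α)) := by
  obtain ⟨α, hα⟩ := hω.exists_isDualAction (isDualPairing_dualEval H)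
  exact ⟨α, fun k x h => hα.act k h x, hα.cstarIso⟩

/-! ### The rotation cocycle and its action on the circle. -/

section Rotation

/-- The pairing `(k, h) ↦ e^{2πiθkh}` of `ℤ` with itself. -/
def rotationPairing (θ : ℝ) : Multiplicative ℤ →* Multiplicative ℤ →* Circle where
  toFun k :=
    { toFun := fun h => Circle.exp (2 * Real.pi * θ * k.toAdd * h.toAdd)
      map_one' := by simp
      map_mul' := fun h h' => by
        rw [← Circle.exp_add, toAdd_mul, Int.cast_add, mul_add] }
  map_one' := by apply MonoidHom.ext; intro h; simp
  map_mul' k k' := by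
    apply MonoidHom.ext
    intro h
    change Circle.exp _ = Circle.exp _ * Circle.exp _
    rw [← Circle.exp_add, toAdd_mul, Int.cast_add, mul_add, add_mul]

theorem rotationPairing_apply (θ : ℝ) (k h : Multiplicative ℤ) :
    rotationPairing θ k h = Circle.exp (2 * Real.pi * θ * k.toAdd * h.toAdd) := rfl

/-- The 2-cocycle `((h, k), (h', k')) ↦ e^{2πiθkh'}` on `ℤ × ℤ`. -/
def rotationCocycle (θ : ℝ) :
    TwoCocycle (ofGroup
      (Multiplicative ℤ ⋊[(1 : Multiplicative ℤ →* MulAut (Multiplicative ℤ))]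
        Multiplicative ℤ)) :=
  .ofRightLeft (rotationPairing θ)

theorem exists_cstarIso_rotation (θ : ℝ) :
    ∃ α : Multiplicative ℤ →* (Circle ≃ₜ Circle),
      (∀ (k : ℤ) (z : Circle),
        α (Multiplicative.ofAdd k) z = Circle.exp (-(2 * Real.pi * θ * k)) * z) ∧
      CStarIso (rotationCocycle θ)
        (TwoCocycle.trivial (transformationGroupoid (Multiplicative ℤ) Circle α)) := by
  obtain ⟨α, hα⟩ := (TwoCocycle.isNormalized_ofRightLeft
    (rotationPairing θ)).exists_isDualAction isDualPairing_circleEval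
  refine ⟨α, fun k z => ?_, hα.cstarIso⟩
  -- The character of `1 ∈ ℤ` is the identity map of the circle, so the action formula at it is the
  -- action itself.
  have h := hα.act (Multiplicative.ofAdd k) (Multiplicative.ofAdd 1) z
  rw [conjCocycle_ofRightLeft, rotationPairing_apply] at h
  simpa [circleEval] using h

end Rotation

/-! ### The solenoid cocycle and its action. -/

section NoncommutativeSolenoid

variable {N : ℕ}

/-- The pairing `(x, y) ↦ σ (x y)` of `ℤ[1/N]` with itself. -/
def Solenoid.pairing (hN : 1 ≤ N) (σ : Solenoid N) :
    Multiplicative (ZInv N) →* Multiplicative (ZInv N) →* Circle where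
  toFun x :=
    { toFun := fun y => σ.character hN (x.toAdd * y.toAdd)
      map_one' := by rw [toAdd_one, mul_zero, σ.character_zero hN]
      map_mul' := fun y y' => by rw [toAdd_mul, mul_add, σ.character_add hN] }
  map_one' := by
    apply MonoidHom.ext
    intro y
    change σ.character hN (0 * y.toAdd) = 1
    rw [zero_mul, σ.character_zero hN]
  map_mul' x x' := by
    apply MonoidHom.ext
    intro y
    change σ.character hN ((x.toAdd + x'.toAdd) * y.toAdd) = _
    rw [add_mul, σ.character_add hN]
    rfl

/-- The index `h + l` and the exponent `p * s` come from multiplying the fractions. Hence the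
formula is independent of their representations and is a bicharacter by distributivity. -/
theorem Solenoid.pairing_apply (hN : 1 ≤ N) (σ : Solenoid N) {x y : ZInv N} {p s : ℤ} {h l : ℕ}
    (hx : (x : ℚ) = p / (N : ℚ) ^ h) (hy : (y : ℚ) = s / (N : ℚ) ^ l) :
    σ.pairing hN (Multiplicative.ofAdd x) (Multiplicative.ofAdd y) = σ.1 (h + l) ^ (p * s) := by
  refine σ.character_eq hN ?_
  change (x : ℚ) * (y : ℚ) = _
  rw [hx, hy, pow_add, div_mul_div_comm, Int.cast_mul]

/-- The point of the solenoid given by a sequence of angles. -/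
def Solenoid.ofAngles (a : ℕ → ℝ) (ha : ∀ n, ∃ k : ℕ, k < N ∧ N * a (n + 1) = a n + k) :
    Solenoid N :=
  ⟨fun n => Circle.exp (2 * Real.pi * a n), fun n => by
    obtain ⟨k, -, hk⟩ := ha n
    rw [← Circle.exp_nsmul, nsmul_eq_mul, mul_left_comm, hk, mul_add, Circle.exp_add]
    simpa using Circle.exp_two_pi_mul_int k⟩

theorem Solenoid.ofAngles_zpow (a : ℕ → ℝ) (ha : ∀ n, ∃ k : ℕ, k < N ∧ N * a (n + 1) = a n + k)
    (n : ℕ) (p : ℤ) : (Solenoid.ofAngles a ha).1 n ^ p = Circle.exp (2 * Real.pi * a n * p) := by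
  change Circle.exp _ ^ p = _
  rw [← Circle.exp_zsmul, zsmul_eq_mul, mul_comm]

theorem exists_cstarIso_solenoid (hN : 1 ≤ N) (σ : Solenoid N) :
    ∃ α : Multiplicative (ZInv N) →* (Solenoid N ≃ₜ Solenoid N),
      (∀ (y : ZInv N) (p : ℤ) (l : ℕ), (y : ℚ) = p / (N : ℚ) ^ l →
        ∀ (z : Solenoid N) (n : ℕ),
          (α (Multiplicative.ofAdd y) z).1 n = σ.1 (n + l) ^ p * z.1 n) ∧
      CStarIso (TwoCocycle.ofLeftRight (σ.pairing hN)) (TwoCocycle.trivial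
        (transformationGroupoid (Multiplicative (ZInv N)) (Solenoid N) α)) := by
  obtain ⟨α, hα⟩ := (TwoCocycle.isNormalized_ofLeftRight
    (σ.pairing hN)).exists_isDualAction (isDualPairing_solenoidEval hN)
  refine ⟨α, fun y p l hy z n => ?_, hα.cstarIso⟩
  -- The `n`-th coordinate is the character of `N⁻ⁿ`; having numerator `1`, it contributes only `n`
  -- to the index.
  have h := hα.act (Multiplicative.ofAdd y) (Multiplicative.ofAdd (ZInv.invPow N n)) z
  rw [conjCocycle_ofLeftRight, σ.pairing_apply hN (ZInv.coe_invPow n) hy, one_mul,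
    MonoidHom.one_apply, MulAut.one_apply, solenoidEval_invPow, solenoidEval_invPow] at h
  exact h

end NoncommutativeSolenoid

/-! ### Unital C*-algebras generated by projective families -/

section Transfer

/-- A small non-unital C*-algebra with a two-sided identity is isomorphic to a unital
C*-algebra in the smaller universe. -/
theorem exists_cstarAlgebra_equiv (D : Type v) [NonUnitalCStarAlgebra D] [Small.{w} D] (e : D)
    (h₁ : ∀ x, e * x = x) (h₂ : ∀ x, x * e = x) :
    ∃ (A : Type w) (_ : CStarAlgebra A), Nonempty (A ≃⋆ₐ[ℂ] D) := by
  let f : Shrink.{w} D ≃ D := (equivShrink D).symm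
  let nr : NonUnitalRing (Shrink.{w} D) := f.nonUnitalRing
  let E : Shrink.{w} D ≃+* D := f.ringEquiv
  let nn : NonUnitalNormedRing (Shrink.{w} D) := NonUnitalNormedRing.induced _ D E E.injective
  let md : Module ℂ (Shrink.{w} D) := f.module ℂ
  let L : Shrink.{w} D ≃ₗ[ℂ] D := f.linearEquiv ℂ
  let r : Ring (Shrink.{w} D) :=
    { nr with
      one := E.symm e
      one_mul := fun x => E.injective <| by
        change E (E.symm e * x) = E x
        rw [map_mul, E.apply_symm_apply, h₁]
      mul_one := fun x => E.injective <| by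
        change E (x * E.symm e) = E x
        rw [map_mul, E.apply_symm_apply, h₂] }
  let rn : NormedRing (Shrink.{w} D) := { nn, r with }
  have hsm (c : ℂ) (x : Shrink.{w} D) : E (c • x) = c • E x := L.map_smul c x
  let al : Algebra ℂ (Shrink.{w} D) := Algebra.ofModule
    (fun c x y => E.injective <| by rw [map_mul, hsm, hsm, map_mul, smul_mul_assoc])
    (fun c x y => E.injective <| by rw [map_mul, hsm, hsm, map_mul, mul_smul_comm])
  let na : NormedAlgebra ℂ (Shrink.{w} D) :=
    { al with
      norm_smul_le := fun c x => by
        change ‖E (c • x)‖ ≤ ‖c‖ * ‖E x‖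
        rw [hsm, norm_smul] }
  let st : StarRing (Shrink.{w} D) :=
    { star := fun x => E.symm (star (E x))
      star_involutive := fun x => E.injective <| by simp
      star_mul := fun x y => E.injective <| by simp
      star_add := fun x y => E.injective <| by simp }
  have hst (x : Shrink.{w} D) : E (star x) = star (E x) := E.apply_symm_apply _
  have hiso : Isometry E := AddMonoidHomClass.isometry_of_norm E fun _ => rfl
  have hcs : CompleteSpace (Shrink.{w} D) :=
    (hiso.isUniformInducing.completeSpace_congr E.surjective).2 inferInstance
  let cs : CStarAlgebra (Shrink.{w} D) :=
    { rn, st, na with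
      complete := hcs.complete
      norm_mul_self_le := fun x => by
        change ‖E x‖ * ‖E x‖ ≤ ‖E (star x * x)‖
        rw [map_mul, hst, CStarRing.norm_star_mul_self]
      star_smul := fun c x => E.injective <| by
        rw [hst, hsm, hsm, hst, star_smul] }
  exact ⟨Shrink.{w} D, cs, ⟨{ E with map_star' := hst, map_smul' := hsm }⟩⟩

/-- Every point is the limit of a sequence from a countable dense set, so the set is a quotient of
`ℕ → ℕ`, which has a copy in every universe. -/
theorem small_of_isSeparable {X : Type v} [MetricSpace X] {s : Set X}
    (hs : TopologicalSpace.IsSeparable s) : Small.{w} s := by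
  rcases s.eq_empty_or_nonempty with rfl | ⟨x₀, hx₀⟩
  · exact small_of_injective (β := PEmpty.{w+1}) (f := fun x => x.2.elim) fun x => x.2.elim
  have : TopologicalSpace.SeparableSpace s := hs.separableSpace
  have : Nonempty s := ⟨⟨x₀, hx₀⟩⟩
  have h : Function.Surjective fun t : ℕ → ℕ =>
      Filter.limUnder Filter.atTop fun n => TopologicalSpace.denseSeq s (t n) := fun x => by
    obtain ⟨y, hy, hlim⟩ := mem_closure_iff_seq_limit.1
      ((TopologicalSpace.denseRange_denseSeq s).closure_range ▸ Set.mem_univ x)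
    choose t ht using hy
    exact ⟨t, by simpa only [ht] using hlim.limUnder_eq⟩
  have : Small.{w} (ℕ → ℕ) := small_lift _
  exact small_of_surjective h

end Transfer

namespace ProjRep

variable {G : Type u} [Group G] {ω : TwoCocycle (ofGroup G)}

theorem isSeparable_alg [Countable G] {B : Type w} [NonUnitalCStarAlgebra B] (R : ProjRep ω B) :
    TopologicalSpace.IsSeparable (R.alg : Set B) := by
  refine TopologicalSpace.IsSeparable.closure ?_
  change TopologicalSpace.IsSeparable (LinearMap.range R.lin : Set B)
  rw [range_lin]
  exact (Set.countable_range R.U).isSeparable.span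

instance {B : Type w} [NonUnitalCStarAlgebra B] (R : ProjRep ω B) : NonUnitalCStarAlgebra R.alg :=
  haveI : IsClosed (R.alg : Set B) := NonUnitalStarSubalgebra.isClosed_topologicalClosure _
  inferInstance

/-- The family, in the C*-algebra that it generates. -/
def toAlg {B : Type w} [NonUnitalCStarAlgebra B] (R : ProjRep ω B) : ProjRep ω R.alg where
  U a := ⟨R.U a, R.spanAlg.le_topologicalClosure ⟨Finsupp.single a 1, by simp⟩⟩
  U_mul a b := Subtype.ext (R.U_mul a b)
  star_U a := Subtype.ext (R.star_U a)

theorem coe_toAlg_U {B : Type w} [NonUnitalCStarAlgebra B] (R : ProjRep ω B) (a : G) :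
    (R.toAlg.U a : B) = R.U a := rfl

/-- The ambient algebra may have no unit; for a cocycle normalised at `1`, `U 1` is the unit of the
generated algebra. -/
theorem one_mul_of_mem_alg {B : Type w} [NonUnitalCStarAlgebra B] (R : ProjRep ω B)
    (hω : ∀ a, ω 1 a = 1) {x : B} (hx : x ∈ R.alg) : R.U 1 * x = x := by
  have hcl : IsClosed {x : B | R.U 1 * x = x} := isClosed_eq (by fun_prop) (by fun_prop)
  refine closure_minimal ?_ hcl hx
  rintro _ ⟨c, rfl⟩
  change R.U 1 * R.lin c = R.lin c
  induction c using Finsupp.induction_linear with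
  | zero => simp
  | add f g hf hg => rw [map_add, mul_add, hf, hg]
  | single a z =>
    rw [lin_single, mul_smul_comm, R.U_mul, one_mul, hω, Circle.coe_one, one_smul]

theorem mul_one_of_mem_alg {B : Type w} [NonUnitalCStarAlgebra B] (R : ProjRep ω B)
    (hω : ∀ a, ω a 1 = 1) {x : B} (hx : x ∈ R.alg) : x * R.U 1 = x := by
  have hcl : IsClosed {x : B | x * R.U 1 = x} := isClosed_eq (by fun_prop) (by fun_prop)
  refine closure_minimal ?_ hcl hx
  rintro _ ⟨c, rfl⟩
  change R.lin c * R.U 1 = R.lin c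
  induction c using Finsupp.induction_linear with
  | zero => simp
  | add f g hf hg => rw [map_add, add_mul, hf, hg]
  | single a z =>
    rw [lin_single, smul_mul_assoc, R.U_mul, mul_one, hω, Circle.coe_one, one_smul]

theorem dense_range_toAlg_lin {B : Type w} [NonUnitalCStarAlgebra B] (R : ProjRep ω B) :
    Dense (Set.range R.toAlg.lin) := by
  intro x
  rw [closure_subtype, ← Set.range_comp]
  have : Subtype.val ∘ R.toAlg.lin = R.lin := funext fun c =>
    (R.toAlg.map_lin (NonUnitalStarSubalgebraClass.subtype R.alg) c).symm
  rw [this]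
  exact x.2

/-- The C*-algebra generated by a projective representation is unital. -/
theorem exists_unital {B : Type v} [NonUnitalCStarAlgebra B] (S : ProjRep ω B)
    [Small.{w} S.alg] (h₁ : ∀ a, ω 1 a = 1) (h₂ : ∀ a, ω a 1 = 1) :
    ∃ (A : Type w) (_ : CStarAlgebra A) (R : ProjRep ω A) (e : A ≃⋆ₐ[ℂ] S.alg),
      (∀ a, e (R.U a) = S.toAlg.U a) ∧ R.U 1 = 1 ∧ Dense (Set.range R.lin) := by
  obtain ⟨A, hA, ⟨e⟩⟩ := exists_cstarAlgebra_equiv.{v, w} S.alg (S.toAlg.U 1)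
    (fun x => Subtype.ext (S.one_mul_of_mem_alg h₁ x.2))
    (fun x => Subtype.ext (S.mul_one_of_mem_alg h₂ x.2))
  let f : S.alg →⋆ₙₐ[ℂ] A := e.symm
  have he (a : G) : e ((S.toAlg.map f).U a) = S.toAlg.U a := e.apply_symm_apply _
  have hf : Continuous f := AddMonoidHomClass.continuous_of_bound f 1 fun x => by
    rw [one_mul]; exact NonUnitalStarAlgHom.norm_apply_le f x
  refine ⟨A, hA, S.toAlg.map f, e, he, ?_, ?_⟩
  · have h (x : A) : (S.toAlg.map f).U 1 * x = x := EquivLike.injective e <| by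
      rw [map_mul, he]
      exact Subtype.ext (S.one_mul_of_mem_alg h₁ (e x).2)
    rw [← h 1, mul_one]
  · have h : Set.range (S.toAlg.map f).lin = f '' Set.range S.toAlg.lin := by
      rw [← Set.range_comp]
      exact congrArg Set.range (funext (S.toAlg.map_lin f))
    rw [h]
    exact e.symm.surjective.denseRange.dense_image hf S.dense_range_toAlg_lin

/-- The family of all representations in the universe of `G`. -/
def universal (ω : TwoCocycle (ofGroup G)) :
    ProjRep ω (BddFamily fun π : BundledRep ω => π.target) :=
  family fun π => ofConv π.rep

theorem generated_universal :
    generated {a : BddFamily fun π : BundledRep ω => π.target |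
      ∃ f : Cc (ofGroup G), ∀ π : BundledRep ω, a π = π.rep.toLin f} = (universal ω).alg := by
  refine generated_eq _ _ (fun c => ⟨(groupEquiv _).symm c, fun π => ?_⟩) ?_
  · rw [universal, family_lin, ofConv_lin]
  · rintro a ⟨f, hf⟩
    refine NonUnitalStarSubalgebra.le_topologicalClosure _ ⟨groupEquiv _ f, ?_⟩
    refine lp.ext <| funext fun π => ?_
    rw [hf π, universal, family_lin, ofConv_lin, LinearEquiv.symm_apply_apply]

theorem nonempty_universal_equiv : Nonempty ((universal ω).alg ≃⋆ₐ[ℂ] FullCStar ω) := by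
  have h (S : NonUnitalStarSubalgebra ℂ (BddFamily fun π : BundledRep ω => π.target))
      (hS : S = (universal ω).alg) : Nonempty ((universal ω).alg ≃⋆ₐ[ℂ] S) := by
    subst hS
    exact ⟨.refl ℂ _⟩
  exact h _ generated_universal

/-- The universal property of the full twisted group C*-algebra. -/
theorem exists_lift [Countable G] (h₁ : ∀ a, ω 1 a = 1) (h₂ : ∀ a, ω a 1 = 1) {B : Type w}
    [NonUnitalCStarAlgebra B] (T : ProjRep ω B) :
    ∃ φ : (universal ω).alg →⋆ₙₐ[ℂ] B, ∀ a, φ ((universal ω).toAlg.U a) = T.U a := by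
  -- The universal family contains only representations in the universe of `G`. Separability moves
  -- the algebra generated by `T` there, and the lift is the coordinate at the resulting
  -- representation.
  have : Small.{u} T.alg := small_of_isSeparable T.isSeparable_alg
  obtain ⟨D, _, R, e, he, -, -⟩ := T.exists_unital.{u, w, u} h₁ h₂
  let π : BundledRep ω := ⟨D, R.toConv⟩
  let ev : (universal ω).alg →⋆ₙₐ[ℂ] D :=
    { toFun := fun x => x.1 π
      map_smul' := fun _ _ => rfl
      map_zero' := rfl
      map_add' := fun _ _ => rfl
      map_mul' := fun _ _ => rfl
      map_star' := fun _ => rfl }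
  refine ⟨((NonUnitalStarSubalgebraClass.subtype T.alg).comp (e : D →⋆ₙₐ[ℂ] T.alg)).comp ev,
    fun a => ?_⟩
  have h : ev ((universal ω).toAlg.U a) = R.U a := by
    change R.lin (groupEquiv _ ((groupEquiv _).symm (Finsupp.single a 1))) = _
    rw [LinearEquiv.apply_symm_apply, lin_single, one_smul]
  change (e (ev ((universal ω).toAlg.U a)) : B) = T.U a
  rw [h, he, coe_toAlg_U]

theorem exists_unital_lift {B : Type v} [NonUnitalCStarAlgebra B] (S : ProjRep ω B)
    {F : Type v} [NonUnitalCStarAlgebra F] (hF : Nonempty (S.alg ≃⋆ₐ[ℂ] F))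
    (h₁ : ∀ a, ω 1 a = 1) (h₂ : ∀ a, ω a 1 = 1)
    (hl : ∀ (B : Type w) [NonUnitalCStarAlgebra B] (T : ProjRep ω B),
      ∃ φ : S.alg →⋆ₙₐ[ℂ] B, ∀ a, φ (S.toAlg.U a) = T.U a) :
    ∃ (A : Type v) (_ : CStarAlgebra A) (R : ProjRep ω A), R.U 1 = 1 ∧
      Dense (Set.range R.lin) ∧
      (∀ (B : Type w) [NonUnitalCStarAlgebra B] (T : ProjRep ω B),
        ∃ φ : A →⋆ₙₐ[ℂ] B, ∀ a, φ (R.U a) = T.U a) ∧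
      Nonempty (A ≃⋆ₐ[ℂ] F) := by
  obtain ⟨A, hA, R, e, he, hR, hd⟩ := S.exists_unital.{u, v, v} h₁ h₂
  refine ⟨A, hA, R, hR, hd, fun B _ T => ?_, hF.map e.trans⟩
  obtain ⟨φ, hφ⟩ := hl B T
  refine ⟨φ.comp (e : A →⋆ₙₐ[ℂ] S.alg), fun a => ?_⟩
  rw [← hφ, ← he]
  rfl

/-- The full twisted group C*-algebra is a unital C*-algebra, with a universal property. -/
theorem exists_universal_unital [Countable G] (h₁ : ∀ a, ω 1 a = 1) (h₂ : ∀ a, ω a 1 = 1) :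
    ∃ (A : Type (u + 1)) (_ : CStarAlgebra A) (R : ProjRep ω A), R.U 1 = 1 ∧
      Dense (Set.range R.lin) ∧
      (∀ (B : Type w) [NonUnitalCStarAlgebra B] (T : ProjRep ω B),
        ∃ φ : A →⋆ₙₐ[ℂ] B, ∀ a, φ (R.U a) = T.U a) ∧
      Nonempty (A ≃⋆ₐ[ℂ] FullCStar ω) :=
  exists_unital_lift (universal ω) nonempty_universal_equiv h₁ h₂ fun _ _ T => exists_lift h₁ h₂ T

end ProjRep

/-! ### The rotation algebra -/

section Commutation

/-- Conjugation by `u` sends `v` to `cv`, hence `v^m` to `c^m v^m`; read as a conjugation of `u` by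
`v^m`, this can be raised to the power `k`. -/
theorem zpow_mul_zpow_of_mul_eq {Γ : Type*} [Group Γ] {u v c : Γ} (hu : Commute c u)
    (hv : Commute c v) (h : u * v = c * (v * u)) (k m : ℤ) :
    u ^ k * v ^ m = c ^ (k * m) * (v ^ m * u ^ k) := by
  have h1 : SemiconjBy u v (c * v) := by rw [SemiconjBy, h, mul_assoc]
  have h2 : u * v ^ m = c ^ m * v ^ m * u := by rw [← hv.mul_zpow]; exact h1.zpow_right m
  have h3 : SemiconjBy (v ^ m) (c ^ m * u) u := by
    rw [SemiconjBy, h2, ← mul_assoc, (hv.zpow_zpow m m).eq]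
  have h4 : v ^ m * (c ^ m * u) ^ k = u ^ k * v ^ m := h3.zpow_right k
  rw [(hu.zpow_left m).mul_zpow, ← zpow_mul, mul_comm m k, ← mul_assoc,
    ← (hv.zpow_zpow (k * m) m).eq, mul_assoc] at h4
  exact h4.symm

/-- The scalar unitaries. -/
def scalarUnitary (B : Type w) [CStarAlgebra B] : Circle →* unitary B where
  toFun c := ⟨(c : ℂ) • 1, by
    rw [Unitary.mem_iff, star_smul, star_one, smul_mul_smul_comm, smul_mul_smul_comm, mul_one,
      mul_comm]
    refine ⟨?_, ?_⟩ <;> exact (congrArg (· • (1 : B)) (coe_mul_conj_circle c)).trans (one_smul _ _)⟩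
  map_one' := Subtype.ext (by simp)
  map_mul' c d := Subtype.ext (by simp [smul_smul, mul_comm])

theorem coe_scalarUnitary (B : Type w) [CStarAlgebra B] (c : Circle) :
    (scalarUnitary B c : B) = (c : ℂ) • 1 := rfl

theorem commute_scalarUnitary {B : Type w} [CStarAlgebra B] (c : Circle) (u : unitary B) :
    Commute (scalarUnitary B c) u :=
  Subtype.ext (by
    change ((c : ℂ) • (1 : B)) * u = u * ((c : ℂ) • 1)
    rw [smul_one_mul, mul_smul_one])

end Commutation

theorem starAlgHom_ext_of_topologicalClosure {A : Type v} {B : Type w} [CStarAlgebra A]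
    [CStarAlgebra B] {s : Set A} (hs : (StarAlgebra.adjoin ℂ s).topologicalClosure = ⊤)
    (φ ψ : A →⋆ₐ[ℂ] B) (h : ∀ x ∈ s, φ x = ψ x) : φ = ψ := by
  have hc (φ : A →⋆ₐ[ℂ] B) : Continuous φ :=
    AddMonoidHomClass.continuous_of_bound φ 1 fun x => by
      rw [one_mul]; exact NonUnitalStarAlgHom.norm_apply_le φ x
  have hcl : IsClosed (StarAlgHom.equalizer φ ψ : Set A) := isClosed_eq (hc φ) (hc ψ)
  have := StarSubalgebra.topologicalClosure_minimal
    (StarAlgebra.adjoin_le (S := StarAlgHom.equalizer φ ψ) h) hcl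
  rw [hs] at this
  exact StarAlgHom.ext fun x => this (x := x) trivial

section Rotation

open SemidirectProduct Multiplicative

variable {θ : ℝ}

theorem rotationCocycle_apply (θ : ℝ) (a b : Multiplicative ℤ ⋊[(1 : Multiplicative ℤ →*
    MulAut (Multiplicative ℤ))] Multiplicative ℤ) :
    rotationCocycle θ a b = Circle.exp (2 * Real.pi * θ) ^ (a.right.toAdd * b.left.toAdd) := by
  change Circle.exp (2 * Real.pi * θ * a.right.toAdd * b.left.toAdd) = _
  rw [← Circle.exp_zsmul, zsmul_eq_mul]
  congr 1
  push_cast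
  ring

/-- Two unitaries with the rotation relation give a projective representation of `ℤ × ℤ`. -/
def ProjRep.ofUnitaries {B : Type w} [CStarAlgebra B] (U V : unitary B)
    (h : U * V = scalarUnitary B (Circle.exp (2 * Real.pi * θ)) * (V * U)) :
    ProjRep (rotationCocycle θ) B where
  -- The power of `V` comes first because `ω` is `1` on pairs `(inl h, inr k)`; moving `U^k` past
  -- `V^h'` then yields exactly the scalar of the cocycle.
  U a := ((V ^ a.left.toAdd * U ^ a.right.toAdd : unitary B) : B)
  U_mul a b := by
    have hc := zpow_mul_zpow_of_mul_eq (commute_scalarUnitary _ U) (commute_scalarUnitary _ V) h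
      a.right.toAdd b.left.toAdd
    have e : V ^ a.left.toAdd * U ^ a.right.toAdd * (V ^ b.left.toAdd * U ^ b.right.toAdd) =
        scalarUnitary B (rotationCocycle θ a b) *
          (V ^ (a * b).left.toAdd * U ^ (a * b).right.toAdd) := by
      rw [mul_assoc, ← mul_assoc (U ^ _), hc, rotationCocycle_apply, map_zpow, mul_left, mul_right,
        MonoidHom.one_apply, MulAut.one_apply, toAdd_mul, toAdd_mul, zpow_add, zpow_add,
        ← mul_assoc (V ^ a.left.toAdd), ← mul_assoc (V ^ a.left.toAdd),
        ← ((commute_scalarUnitary _ (V ^ a.left.toAdd)).zpow_left _).eq]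
      simp only [mul_assoc]
    have e' := congrArg (Subtype.val : unitary B → B) e
    rw [Submonoid.coe_mul (unitary B) (scalarUnitary _ _), coe_scalarUnitary, smul_one_mul] at e'
    exact e'
  star_U a := by
    have hc := zpow_mul_zpow_of_mul_eq (commute_scalarUnitary _ U) (commute_scalarUnitary _ V) h
      (-a.right.toAdd) (-a.left.toAdd)
    have e : (V ^ a.left.toAdd * U ^ a.right.toAdd)⁻¹ =
        scalarUnitary B (rotationCocycle θ a⁻¹ a)⁻¹ *
          (V ^ a⁻¹.left.toAdd * U ^ a⁻¹.right.toAdd) := by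
      rw [mul_inv_rev, ← zpow_neg, ← zpow_neg, hc, rotationCocycle_apply, ← zpow_neg, map_zpow,
        inv_left, inv_right, MonoidHom.one_apply, MulAut.one_apply, toAdd_inv, toAdd_inv,
        neg_mul_neg, neg_mul, neg_neg]
    have e' := congrArg (Subtype.val : unitary B → B) e
    rw [Submonoid.coe_mul, coe_scalarUnitary, smul_one_mul, Circle.coe_inv_eq_conj] at e'
    exact e'

variable {A : Type v} [CStarAlgebra A]

theorem ProjRep.inl_mul_inl (R : ProjRep (rotationCocycle θ) A) (h h' : Multiplicative ℤ) :
    R.U (inl h) * R.U (inl h') = R.U (inl (h * h')) := by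
  rw [R.U_mul, rotationCocycle_apply, right_inl, toAdd_one, zero_mul, zpow_zero, Circle.coe_one,
    one_smul, ← map_mul]

theorem ProjRep.inr_mul_inr (R : ProjRep (rotationCocycle θ) A) (k k' : Multiplicative ℤ) :
    R.U (inr k) * R.U (inr k') = R.U (inr (k * k')) := by
  rw [R.U_mul, rotationCocycle_apply, left_inr, toAdd_one, mul_zero, zpow_zero, Circle.coe_one,
    one_smul, ← map_mul]

theorem ProjRep.star_inl (R : ProjRep (rotationCocycle θ) A) (h : Multiplicative ℤ) :
    star (R.U (inl h)) = R.U (inl h⁻¹) := by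
  rw [R.star_U, rotationCocycle_apply, ← map_inv, right_inl, toAdd_one, zero_mul, zpow_zero,
    Circle.coe_one, map_one, one_smul]

theorem ProjRep.star_inr (R : ProjRep (rotationCocycle θ) A) (k : Multiplicative ℤ) :
    star (R.U (inr k)) = R.U (inr k⁻¹) := by
  rw [R.star_U, rotationCocycle_apply, ← map_inv, left_inr, toAdd_one, mul_zero, zpow_zero,
    Circle.coe_one, map_one, one_smul]

theorem ProjRep.inl_mul_inr (R : ProjRep (rotationCocycle θ) A) (h k : Multiplicative ℤ) :
    R.U (inl h) * R.U (inr k) = R.U ⟨h, k⟩ := by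
  rw [R.U_mul, rotationCocycle_apply, left_inr, toAdd_one, mul_zero, zpow_zero, Circle.coe_one,
    one_smul, ← mk_eq_inl_mul_inr]

/-- A unital projective representation of `ℤ × ℤ` lies in the *-algebra of its generators. -/
theorem ProjRep.mem_adjoin (R : ProjRep (rotationCocycle θ) A) (hR : R.U 1 = 1)
    (a : Multiplicative ℤ ⋊[(1 : Multiplicative ℤ →* MulAut (Multiplicative ℤ))]
      Multiplicative ℤ) :
    R.U a ∈ StarAlgebra.adjoin ℂ {R.U (inr (ofAdd 1)), R.U (inl (ofAdd 1))} := by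
  set S := StarAlgebra.adjoin ℂ {R.U (inr (ofAdd 1)), R.U (inl (ofAdd 1))} with hS
  -- The exponents whose unitary lies in the *-algebra form a subgroup of `ℤ` that contains `1`.
  let P : Subgroup (Multiplicative ℤ) :=
    { carrier := {h | R.U (inl h) ∈ S}
      one_mem' := by rw [Set.mem_ofPred_eq, map_one, hR]; exact one_mem S
      mul_mem' := fun {a b} ha hb => by
        rw [Set.mem_ofPred_eq, ← R.inl_mul_inl]; exact mul_mem ha hb
      inv_mem' := fun {a} ha => by rw [Set.mem_ofPred_eq, ← R.star_inl]; exact star_mem ha }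
  let Q : Subgroup (Multiplicative ℤ) :=
    { carrier := {k | R.U (inr k) ∈ S}
      one_mem' := by rw [Set.mem_ofPred_eq, map_one, hR]; exact one_mem S
      mul_mem' := fun {a b} ha hb => by
        rw [Set.mem_ofPred_eq, ← R.inr_mul_inr]; exact mul_mem ha hb
      inv_mem' := fun {a} ha => by rw [Set.mem_ofPred_eq, ← R.star_inr]; exact star_mem ha }
  have top (T : Subgroup (Multiplicative ℤ)) (hT : ofAdd 1 ∈ T) (x : Multiplicative ℤ) : x ∈ T := by
    have := T.zpow_mem hT x.toAdd
    rwa [← ofAdd_zsmul, smul_eq_mul, mul_one, ofAdd_toAdd] at this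
  have hP : ofAdd 1 ∈ P := StarAlgebra.subset_adjoin ℂ _ (by simp)
  have hQ : ofAdd 1 ∈ Q := StarAlgebra.subset_adjoin ℂ _ (by simp)
  obtain ⟨h, k⟩ := a
  rw [← R.inl_mul_inr]
  exact mul_mem (top P hP h) (top Q hQ k)

/-- A unital C*-algebra that is densely spanned by a projective representation of `ℤ × ℤ`, through
which every other projective representation factors, is a rotation algebra. -/
theorem isRotationAlgebra_of_lift (R : ProjRep (rotationCocycle θ) A) (hR : R.U 1 = 1)
    (hd : Dense (Set.range R.lin))
    (hl : ∀ (B : Type w) [CStarAlgebra B] (T : ProjRep (rotationCocycle θ) B),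
      ∃ φ : A →⋆ₙₐ[ℂ] B, ∀ a, φ (R.U a) = T.U a) :
    IsRotationAlgebra.{v, w} θ A := by
  have htop : (StarAlgebra.adjoin ℂ
      {R.U (inr (ofAdd 1)), R.U (inl (ofAdd 1))}).topologicalClosure = ⊤ := by
    refine eq_top_iff.2 fun x _ => ?_
    refine closure_mono ?_ (hd x)
    rintro _ ⟨c, rfl⟩
    change R.lin c ∈ StarAlgebra.adjoin ℂ _
    induction c using Finsupp.induction_linear with
    | zero => rw [map_zero]; exact zero_mem _
    | add f g hf hg => rw [map_add]; exact add_mem hf hg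
    | single a z => rw [R.lin_single]; exact SMulMemClass.smul_mem z (R.mem_adjoin hR a)
  refine ⟨R.U (inr (ofAdd 1)), ?_, R.U (inl (ofAdd 1)), ?_, ?_, htop, ?_⟩
  · rw [Unitary.mem_iff, R.star_inr, R.inr_mul_inr, R.inr_mul_inr, inv_mul_cancel, mul_inv_cancel,
      map_one, hR]
    exact ⟨rfl, rfl⟩
  · rw [Unitary.mem_iff, R.star_inl, R.inl_mul_inl, R.inl_mul_inl, inv_mul_cancel, mul_inv_cancel,
      map_one, hR]
    exact ⟨rfl, rfl⟩
  · rw [R.inl_mul_inr, R.U_mul, rotationCocycle_apply, right_inr, left_inl, toAdd_ofAdd, mul_one,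
      zpow_one]
    congr 2
  · intro B _ U' hU V' hV hUV
    let T : ProjRep (rotationCocycle θ) B := .ofUnitaries ⟨U', hU⟩ ⟨V', hV⟩ (Subtype.ext (by
      rw [Submonoid.coe_mul, Submonoid.coe_mul, Submonoid.coe_mul, coe_scalarUnitary, smul_one_mul]
      exact hUV))
    obtain ⟨φ, hφ⟩ := hl B T
    -- The lift is a priori not unital; it is so here because `U 1` is the unit on both sides.
    have h1 : φ 1 = 1 := by
      rw [← hR, hφ]
      change (((⟨V', hV⟩ : unitary B) ^ (0 : ℤ) * (⟨U', hU⟩ : unitary B) ^ (0 : ℤ) :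
        unitary B) : B) = 1
      rw [zpow_zero, zpow_zero, mul_one, OneMemClass.coe_one]
    have hφU : φ (R.U (inr (ofAdd 1))) = U' := by
      rw [hφ]
      change (((⟨V', hV⟩ : unitary B) ^ (0 : ℤ) * (⟨U', hU⟩ : unitary B) ^ (1 : ℤ) :
        unitary B) : B) = U'
      rw [zpow_zero, zpow_one, one_mul]
    have hφV : φ (R.U (inl (ofAdd 1))) = V' := by
      rw [hφ]
      change (((⟨V', hV⟩ : unitary B) ^ (1 : ℤ) * (⟨U', hU⟩ : unitary B) ^ (0 : ℤ) :
        unitary B) : B) = V'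
      rw [zpow_zero, zpow_one, mul_one]
    refine ⟨{ φ with
        map_one' := h1
        commutes' := fun z => by
          change φ (algebraMap ℂ A z) = algebraMap ℂ B z
          rw [Algebra.algebraMap_eq_smul_one, map_smul, h1, Algebra.algebraMap_eq_smul_one] },
      ⟨hφU, hφV⟩, fun ψ hψ => ?_⟩
    refine starAlgHom_ext_of_topologicalClosure htop _ _ ?_
    rintro _ (rfl | rfl)
    · exact hψ.1.trans hφU.symm
    · exact hψ.2.trans hφV.symm

theorem exists_isRotationAlgebra (θ : ℝ) :
    ∃ (A : Type 1) (_ : CStarAlgebra A),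
      IsRotationAlgebra.{1, w} θ A ∧ Nonempty (A ≃⋆ₐ[ℂ] FullCStar (rotationCocycle θ)) := by
  have h₁ (a) : rotationCocycle θ 1 a = 1 := by
    rw [rotationCocycle_apply, one_right, toAdd_one, zero_mul, zpow_zero]
  have h₂ (a) : rotationCocycle θ a 1 = 1 := by
    rw [rotationCocycle_apply, one_left, toAdd_one, mul_zero, zpow_zero]
  have : Countable (Multiplicative ℤ ⋊[(1 : Multiplicative ℤ →* MulAut (Multiplicative ℤ))]
    Multiplicative ℤ) := SemidirectProduct.equivProd.injective.countable
  obtain ⟨A, hA, R, hR, hd, hl, he⟩ := ProjRep.exists_universal_unital h₁ h₂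
  exact ⟨A, hA, isRotationAlgebra_of_lift R hR hd fun B _ T => hl B T, he⟩

end Rotation

end GroupoidCStar

end

/-! ### The main theorem. -/

theorem mainTheorem8 :
    -- the general isomorphism
    (∀ (H : Type u) [CommGroup H] [TopologicalSpace H] [DiscreteTopology H]
        (K : Type v) [CommGroup K] (β : K →* MulAut H)
        (ω : TwoCocycle (ofGroup (H ⋊[β] K))),
        (∀ h h' : H, ω (SemidirectProduct.inl h) (SemidirectProduct.inl h') = 1) →
        (∀ k k' : K, ω (SemidirectProduct.inr k) (SemidirectProduct.inr k') = 1) →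
        ∃ α : K →* (PontryaginDual H ≃ₜ PontryaginDual H),
          (∀ (k : K) (x : PontryaginDual H) (h : H),
            α k x h = ω (SemidirectProduct.inr k⁻¹) (SemidirectProduct.inl h) *
              ω ⟨β k⁻¹ h, k⁻¹⟩ (SemidirectProduct.inr k) * x (β k⁻¹ h)) ∧
          CStarIso ω (TwoCocycle.trivial (transformationGroupoid K (PontryaginDual H) α))) ∧
    -- rotation algebras
    (∀ θ : ℝ,
        ∃ ω : TwoCocycle (ofGroup
            (Multiplicative ℤ ⋊[(1 : Multiplicative ℤ →* MulAut (Multiplicative ℤ))]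
              Multiplicative ℤ)),
          (∀ h k h' k' : ℤ,
            ω ⟨Multiplicative.ofAdd h, Multiplicative.ofAdd k⟩
                ⟨Multiplicative.ofAdd h', Multiplicative.ofAdd k'⟩ =
              Circle.exp (2 * Real.pi * θ * k * h')) ∧
          (∃ (A : Type 1) (_ : CStarAlgebra A),
            IsRotationAlgebra.{1, w} θ A ∧ Nonempty (A ≃⋆ₐ[ℂ] FullCStar ω)) ∧
          ∃ α : Multiplicative ℤ →* (Circle ≃ₜ Circle),
            (∀ (k : ℤ) (z : Circle),
              α (Multiplicative.ofAdd k) z = Circle.exp (-(2 * Real.pi * θ * k)) * z) ∧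
            CStarIso ω (TwoCocycle.trivial (transformationGroupoid (Multiplicative ℤ) Circle α))) ∧
    -- noncommutative solenoids
    (∀ N : ℕ, 1 ≤ N → ∀ a : ℕ → ℝ, a 0 ∈ Set.Ico 0 1 →
        (∀ n, ∃ k : ℕ, k < N ∧ N * a (n + 1) = a n + k) →
        ∃ ω : TwoCocycle (ofGroup
            (Multiplicative (ZInv N) ⋊[(1 : Multiplicative (ZInv N) →*
              MulAut (Multiplicative (ZInv N)))] Multiplicative (ZInv N))),
          (∀ (x y x' y' : ZInv N) (p s : ℤ) (h l : ℕ),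
            (x : ℚ) = p / (N : ℚ) ^ h → (y' : ℚ) = s / (N : ℚ) ^ l →
            ω ⟨Multiplicative.ofAdd x, Multiplicative.ofAdd y⟩
                ⟨Multiplicative.ofAdd x', Multiplicative.ofAdd y'⟩ =
              Circle.exp (2 * Real.pi * a (h + l) * p * s)) ∧
          ∃ α : Multiplicative (ZInv N) →* (Solenoid N ≃ₜ Solenoid N),
            (∀ (y : ZInv N) (p : ℤ) (l : ℕ), (y : ℚ) = p / (N : ℚ) ^ l →
              ∀ (z : Solenoid N) (n : ℕ),
                (α (Multiplicative.ofAdd y) z).1 n =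
                  Circle.exp (2 * Real.pi * a (n + l) * p) * z.1 n) ∧
            CStarIso ω (TwoCocycle.trivial
              (transformationGroupoid (Multiplicative (ZInv N)) (Solenoid N) α))) := by
  refine ⟨fun H _ _ _ K _ β ω h₁ h₂ => exists_cstarIso_pontryaginDual H K β ω ⟨h₁, h₂⟩,
    fun θ => ⟨rotationCocycle θ, fun h k h' k' => rotationPairing_apply θ _ _,
      exists_isRotationAlgebra θ, exists_cstarIso_rotation θ⟩, fun N hN a _ ha => ?_⟩
  -- The recursion for the angles says that `n ↦ e^{2πi a_n}` is a point of the solenoid, that is a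
  -- character of `ℤ[1/N]`; it defines both the cocycle and the action.
  obtain ⟨α, hα, e⟩ := exists_cstarIso_solenoid hN (Solenoid.ofAngles a ha)
  refine ⟨_, fun x y x' y' p s h l hx hy => ?_, α, fun y p l hy z n => ?_, e⟩
  · refine ((Solenoid.ofAngles a ha).pairing_apply hN hx hy).trans ?_
    rw [Solenoid.ofAngles_zpow, Int.cast_mul, ← mul_assoc]
  · rw [hα y p l hy, Solenoid.ofAngles_zpow]
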